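/- Let $p,q\ge 0$, $n=p+q$, and let $\mathbb R^{2p,2q}$ be $\mathbb R^{2n}$ with the metric of matrix $I_{p,q}=\mathrm{diag}(1_{2p},-1_{2q})$. Let $J_{p,q}=\mathrm{diag}(J_p,-J_q)$ with $J_p=\begin{pmatrix}0&-1_p\\1_p&0\end{pmatrix}$, and orient $\mathbb R^{2p,2q}$ by $J_{p,q}$ (a complex structure $J$ induces the orientation of any basis $(v_1,Jv_1,\dots,v_n,Jv_n)$). Let $F_{p,q}$ be the space of real matrices $J$ with $J^2=-1$, $J^TI_{p,q}J=I_{p,q}$, inducing this orientation, with the subspace topology. Let $SO_{2p,2q}$ be the group of the $k$ with $k^TI_{p,q}k=I_{p,q}$ and $\det k=1$, $\mathfrak{so}_{2p,2q}$ its Lie algebra with Killing form $B$, $U_{p,q}$ its subgroup of elements commuting with $J_{p,q}$, and $\mathfrak m_J=\{A\in\mathfrak{so}_{2p,2q}: AJ=-JA\}$. Then: 1. $\sigma(k)=J_{p,q}kJ_{p,q}^T$ is an involutive automorphism of $SO_{2p,2q}$ with fixed subgroup $U_{p,q}$, and $kU_{p,q}\mapsto kJ_{p,q}k^{-1}$ is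 a homeomorphism $SO_{2p,2q}/U_{p,q}\to F_{p,q}$. 2. $F_{p,q}$ carries the structure of a finite-dimensional complex manifold, smoothly embedded in the space of real $2n\times2n$ matrices, such that $T_JF_{p,q}=\mathfrak m_J$ and the complex structure of $T_JF_{p,q}$ is the left multiplication $A\mapsto JA$. 3. For this structure and for every real $c\neq0$, the formula $g_J(X,Y)=c\,B(X,Y)$, $X,Y\in\mathfrak m_J$, defines a pseudo-Kähler metric on $F_{p,q}$ (a smooth nondegenerate symmetric form, Hermitian for the complex structure, with closed fundamental form $\omega_J(X,Y)=g_J(JX,Y)$), for which $F_{p,q}$ is a pseudo-Kähler symmetric space: every point is an isolated fixed point of an involutive holomorphic isometry of $F_{p,q}$ whose differential there is $-\mathrm{id}$. The group $SO_{2p,2q}$ acts on $F_{p,q}$ by holomorphic isometries $J\mapsto kJk^{-1}$, and $kJ_{p,q}k^{-1}\mapsto \sigma(k)J_{p,q}\sigma(k)^{-1}$ is a symmetry at $J_{p,q}$. -/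

import Mathlib

open scoped Manifold ContDiff Matrix Topology Bundle

attribute [local instance 100] LieRing.ofAssociativeRing

noncomputable section

/-! ### Pseudo-Kähler symmetric spaces -/

section General

variable {W : Type*} [NormedAddCommGroup W] [NormedSpace ℂ W]
  {M : Type*} [TopologicalSpace M] [ChartedSpace W M]

/-- The almost complex structure of a complex manifold `M` modelled on `W`: multiplication by `i`
on each real tangent space. -/
def complexStructure (x : M) :
    TangentSpace 𝓘(ℝ, W) x →L[ℝ] TangentSpace 𝓘(ℝ, W) x :=
  (Complex.I • ContinuousLinearMap.id ℝ W : W →L[ℝ] W)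

/-- A field of bilinear forms on the real tangent spaces. -/
abbrev BilinField (W M : Type*) [NormedAddCommGroup W] [NormedSpace ℂ W]
    [TopologicalSpace M] [ChartedSpace W M] :=
  ∀ x : M, TangentSpace 𝓘(ℝ, W) x →L[ℝ] TangentSpace 𝓘(ℝ, W) x →L[ℝ] ℝ

/-- The fundamental form `ω(v, w) = g(iv, w)`. -/
def fundamentalForm (g : BilinField W M) : BilinField W M :=
  fun x => (g x).comp (complexStructure x)

/-- The exterior derivative `dω(X, Y, Z)` of a 2-form, evaluated on three vector fields:
`X ω(Y, Z) + Y ω(Z, X) + Z ω(X, Y) - ω([X, Y], Z) - ω([Y, Z], X) - ω([Z, X], Y)`. -/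
def extDerivTwoForm (ω₂ : BilinField W M) (X Y Z : ∀ x : M, TangentSpace 𝓘(ℝ, W) x) (x : M) : ℝ :=
  mvfderiv 𝓘(ℝ, W) (fun y => ω₂ y (Y y) (Z y)) x (X x)
    + mvfderiv 𝓘(ℝ, W) (fun y => ω₂ y (Z y) (X y)) x (Y x)
    + mvfderiv 𝓘(ℝ, W) (fun y => ω₂ y (X y) (Y y)) x (Z x)
    - ω₂ x (VectorField.mlieBracket 𝓘(ℝ, W) X Y x) (Z x)
    - ω₂ x (VectorField.mlieBracket 𝓘(ℝ, W) Y Z x) (X x)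
    - ω₂ x (VectorField.mlieBracket 𝓘(ℝ, W) Z X x) (Y x)

/-- `g` is a pseudo-Kähler metric on the complex manifold `M`: a smooth pseudo-Riemannian metric,
Hermitian for the complex structure, whose fundamental form is closed. -/
structure IsPseudoKahler [IsManifold 𝓘(ℝ, W) ∞ M] [IsManifold 𝓘(ℂ, W) ω M]
    (g : BilinField W M) : Prop where
  smooth : ContMDiff 𝓘(ℝ, W) (𝓘(ℝ, W).prod 𝓘(ℝ, W →L[ℝ] W →L[ℝ] ℝ)) ∞
    (fun x : M => Bundle.TotalSpace.mk' (W →L[ℝ] W →L[ℝ] ℝ)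
      (E := fun x : M => TangentSpace 𝓘(ℝ, W) x →L[ℝ] TangentSpace 𝓘(ℝ, W) x →L[ℝ] ℝ) x (g x))
  symm : ∀ (x : M) (v w : TangentSpace 𝓘(ℝ, W) x), g x v w = g x w v
  nondegenerate : ∀ (x : M) (v : TangentSpace 𝓘(ℝ, W) x), (∀ w, g x v w = 0) → v = 0
  hermitian : ∀ (x : M) (v w : TangentSpace 𝓘(ℝ, W) x),
    g x (complexStructure x v) (complexStructure x w) = g x v w
  closed : ∀ (x : M) (X Y Z : ∀ y : M, TangentSpace 𝓘(ℝ, W) y),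
    ContMDiffAt 𝓘(ℝ, W) 𝓘(ℝ, W).tangent ∞ (fun y => (⟨y, X y⟩ : TangentBundle 𝓘(ℝ, W) M)) x →
    ContMDiffAt 𝓘(ℝ, W) 𝓘(ℝ, W).tangent ∞ (fun y => (⟨y, Y y⟩ : TangentBundle 𝓘(ℝ, W) M)) x →
    ContMDiffAt 𝓘(ℝ, W) 𝓘(ℝ, W).tangent ∞ (fun y => (⟨y, Z y⟩ : TangentBundle 𝓘(ℝ, W) M)) x →
    extDerivTwoForm (fundamentalForm g) X Y Z x = 0

/-- A map that is holomorphic and preserves the metric `g`. -/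
structure IsHolomorphicIsometry (g : BilinField W M) (s : M → M) : Prop where
  holomorphic : ContMDiff 𝓘(ℂ, W) 𝓘(ℂ, W) ω s
  isometry : ∀ (y : M) (v w : TangentSpace 𝓘(ℝ, W) y),
    g (s y) (mfderiv 𝓘(ℝ, W) 𝓘(ℝ, W) s y v) (mfderiv 𝓘(ℝ, W) 𝓘(ℝ, W) s y w) = g y v w

/-- `s` is a (holomorphic, isometric) symmetry of `M` at the point `x`: an involution with `x` as
an isolated fixed point, whose differential at `x` is `-id`. -/
structure IsSymmetryAt (g : BilinField W M) (x : M) (s : M → M) : Prop where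
  holomorphicIsometry : IsHolomorphicIsometry g s
  involutive : Function.Involutive s
  fixed : s x = x
  isolated : ∀ᶠ y in 𝓝[≠] x, s y ≠ y
  mfderiv_eq : ∀ v : TangentSpace 𝓘(ℝ, W) x,
    (mfderiv 𝓘(ℝ, W) 𝓘(ℝ, W) s x v : W) = -(v : W)

/-- `(M, g)` is a pseudo-Kähler symmetric space: it is pseudo-Kähler and has a symmetry at each
of its points. -/
structure IsPseudoKahlerSymmetricSpace [IsManifold 𝓘(ℝ, W) ∞ M] [IsManifold 𝓘(ℂ, W) ω M]
    (g : BilinField W M) : Prop where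
  pseudoKahler : IsPseudoKahler g
  symmetric : ∀ x : M, ∃ s : M → M, IsSymmetryAt g x s

end General

/-! ### Orthogonal complex structures on `ℝ^{2p,2q}` -/

/-- Index set of the coordinates of `ℝ^{2p,2q}`: `p + p` positive and `q + q` negative ones. -/
abbrev Idx (p q : ℕ) : Type := (Fin p ⊕ Fin p) ⊕ (Fin q ⊕ Fin q)

/-- The matrix `I_{p,q}` of the metric of `ℝ^{2p,2q}`. -/
abbrev Ipq (p q : ℕ) : Matrix (Idx p q) (Idx p q) ℝ :=
  LieAlgebra.Orthogonal.indefiniteDiagonal (Fin p ⊕ Fin p) (Fin q ⊕ Fin q) ℝ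

/-- The complex structure `J_{p,q} = diag(J_p, -J_q)`, where `J_p = (0, -1; 1, 0)`. -/
def Jpq (p q : ℕ) : Matrix (Idx p q) (Idx p q) ℝ :=
  Matrix.fromBlocks (Matrix.J (Fin p) ℝ) 0 0 (-Matrix.J (Fin q) ℝ)

/-- The Lie algebra `so_{2p,2q}`. -/
abbrev soLie (p q : ℕ) : LieSubalgebra ℝ (Matrix (Idx p q) (Idx p q) ℝ) :=
  LieAlgebra.Orthogonal.so' (Fin p ⊕ Fin p) (Fin q ⊕ Fin q) ℝ

/-- The group `SO_{2p,2q}`. -/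
def SO (p q : ℕ) : Subgroup (Matrix.SpecialLinearGroup (Idx p q) ℝ) where
  carrier := {k | (k.1)ᵀ * Ipq p q * k.1 = Ipq p q}
  one_mem' := by simp
  mul_mem' := by
    intro a b ha hb
    simp only [Set.mem_ofPred_eq, Matrix.SpecialLinearGroup.coe_mul] at ha hb ⊢
    calc (a.1 * b.1)ᵀ * Ipq p q * (a.1 * b.1)
        = (b.1)ᵀ * ((a.1)ᵀ * Ipq p q * a.1) * b.1 := by
          simp only [Matrix.transpose_mul, Matrix.mul_assoc]
      _ = Ipq p q := by rw [ha, hb]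
  inv_mem' := by
    intro a ha
    simp only [Set.mem_ofPred_eq] at ha ⊢
    have h : a.1 * (a⁻¹).1 = 1 := by
      rw [← Matrix.SpecialLinearGroup.coe_mul, mul_inv_cancel, Matrix.SpecialLinearGroup.coe_one]
    calc ((a⁻¹).1)ᵀ * Ipq p q * (a⁻¹).1
        = ((a⁻¹).1)ᵀ * ((a.1)ᵀ * Ipq p q * a.1) * (a⁻¹).1 := by rw [ha]
      _ = (a.1 * (a⁻¹).1)ᵀ * Ipq p q * (a.1 * (a⁻¹).1) := by
          simp only [Matrix.transpose_mul, Matrix.mul_assoc]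
      _ = Ipq p q := by rw [h]; simp

/-- The underlying matrix of an element of `SO_{2p,2q}`. -/
abbrev matSO {p q : ℕ} (k : SO p q) : Matrix (Idx p q) (Idx p q) ℝ := k.1.1

/-- The subgroup `U_{p,q}` of `SO_{2p,2q}`: the orthogonal maps that are complex linear
for `J_{p,q}`. -/
def Upq (p q : ℕ) : Subgroup (SO p q) where
  carrier := {k | matSO k * Jpq p q = Jpq p q * matSO k}
  one_mem' := by simp [matSO]
  mul_mem' := by
    intro a b ha hb
    simp only [Set.mem_ofPred_eq, matSO, Subgroup.coe_mul,
      Matrix.SpecialLinearGroup.coe_mul] at ha hb ⊢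
    rw [Matrix.mul_assoc, hb, ← Matrix.mul_assoc, ha, Matrix.mul_assoc]
  inv_mem' := by
    intro a ha
    simp only [Set.mem_ofPred_eq, matSO] at ha ⊢
    have h : a.1.1 * (a⁻¹).1.1 = 1 := by
      rw [← Matrix.SpecialLinearGroup.coe_mul, ← Subgroup.coe_mul, mul_inv_cancel]
      simp
    have h' : (a⁻¹).1.1 * a.1.1 = 1 := by
      rw [← Matrix.SpecialLinearGroup.coe_mul, ← Subgroup.coe_mul, inv_mul_cancel]
      simp
    calc (a⁻¹).1.1 * Jpq p q = (a⁻¹).1.1 * (Jpq p q * a.1.1) * (a⁻¹).1.1 := by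
          rw [Matrix.mul_assoc, Matrix.mul_assoc, h, Matrix.mul_one]
      _ = Jpq p q * (a⁻¹).1.1 := by rw [← ha, ← Matrix.mul_assoc, h', Matrix.one_mul]

/-- A basis `(v_1, J v_1, …, v_n, J v_n)` of `ℝ^{2p,2q}`, `n = p + q`, adapted to `J`. -/
def IsAdaptedBasis {p q : ℕ} (J : Matrix (Idx p q) (Idx p q) ℝ)
    (b : Module.Basis (Fin (p + q) × Fin 2) ℝ (Idx p q → ℝ)) : Prop :=
  ∀ i : Fin (p + q), b (i, 1) = J *ᵥ b (i, 0)

/-- `J` and `J'` induce the same orientation, the orientation induced by a complex structure being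
that of its adapted bases. -/
def InduceSameOrientation {p q : ℕ} (J J' : Matrix (Idx p q) (Idx p q) ℝ) : Prop :=
  ∃ b b' : Module.Basis (Fin (p + q) × Fin 2) ℝ (Idx p q → ℝ),
    IsAdaptedBasis J b ∧ IsAdaptedBasis J' b' ∧ b.orientation = b'.orientation

/-- The space `F_{p,q}` of linear complex structures on `ℝ^{2p,2q}` that preserve the metric and
induce the orientation of `ℝ^{2p,2q}`, namely that of `J_{p,q}`. -/
abbrev Fpq (p q : ℕ) : Type :=
  {J : Matrix (Idx p q) (Idx p q) ℝ //
    J * J = -1 ∧ Jᵀ * Ipq p q * J = Ipq p q ∧ InduceSameOrientation J (Jpq p q)}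

/-- The inclusion of `F_{p,q}` in the space of matrices, seen as the normed space of families of
their entries. -/
def incl {p q : ℕ} (J : Fpq p q) : Idx p q → Idx p q → ℝ := fun i j => J.1 i j

/-- The differential at `J` of the inclusion of `F_{p,q}` in the space of matrices. -/
def dincl {p q : ℕ} {W : Type*} [NormedAddCommGroup W] [NormedSpace ℂ W]
    [ChartedSpace W (Fpq p q)] (J : Fpq p q) (v : TangentSpace 𝓘(ℝ, W) J) :
    Matrix (Idx p q) (Idx p q) ℝ :=
  Matrix.of (mfderiv 𝓘(ℝ, W) 𝓘(ℝ, Idx p q → Idx p q → ℝ) (incl (p := p) (q := q)) J v)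

/-- The space `𝔪_J` of the elements of `so_{2p,2q}` that anticommute with `J`. -/
def mSpace {p q : ℕ} (J : Matrix (Idx p q) (Idx p q) ℝ) : Set (Matrix (Idx p q) (Idx p q) ℝ) :=
  {A | A ∈ soLie p q ∧ A * J = -(J * A)}

end

/-!
The group `SO_{2p,2q}` acts on `F_{p,q}` by conjugation. The action is transitive: an isometric
complex structure `J` admits a pseudo-unitary basis (`exists_pseudoUnitary`), whose numbers of
positive and negative vectors are fixed by Sylvester's law of inertia, so that an isometry `k`
conjugates `J_{p,q}` to `J` (`exists_intertwine`); since `J` induces the orientation of `J_{p,q}`,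
and complex linear maps have positive real determinant, `k` has determinant `1`. The stabilizer of
`J_{p,q}` is `U_{p,q}`, and `σ` is conjugation by `J_{p,q} ∈ SO_{2p,2q}`. The bijection from
`SO_{2p,2q} / U_{p,q}` is a homeomorphism by the open mapping theorem for σ-compact groups acting
transitively on locally compact spaces.

The Cayley transform of `-J_{p,q} J` maps the complex structures `J` near `J_{p,q}` to an open
subset of the space `𝔪` of infinitesimal isometries anticommuting with `J_{p,q}`, with inverse
`A ↦ (1 + A) J_{p,q} (1 + A)⁻¹`. Restriction to the `-i`-eigenspace of `J_{p,q}` turns `𝔪` into a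
complex vector space, `modelSpace`, in such a way that left multiplication by `J_{p,q}` becomes
multiplication by `i`. The translates of this chart under `SO_{2p,2q}` form an atlas. Its
transition maps are holomorphic because, in terms of the `-i`-eigenspaces of the complex
structures, the group acts by fractional linear transformations (`modelMat_baseChart_smul`). The
Cayley transform is also a chart of the space of all matrices, in which `F_{p,q}` is a linear
subspace; this gives the embedding, and differentiating `J k (1 + A) = k (1 + A) J_{p,q}` gives the
tangent spaces (`dincl_eq`).

The Killing form of `so_N` is `N - 2` times the trace form (`killingForm_soLie`), so `c B` induces
the metric `C tr(XY)` with `C = c (N - 2)`. It is invariant, Hermitian, and nondegenerate, since the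
projection of the space of matrices onto `𝔪_J` is self-adjoint for the trace form; when `N = 2` the
constant `C` vanishes, but then `𝔪_J = 0`. The fundamental form is `C tr(J X Y)`. In its exterior
derivative, the derivatives of the vector fields cancel because tangent vectors anticommute with
`J`, with the brackets computed in the space of matrices (`mvfderiv_mlieBracket`), and what remains
is a sum of traces `tr(X Y Z)`, which vanish because `X Y Z` anticommutes with `J`.

The symmetry at `J` is the action of `J` itself. It acts on `𝔪_J` as `A ↦ J A J⁻¹ = -A`, and its
fixed points commute with `J`, so that `J` is isolated among them. At `J_{p,q}` this is the map
induced by `σ`.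
-/
noncomputable section
/-! ### Linear complex structures and orientations -/

/-- A real matrix commuting with a complex structure is complex linear, so that its real
determinant is the squared modulus of its complex determinant. -/
theorem det_pos_of_commute_complexStructure {ι : Type*} [Fintype ι] [DecidableEq ι]
    {J T : Matrix ι ι ℝ} (hJ : J * J = -1) (hT : T * J = J * T) (h0 : T.det ≠ 0) :
    0 < T.det := by
  let φ : ℂ →ₐ[ℝ] Module.End ℝ (ι → ℝ) := Complex.lift ⟨Matrix.toLin' J, by
    rw [Module.End.mul_eq_comp, ← Matrix.toLin'_mul, hJ]; simp; rfl⟩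
  let : Module ℂ (ι → ℝ) := Module.compHom _ φ.toRingHom
  have hsmul : ∀ (z : ℂ) (v : ι → ℝ), z • v = φ z v := fun _ _ => rfl
  have : IsScalarTower ℝ ℂ (ι → ℝ) := ⟨fun r z v => by
    simp [hsmul]⟩
  have : Module.Finite ℂ (ι → ℝ) := Module.Finite.of_restrictScalars_finite ℝ ℂ _
  let f : (ι → ℝ) →ₗ[ℂ] (ι → ℝ) :=
    { toFun := fun v => T *ᵥ v
      map_add' := fun v w => Matrix.mulVec_add _ _ _
      map_smul' := fun z v => by
        have : T *ᵥ (J *ᵥ v) = J *ᵥ (T *ᵥ v) := by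
          rw [Matrix.mulVec_mulVec, hT, Matrix.mulVec_mulVec]
        simp [hsmul, φ, Complex.lift_apply, Complex.liftAux_apply, Matrix.mulVec_add,
          Matrix.mulVec_smul, this] }
  have h1 : f.restrictScalars ℝ = Matrix.toLin' T := by
    ext v; rfl
  have h2 := LinearMap.det_restrictScalars (R := ℝ) (S := ℂ) (f := f)
  rw [h1, LinearMap.det_toLin', Algebra.norm_complex_eq] at h2
  have h3 : 0 ≤ T.det := by
    rw [h2]; exact Complex.normSq_nonneg _
  exact lt_of_le_of_ne h3 (Ne.symm h0)

variable {p q : ℕ}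

/-- The orientation induced by a complex structure is transported by positive linear maps. -/
theorem InduceSameOrientation.of_intertwine {J J' K M : Matrix (Idx p q) (Idx p q) ℝ}
    (h : InduceSameOrientation J' K) (hM : 0 < M.det) (hJ : J * M = M * J') :
    InduceSameOrientation J K := by
  obtain ⟨b, b', hb, hb', ho⟩ := h
  let f : (Idx p q → ℝ) ≃ₗ[ℝ] (Idx p q → ℝ) :=
    LinearEquiv.ofIsUnitDet (f := Matrix.toLin' M) (v := Pi.basisFun ℝ _) (v' := Pi.basisFun ℝ _)
      (by rw [LinearMap.toMatrix_eq_toMatrix', LinearMap.toMatrix'_toLin']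
          exact isUnit_iff_ne_zero.2 hM.ne')
  have hf : ∀ v, f v = M *ᵥ v := fun v => rfl
  refine ⟨b.map f, b', fun i => ?_, hb', ?_⟩
  · simp only [Module.Basis.map_apply, hf, hb i, Matrix.mulVec_mulVec, hJ]
  · have hb : ⇑(b.map f) = (f : (Idx p q → ℝ) →ₗ[ℝ] (Idx p q → ℝ)) ∘ b := by
      ext; simp
    rw [← ho, eq_comm, Module.Basis.orientation_eq_iff_det_pos, hb, Module.Basis.det_comp,
      Module.Basis.det_self, mul_one]
    have : LinearMap.det (f : (Idx p q → ℝ) →ₗ[ℝ] (Idx p q → ℝ)) = M.det := by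
      have : (f : (Idx p q → ℝ) →ₗ[ℝ] (Idx p q → ℝ)) = Matrix.toLin' M := by ext; rfl
      rw [this, LinearMap.det_toLin']
    exact this ▸ hM

/-- A linear map that intertwines complex structures inducing the same orientation preserves the
orientation: it differs from the map between adapted bases by a complex linear map. -/
theorem InduceSameOrientation.det_pos {J K M : Matrix (Idx p q) (Idx p q) ℝ}
    (h : InduceSameOrientation J K) (hJJ : J * J = -1) (hKK : K * K = -1) (hM : M.det ≠ 0)
    (hJ : J * M = M * K) : 0 < M.det := by
  obtain ⟨b, b', hb, hb', ho⟩ := h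
  let f : (Idx p q → ℝ) ≃ₗ[ℝ] (Idx p q → ℝ) := b'.equiv b (Equiv.refl _)
  let T : Matrix (Idx p q) (Idx p q) ℝ := LinearMap.toMatrix' (f : (Idx p q → ℝ) →ₗ[ℝ] _)
  have hTf : ∀ v, T *ᵥ v = f v := fun v => LinearMap.toMatrix'_mulVec _ _
  have hfb : ∀ a, f (b' a) = b a := fun a => by simp [f]
  have hT : 0 < T.det := by
    have h1 : (⇑b : Fin (p + q) × Fin 2 → _) = (f : (Idx p q → ℝ) →ₗ[ℝ] _) ∘ b' :=
      funext fun a => (hfb a).symm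
    rw [eq_comm, Module.Basis.orientation_eq_iff_det_pos, h1, Module.Basis.det_comp,
      Module.Basis.det_self, mul_one] at ho
    rwa [LinearMap.det_toMatrix']
  have hTK : J * T = T * K := by
    apply Matrix.toLin'.injective
    refine b'.ext fun a => ?_
    obtain ⟨i, t⟩ := a
    simp only [Matrix.toLin'_apply, ← Matrix.mulVec_mulVec, hTf]
    fin_cases t
    · simp only [Fin.zero_eta, hfb, ← hb' i, ← hb i]
    · simp only [Fin.mk_one, hfb, hb i]
      rw [hb' i, Matrix.mulVec_mulVec, Matrix.mulVec_mulVec, hJJ, hKK, Matrix.neg_mulVec,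
        Matrix.one_mulVec, Matrix.neg_mulVec, Matrix.one_mulVec, map_neg, hfb]
  have hMu : IsUnit M.det := isUnit_iff_ne_zero.2 hM
  have h2 : 0 < (M⁻¹ * T).det := by
    apply det_pos_of_commute_complexStructure hKK
    · calc M⁻¹ * T * K = M⁻¹ * (J * M) * M⁻¹ * T := by
            rw [Matrix.mul_assoc, ← hTK, Matrix.mul_assoc M⁻¹ (J * M), Matrix.mul_assoc J M,
              Matrix.mul_nonsing_inv _ hMu, Matrix.mul_one, Matrix.mul_assoc]
        _ = K * (M⁻¹ * T) := by
            rw [hJ, ← Matrix.mul_assoc, Matrix.nonsing_inv_mul _ hMu, Matrix.one_mul,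
              Matrix.mul_assoc]
    · rw [Matrix.det_mul]
      exact mul_ne_zero (by simpa [Matrix.det_nonsing_inv] using hM) hT.ne'
  have h3 : T.det = M.det * (M⁻¹ * T).det := by
    rw [← Matrix.det_mul, ← Matrix.mul_assoc, Matrix.mul_nonsing_inv _ hMu, Matrix.one_mul]
  rw [h3] at hT
  exact pos_of_mul_pos_left hT h2.le

/-! ### The base point -/

theorem Jpq_mulVec_posL (i : Fin p) :
    Jpq p q *ᵥ Pi.single (Sum.inl (Sum.inl i)) 1 = Pi.single (Sum.inl (Sum.inr i)) 1 := by
  ext ((a | a) | (a | a)) <;>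
    simp [Jpq, Matrix.J, Matrix.fromBlocks, Matrix.one_apply, Pi.single_apply]

theorem Jpq_mulVec_posR (i : Fin p) :
    Jpq p q *ᵥ Pi.single (Sum.inl (Sum.inr i)) 1 = -Pi.single (Sum.inl (Sum.inl i)) 1 := by
  ext ((a | a) | (a | a)) <;>
    simp [Jpq, Matrix.J, Matrix.fromBlocks, Matrix.one_apply, Pi.single_apply]

theorem Jpq_mulVec_negL (i : Fin q) :
    Jpq p q *ᵥ Pi.single (Sum.inr (Sum.inl i)) 1 = -Pi.single (Sum.inr (Sum.inr i)) 1 := by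
  ext ((a | a) | (a | a)) <;>
    simp [Jpq, Matrix.J, Matrix.fromBlocks, Matrix.one_apply, Pi.single_apply]

theorem Jpq_mulVec_negR (i : Fin q) :
    Jpq p q *ᵥ Pi.single (Sum.inr (Sum.inr i)) 1 = Pi.single (Sum.inr (Sum.inl i)) 1 := by
  ext ((a | a) | (a | a)) <;>
    simp [Jpq, Matrix.J, Matrix.fromBlocks, Matrix.one_apply, Pi.single_apply]

theorem Jpq_mul_self : Jpq p q * Jpq p q = -1 := by
  simp [Jpq, Matrix.fromBlocks_multiply, Matrix.J_squared, ← Matrix.fromBlocks_one,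
    Matrix.fromBlocks_neg]

theorem Jpq_transpose : (Jpq p q)ᵀ = -Jpq p q := by
  simp [Jpq, Matrix.fromBlocks_transpose, Matrix.J_transpose, Matrix.fromBlocks_neg]

theorem Ipq_eq_fromBlocks : Ipq p q = Matrix.fromBlocks 1 0 0 (-1) := by
  ext (a | a) (b | b) <;>
    simp [LieAlgebra.Orthogonal.indefiniteDiagonal, Matrix.fromBlocks, Matrix.diagonal_apply,
      Matrix.one_apply]
  split_ifs <;> simp

theorem Ipq_mul_self : Ipq p q * Ipq p q = 1 := by
  simp [Ipq_eq_fromBlocks, Matrix.fromBlocks_multiply]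

theorem Ipq_transpose : (Ipq p q)ᵀ = Ipq p q := by
  simp [Ipq_eq_fromBlocks, Matrix.fromBlocks_transpose]

theorem Jpq_isometry : (Jpq p q)ᵀ * Ipq p q * Jpq p q = Ipq p q := by
  simp [Jpq, Ipq_eq_fromBlocks, Matrix.fromBlocks_transpose, Matrix.fromBlocks_multiply,
    Matrix.J_transpose, Matrix.J_squared]

/-- The permuted standard basis `(v₁, J v₁, …, vₙ, J vₙ)` for `J = J_{p,q}`: on the negative part
`J_{p,q}` maps the second half of the coordinate vectors to the first one. -/
def adaptedIdxEquiv (p q : ℕ) : Idx p q ≃ Fin (p + q) × Fin 2 where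
  toFun := Sum.elim
    (Sum.elim (fun i => (Fin.castAdd q i, 0)) (fun i => (Fin.castAdd q i, 1)))
    (Sum.elim (fun j => (Fin.natAdd p j, 1)) (fun j => (Fin.natAdd p j, 0)))
  invFun a := Fin.addCases
    (fun i => Sum.inl (if a.2 = 0 then Sum.inl i else Sum.inr i))
    (fun j => Sum.inr (if a.2 = 0 then Sum.inr j else Sum.inl j)) a.1
  left_inv := by rintro ((i | i) | (i | i)) <;> simp
  right_inv := by
    rintro ⟨i, t⟩
    refine Fin.addCases (fun i => ?_) (fun j => ?_) i <;> fin_cases t <;> simp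

theorem induceSameOrientation_Jpq : InduceSameOrientation (Jpq p q) (Jpq p q) := by
  let b := (Pi.basisFun ℝ (Idx p q)).reindex (adaptedIdxEquiv p q)
  have hb : IsAdaptedBasis (Jpq p q) b := by
    intro i
    refine Fin.addCases (fun i => ?_) (fun j => ?_) i
    · simpa [b, adaptedIdxEquiv] using (Jpq_mulVec_posL i).symm
    · simpa [b, adaptedIdxEquiv] using (Jpq_mulVec_negR j).symm
  exact ⟨b, b, hb, hb, rfl⟩

/-- The base point `J_{p,q}` of `F_{p,q}`. -/
def basePt (p q : ℕ) : Fpq p q :=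
  ⟨Jpq p q, Jpq_mul_self, Jpq_isometry, induceSameOrientation_Jpq⟩

/-! ### Unitary bases and transitivity -/

section UnitaryBasis

variable {V : Type*} [AddCommGroup V] [Module ℝ V]

/-- A pseudo-unitary family for a nondegenerate form with an isometric complex structure extends by
a vector, as long as it is not a basis: the orthogonal complement of its complex span is nonzero
and nondegenerate, hence contains a vector that is not isotropic. -/
theorem exists_orthogonal_unit [FiniteDimensional ℝ V] (B : V →ₗ[ℝ] V →ₗ[ℝ] ℝ)
    (hs : ∀ x y, B x y = B y x) (hnd : ∀ x, (∀ y, B x y = 0) → x = 0) {α : Type*} [Fintype α]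
    [DecidableEq α]
    (u : α → V) (ε : α → ℝ) (hε : ∀ a, ε a * ε a = 1)
    (hu : ∀ a b, B (u a) (u b) = if a = b then ε a else 0)
    (hcard : Fintype.card α < Module.finrank ℝ V) :
    ∃ w, (B w w = 1 ∨ B w w = -1) ∧ ∀ a, B w (u a) = 0 := by
  -- `x - ∑ ε_b B(x, u_b) u_b` is the orthogonal projection of `x` away from the `u_b`
  have hproj : ∀ x a, B (x - ∑ b, (ε b * B x (u b)) • u b) (u a) = 0 := by
    intro x a
    simp only [map_sub, map_sum, map_smul, LinearMap.sub_apply, LinearMap.sum_apply,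
      LinearMap.smul_apply, hu, smul_eq_mul, mul_ite, mul_zero, Finset.sum_ite_eq', Finset.mem_univ,
      if_true]
    have := hε a
    linear_combination (-B x (u a)) * this
  obtain ⟨w, hw0, hw⟩ : ∃ w, w ≠ 0 ∧ ∀ a, B w (u a) = 0 := by
    let f : V →ₗ[ℝ] (α → ℝ) := LinearMap.pi fun a => B.flip (u a)
    have hf : LinearMap.ker f ≠ ⊥ := by
      apply LinearMap.ker_ne_bot_of_finrank_lt
      simpa using hcard
    obtain ⟨w, hw, hw0⟩ := Submodule.exists_mem_ne_zero_of_ne_bot hf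
    exact ⟨w, hw0, fun a => congrFun (LinearMap.mem_ker.1 hw) a⟩
  -- if all vectors of the complement were isotropic, `w` would be orthogonal to everything
  obtain ⟨w', hw', hne⟩ : ∃ w', (∀ a, B w' (u a) = 0) ∧ B w' w' ≠ 0 := by
    by_contra! h
    apply hw0
    apply hnd
    intro y
    have h1 : ∀ z, (∀ a, B z (u a) = 0) → B w z = 0 := by
      intro z hz
      have h2 := h (w + z) fun a => by rw [map_add, LinearMap.add_apply, hw, hz, add_zero]
      simp only [map_add, LinearMap.add_apply, h w hw, h z hz] at h2
      rw [hs z w] at h2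
      linarith
    have h3 := h1 _ (hproj y)
    simpa [map_sub, map_sum, hw] using h3
  refine ⟨(Real.sqrt |B w' w'|)⁻¹ • w', ?_, fun a => by simp [hw']⟩
  have hpos : 0 < |B w' w'| := abs_pos.2 hne
  have hsq : Real.sqrt |B w' w'| * Real.sqrt |B w' w'| = |B w' w'| := Real.mul_self_sqrt hpos.le
  have hval : B ((Real.sqrt |B w' w'|)⁻¹ • w') ((Real.sqrt |B w' w'|)⁻¹ • w')
      = (|B w' w'|)⁻¹ * B w' w' := by
    simp only [map_smul, LinearMap.smul_apply, smul_eq_mul]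
    rw [← mul_assoc, ← mul_inv, hsq]
  rw [hval]
  rcases lt_or_gt_of_ne hne with h | h
  · right; rw [abs_of_neg h]; field_simp
  · left; rw [abs_of_pos h]; field_simp

/-- The family `(v₁, J v₁, v₂, J v₂, …)`. -/
def withJ (J : V →ₗ[ℝ] V) {α : Type*} (v : α → V) (a : α × Fin 2) : V :=
  if a.2 = 0 then v a.1 else J (v a.1)

/-- A nondegenerate form with an isometric complex structure has a pseudo-unitary basis. -/
theorem exists_pseudoUnitary [FiniteDimensional ℝ V] (B : V →ₗ[ℝ] V →ₗ[ℝ] ℝ)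
    (hs : ∀ x y, B x y = B y x) (hnd : ∀ x, (∀ y, B x y = 0) → x = 0) (J : V →ₗ[ℝ] V)
    (hJJ : ∀ x, J (J x) = -x) (hJ : ∀ x y, B (J x) (J y) = B x y) (n : ℕ) :
    2 * n ≤ Module.finrank ℝ V →
    ∃ (v : Fin n → V) (ε : Fin n → ℝ), (∀ i, ε i = 1 ∨ ε i = -1) ∧
      ∀ a b, B (withJ J v a) (withJ J v b) = if a = b then ε a.1 else 0 := by
  have hskew : ∀ x y, B (J x) y = -B x (J y) := fun x y => by
    rw [← hJ x (J y), hJJ, map_neg, neg_neg]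
  have hself : ∀ x, B (J x) x = 0 := fun x => by
    have := hskew x x
    rw [hs x (J x)] at this
    linarith
  induction n with
  | zero => exact fun _ => ⟨Fin.elim0, Fin.elim0, fun i => i.elim0, fun a => a.1.elim0⟩
  | succ n ih =>
    intro hn
    obtain ⟨v, ε, hε, hv⟩ := ih (by omega)
    obtain ⟨w, hw, hwv⟩ := exists_orthogonal_unit B hs hnd (withJ J v) (fun a => ε a.1)
      (fun a => by rcases hε a.1 with h | h <;> simp [h]) hv (by simp; omega)
    have hw0 : ∀ i, B w (v i) = 0 := fun i => by simpa [withJ] using hwv (i, 0)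
    have hw1 : ∀ i, B w (J (v i)) = 0 := fun i => by simpa [withJ] using hwv (i, 1)
    refine ⟨Fin.snoc v w, Fin.snoc ε (B w w), fun i => ?_, fun a b => ?_⟩
    · refine Fin.lastCases ?_ (fun i => ?_) i <;> simp [hw, hε]
    · obtain ⟨i, s⟩ := a
      obtain ⟨j, t⟩ := b
      have hv0 : ∀ i, B (v i) w = 0 := fun i => by rw [hs, hw0]
      have hv1 : ∀ i, B (J (v i)) w = 0 := fun i => by rw [hs, hw1]
      have hw2 : ∀ i, B (J w) (v i) = 0 := fun i => by rw [hskew, hw1, neg_zero]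
      have hv2 : ∀ i, B (v i) (J w) = 0 := fun i => by rw [hs, hw2]
      refine Fin.lastCases ?_ (fun i => ?_) i <;> refine Fin.lastCases ?_ (fun j => ?_) j
      · fin_cases s <;> fin_cases t <;> simp [withJ, hJ, hself]
        rw [hs, hself]
      · fin_cases s <;> fin_cases t <;>
          simp [withJ, hJ, hw0, hw1, hw2, (Fin.castSucc_lt_last j).ne']
      · fin_cases s <;> fin_cases t <;>
          simp [withJ, hJ, hv0, hv1, hv2, (Fin.castSucc_lt_last i).ne]
      · have := hv (i, s) (j, t)
        simpa [withJ] using this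

/-- Half of Sylvester's law of inertia: an orthonormal family has at most as many vectors as the
codimension of a subspace on which the form is nonpositive. -/
theorem card_le_of_nonpos_on_ker {U : Type*} [AddCommGroup U] [Module ℝ U] [FiniteDimensional ℝ U]
    (B : V →ₗ[ℝ] V →ₗ[ℝ] ℝ) {α : Type*} [Fintype α] [DecidableEq α] (u : α → V)
    (hu : ∀ a b, B (u a) (u b) = if a = b then 1 else 0) (r : V →ₗ[ℝ] U)
    (hr : ∀ x, r x = 0 → B x x ≤ 0) : Fintype.card α ≤ Module.finrank ℝ U := by
  let f : (α → ℝ) →ₗ[ℝ] U := r ∘ₗ Fintype.linearCombination ℝ u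
  have hf : Function.Injective f := by
    rw [← LinearMap.ker_eq_bot, LinearMap.ker_eq_bot']
    intro c hc
    have h1 := hr _ hc
    have h2 : B (Fintype.linearCombination ℝ u c) (Fintype.linearCombination ℝ u c)
        = ∑ a, c a * c a := by
      simp [Fintype.linearCombination_apply, hu]
    rw [h2] at h1
    have h3 := (Finset.sum_eq_zero_iff_of_nonneg (fun a _ => mul_self_nonneg (c a))).1
      (le_antisymm h1 (Finset.sum_nonneg fun a _ => mul_self_nonneg (c a)))
    ext a
    exact mul_self_eq_zero.1 (h3 a (Finset.mem_univ a))
  simpa using LinearMap.finrank_le_finrank_of_injective hf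

end UnitaryBasis

/-- The metric of `ℝ^{2p,2q}` as a bilinear form. -/
def metricForm (p q : ℕ) : (Idx p q → ℝ) →ₗ[ℝ] (Idx p q → ℝ) →ₗ[ℝ] ℝ :=
  Matrix.toLinearMap₂' ℝ (Ipq p q)

theorem metricForm_apply (x y : Idx p q → ℝ) :
    metricForm p q x y = x ⬝ᵥ Ipq p q *ᵥ y := by
  simp [metricForm, Matrix.toLinearMap₂'_apply']

theorem metricForm_eq (x y : Idx p q → ℝ) :
    metricForm p q x y 
      = ∑ i, x (Sum.inl i) * y (Sum.inl i) - ∑ j, x (Sum.inr j) * y (Sum.inr j) := by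
  rw [metricForm_apply, Ipq_eq_fromBlocks]
  simp [dotProduct, Matrix.fromBlocks_mulVec, Fintype.sum_sum_type, Matrix.neg_mulVec]
  ring

/-- Every isometric complex structure is conjugate to `J_{p,q}` under the isometries of
`ℝ^{2p,2q}`: a pseudo-unitary basis contains `p` positive complex lines and `q` negative ones, by
Sylvester's law of inertia, and `k` maps the standard basis to it. -/
theorem exists_intertwine {J : Matrix (Idx p q) (Idx p q) ℝ} (hJJ : J * J = -1)
    (hJ : Jᵀ * Ipq p q * J = Ipq p q) :
    ∃ k : Matrix (Idx p q) (Idx p q) ℝ, kᵀ * Ipq p q * k = Ipq p q ∧ J * k = k * Jpq p q := by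
  classical
  set B := metricForm p q with hB
  have hs : ∀ x y, B x y = B y x := fun x y => by
    simp only [hB, metricForm_eq, mul_comm]
  have hnd : ∀ x, (∀ y, B x y = 0) → x = 0 := by
    intro x hx
    have h1 : x ᵥ* Ipq p q = 0 := by
      ext i
      have := hx (Pi.single i 1)
      rwa [hB, metricForm_apply, Matrix.dotProduct_mulVec, dotProduct_single_one] at this
    have h2 : x ᵥ* Ipq p q ᵥ* Ipq p q = 0 := by rw [h1, Matrix.zero_vecMul]
    rwa [Matrix.vecMul_vecMul, Ipq_mul_self, Matrix.vecMul_one] at h2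
  have hJB : ∀ x y, B (Matrix.toLin' J x) (Matrix.toLin' J y) = B x y := by
    intro x y
    simp only [hB, metricForm_apply, Matrix.toLin'_apply]
    rw [Matrix.mulVec_mulVec, Matrix.dotProduct_mulVec, ← Matrix.mulVec_transpose,
      Matrix.mulVec_mulVec, Matrix.transpose_mul, Ipq_transpose, hJ, ← Ipq_transpose,
      Matrix.mulVec_transpose, ← Matrix.dotProduct_mulVec, Ipq_transpose]
  have hJJ' : ∀ x, Matrix.toLin' J (Matrix.toLin' J x) = -x := fun x => by
    simp [Matrix.mulVec_mulVec, hJJ, Matrix.neg_mulVec]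
  obtain ⟨v, ε, hε, hv⟩ := exists_pseudoUnitary B hs hnd (Matrix.toLin' J) hJJ' hJB (p + q)
    (by simp; omega)
  have hP : Fintype.card {i // ε i = 1} ≤ p := by
    have := card_le_of_nonpos_on_ker B
      (u := fun a : {i // ε i = 1} × Fin 2 => withJ (Matrix.toLin' J) v (a.1.1, a.2))
      (fun a b => by
        rw [hv, a.1.2]
        congr 1
        simp [Prod.ext_iff, Subtype.ext_iff])
      (LinearMap.funLeft ℝ ℝ (Sum.inl : Fin p ⊕ Fin p → Idx p q)) (fun x hx => by
        have hx' : ∀ i, x (Sum.inl i) = 0 := fun i => congrFun hx i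
        rw [hB, metricForm_eq]
        simp only [hx', mul_zero, Finset.sum_const_zero, zero_sub, neg_nonpos]
        exact Finset.sum_nonneg fun i _ => mul_self_nonneg _)
    simp only [Fintype.card_prod, Fintype.card_fin, Module.finrank_fintype_fun_eq_card,
      Fintype.card_sum] at this
    omega
  have hN : Fintype.card {i // ε i = -1} ≤ q := by
    have := card_le_of_nonpos_on_ker (-B)
      (u := fun a : {i // ε i = -1} × Fin 2 => withJ (Matrix.toLin' J) v (a.1.1, a.2))
      (fun a b => by
        rw [LinearMap.neg_apply, LinearMap.neg_apply, hv, a.1.2]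
        simp only [Prod.ext_iff, Subtype.ext_iff]
        split_ifs <;> simp)
      (LinearMap.funLeft ℝ ℝ (Sum.inr : Fin q ⊕ Fin q → Idx p q)) (fun x hx => by
        have hx' : ∀ i, x (Sum.inr i) = 0 := fun i => congrFun hx i
        rw [LinearMap.neg_apply, LinearMap.neg_apply, hB, metricForm_eq]
        simp only [hx', mul_zero, Finset.sum_const_zero, sub_zero, neg_nonpos]
        exact Finset.sum_nonneg fun i _ => mul_self_nonneg _)
    simp only [Fintype.card_prod, Fintype.card_fin, Module.finrank_fintype_fun_eq_card,
      Fintype.card_sum] at this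
    omega
  have hPN : Fintype.card {i // ε i = 1} + Fintype.card {i // ε i = -1} = p + q := by
    have h1 : ∀ i, ε i = -1 ↔ ¬ ε i = 1 := fun i => by
      rcases hε i with h | h <;> rw [h] <;> norm_num
    rw [Fintype.card_congr (Equiv.subtypeEquivRight h1), Fintype.card_subtype_compl]
    have := Fintype.card_subtype_le fun i => ε i = 1
    simp only [Fintype.card_fin] at this ⊢
    omega
  let eP : Fin p ≃ {i // ε i = 1} := (Fintype.equivFinOfCardEq (by omega)).symm
  let eN : Fin q ≃ {i // ε i = -1} := (Fintype.equivFinOfCardEq (by omega)).symm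
  -- the column index of `k`, chosen so that `J k = k J_{p,q}`: on the negative part, `J_{p,q}` maps the second half
  -- of the coordinate vectors to the first one
  let a : Idx p q → Fin (p + q) × Fin 2 := Sum.elim
    (Sum.elim (fun i => ((eP i).1, 0)) (fun i => ((eP i).1, 1)))
    (Sum.elim (fun j => ((eN j).1, 1)) (fun j => ((eN j).1, 0)))
  let col : Idx p q → Idx p q → ℝ := fun c => withJ (Matrix.toLin' J) v (a c)
  let k : Matrix (Idx p q) (Idx p q) ℝ := Matrix.of fun r c => col c r
  have hk : ∀ c, k *ᵥ Pi.single c 1 = col c := fun c => by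
    rw [Matrix.mulVec_single_one]; rfl
  have ha : Function.Injective a := by
    rintro ((i | i) | (i | i)) ((j | j) | (j | j)) h <;>
      simp only [a, Sum.elim_inl, Sum.elim_inr, Prod.mk.injEq, Fin.isValue, one_ne_zero,
        zero_ne_one, and_false, and_true, Subtype.val_inj, EmbeddingLike.apply_eq_iff_eq] at h
    any_goals rw [h]
    all_goals
      first
      | (have h1 := (eP i).2; have h2 := (eN j).2; rw [h, h2] at h1; norm_num at h1)
      | (have h1 := (eN i).2; have h2 := (eP j).2; rw [h, h2] at h1; norm_num at h1)
  refine ⟨k, ?_, ?_⟩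
  · ext c d
    have h1 : (kᵀ * Ipq p q * k) c d = B (col c) (col d) := by
      rw [hB, metricForm_apply, Matrix.mul_assoc, Matrix.mul_apply]
      rfl
    rw [h1]
    simp only [col]
    rw [hv]
    rcases eq_or_ne c d with rfl | hcd
    · rcases c with ((i | i) | (i | i)) <;>
        simp [a, (eP _).2, (eN _).2, LieAlgebra.Orthogonal.indefiniteDiagonal]
    · rw [if_neg (ha.ne hcd)]
      simp [LieAlgebra.Orthogonal.indefiniteDiagonal, hcd]
  · apply Matrix.toLin'.injective
    refine (Pi.basisFun ℝ (Idx p q)).ext fun c => ?_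
    simp only [Pi.basisFun_apply, Matrix.toLin'_apply, ← Matrix.mulVec_mulVec, hk]
    have hJm : ∀ x, J *ᵥ (J *ᵥ x) = -x := hJJ'
    rcases c with ((i | i) | (i | i))
    · rw [Jpq_mulVec_posL, hk]; simp [col, a, withJ]
    · rw [Jpq_mulVec_posR, Matrix.mulVec_neg, hk]; simp [col, a, withJ, hJm, -Matrix.mulVec_mulVec]
    · rw [Jpq_mulVec_negL, Matrix.mulVec_neg, hk]; simp [col, a, withJ, hJm, -Matrix.mulVec_mulVec]
    · rw [Jpq_mulVec_negR, hk]; simp [col, a, withJ]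

/-! ### The action of the orthogonal group -/

theorem matSO_mul (k l : SO p q) : matSO (k * l) = matSO k * matSO l := rfl

theorem matSO_one : matSO (1 : SO p q) = 1 := rfl

@[simp]
theorem matSO_mul_inv (k : SO p q) : matSO k * matSO k⁻¹ = 1 := by
  rw [← matSO_mul, mul_inv_cancel, matSO_one]

@[simp]
theorem matSO_inv_mul (k : SO p q) : matSO k⁻¹ * matSO k = 1 := by
  rw [← matSO_mul, inv_mul_cancel, matSO_one]

theorem matSO_mul_inv_assoc (k : SO p q) (X : Matrix (Idx p q) (Idx p q) ℝ) :
    matSO k * (matSO k⁻¹ * X) = X := by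
  rw [← Matrix.mul_assoc, matSO_mul_inv, Matrix.one_mul]

theorem matSO_inv_mul_assoc (k : SO p q) (X : Matrix (Idx p q) (Idx p q) ℝ) :
    matSO k⁻¹ * (matSO k * X) = X := by
  rw [← Matrix.mul_assoc, matSO_inv_mul, Matrix.one_mul]

theorem matSO_isometry (k : SO p q) : (matSO k)ᵀ * Ipq p q * matSO k = Ipq p q := k.2

theorem det_matSO (k : SO p q) : (matSO k).det = 1 := k.1.2

theorem matSO_injective : Function.Injective (matSO : SO p q → _) :=
  fun _ _ h => Subtype.ext (Subtype.ext h)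

theorem det_eq_one_of_isometry {k : Matrix (Idx p q) (Idx p q) ℝ}
    (hk : kᵀ * Ipq p q * k = Ipq p q) (hpos : 0 < k.det) : k.det = 1 := by
  have h1 : (Ipq p q).det ≠ 0 := by
    intro h
    have := congrArg Matrix.det (Ipq_mul_self (p := p) (q := q))
    rw [Matrix.det_mul, h] at this
    simp at this
  have h2 := congrArg Matrix.det hk
  rw [Matrix.det_mul, Matrix.det_mul, Matrix.det_transpose] at h2
  have h3 : (Ipq p q).det * (k.det * k.det - 1) = 0 := by linear_combination h2
  have h4 := (mul_eq_zero.1 h3).resolve_left h1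
  nlinarith

theorem det_ne_zero_of_isometry {k : Matrix (Idx p q) (Idx p q) ℝ}
    (hk : kᵀ * Ipq p q * k = Ipq p q) : k.det ≠ 0 := by
  intro h
  have h1 := congrArg Matrix.det hk
  have h2 := congrArg Matrix.det (Ipq_mul_self (p := p) (q := q))
  rw [Matrix.det_mul, h, mul_zero] at h1
  rw [Matrix.det_mul, ← h1] at h2
  simp at h2

/-- An isometry of positive determinant, as an element of `SO_{2p,2q}`. -/
def mkSO (k : Matrix (Idx p q) (Idx p q) ℝ) (hk : kᵀ * Ipq p q * k = Ipq p q) (hpos : 0 < k.det) :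
    SO p q :=
  ⟨⟨k, det_eq_one_of_isometry hk hpos⟩, hk⟩

theorem Fpq_mul_self (J : Fpq p q) : J.1 * J.1 = -1 := J.2.1

theorem Fpq_isometry (J : Fpq p q) : J.1ᵀ * Ipq p q * J.1 = Ipq p q := J.2.2.1

/-- A complex structure in `F_{p,q}`, as an element of `SO_{2p,2q}`. -/
def Fpq.toSO (J : Fpq p q) : SO p q :=
  mkSO J.1 (Fpq_isometry J)
    (det_pos_of_commute_complexStructure (Fpq_mul_self J) rfl
      (det_ne_zero_of_isometry (Fpq_isometry J)))

@[simp]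
theorem Fpq.matSO_toSO (J : Fpq p q) : matSO J.toSO = J.1 := rfl

theorem matSO_inv_eq_of_mul {k : SO p q} {X : Matrix (Idx p q) (Idx p q) ℝ}
    (h : matSO k * X = 1) : matSO k⁻¹ = X := by
  rw [← matSO_inv_mul_assoc k X, h, Matrix.mul_one]

@[simp]
theorem Fpq.matSO_toSO_inv (J : Fpq p q) : matSO J.toSO⁻¹ = -J.1 :=
  matSO_inv_eq_of_mul (by rw [Fpq.matSO_toSO, Matrix.mul_neg, Fpq_mul_self, neg_neg])

theorem conj_mul_conj (k : SO p q) (X Y : Matrix (Idx p q) (Idx p q) ℝ) :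
    (matSO k * X * matSO k⁻¹) * (matSO k * Y * matSO k⁻¹) = matSO k * (X * Y) * matSO k⁻¹ := by
  simp only [Matrix.mul_assoc, matSO_inv_mul_assoc]

theorem isometry_mul {k l : Matrix (Idx p q) (Idx p q) ℝ} (hk : kᵀ * Ipq p q * k = Ipq p q)
    (hl : lᵀ * Ipq p q * l = Ipq p q) : (k * l)ᵀ * Ipq p q * (k * l) = Ipq p q := by
  calc (k * l)ᵀ * Ipq p q * (k * l) = lᵀ * (kᵀ * Ipq p q * k) * l := by
        simp only [Matrix.transpose_mul, Matrix.mul_assoc]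
    _ = Ipq p q := by rw [hk, hl]

/-- `SO_{2p,2q}` acts on `F_{p,q}` by conjugation. -/
instance instMulActionSOFpq : MulAction (SO p q) (Fpq p q) where
  smul k J := ⟨matSO k * J.1 * matSO k⁻¹, by
      rw [conj_mul_conj, Fpq_mul_self]; simp,
    isometry_mul (isometry_mul (matSO_isometry k) (Fpq_isometry J)) (matSO_isometry k⁻¹),
    J.2.2.2.of_intertwine (M := matSO k) (by rw [det_matSO]; exact one_pos) (by
      rw [Matrix.mul_assoc, matSO_inv_mul, Matrix.mul_one])⟩
  one_smul J := Subtype.ext (by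
    change matSO 1 * J.1 * matSO 1⁻¹ = J.1
    rw [inv_one, matSO_one, Matrix.one_mul, Matrix.mul_one])
  mul_smul k l J := Subtype.ext (by
    change matSO (k * l) * J.1 * matSO (k * l)⁻¹
      = matSO k * (matSO l * J.1 * matSO l⁻¹) * matSO k⁻¹
    rw [mul_inv_rev, matSO_mul, matSO_mul]
    simp only [Matrix.mul_assoc])

theorem coe_smul_Fpq (k : SO p q) (J : Fpq p q) :
    (k • J).1 = matSO k * J.1 * matSO k⁻¹ := rfl

theorem exists_smul_basePt (J : Fpq p q) : ∃ k : SO p q, k • basePt p q = J := by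
  obtain ⟨k, hk, hJk⟩ := exists_intertwine (Fpq_mul_self J) (Fpq_isometry J)
  have hpos := J.2.2.2.det_pos (Fpq_mul_self J) Jpq_mul_self (det_ne_zero_of_isometry hk) hJk
  refine ⟨mkSO k hk hpos, Subtype.ext ?_⟩
  change k * Jpq p q * matSO (mkSO k hk hpos)⁻¹ = J.1
  rw [← hJk, Matrix.mul_assoc]
  exact (congrArg _ (matSO_mul_inv (mkSO k hk hpos))).trans (Matrix.mul_one _)

instance instIsPretransitiveSOFpq : MulAction.IsPretransitive (SO p q) (Fpq p q) :=
  MulAction.isPretransitive_iff_base (basePt p q) |>.2 exists_smul_basePt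

theorem smul_eq_self_iff (k : SO p q) (J : Fpq p q) :
    k • J = J ↔ matSO k * J.1 = J.1 * matSO k := by
  rw [Subtype.ext_iff, coe_smul_Fpq]
  constructor
  · intro h
    calc matSO k * J.1 = (matSO k * J.1 * matSO k⁻¹) * matSO k := by
          rw [Matrix.mul_assoc, matSO_inv_mul, Matrix.mul_one]
      _ = J.1 * matSO k := by rw [h]
  · intro h
    rw [h, Matrix.mul_assoc, matSO_mul_inv, Matrix.mul_one]

theorem stabilizer_basePt : MulAction.stabilizer (SO p q) (basePt p q) = Upq p q := by
  ext k
  rw [MulAction.mem_stabilizer_iff, smul_eq_self_iff]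
  rfl

/-- The involution `σ(k) = J_{p,q} k J_{p,q}ᵀ`, which is conjugation by `J_{p,q}`. -/
def sigma (p q : ℕ) : SO p q ≃* SO p q := MulAut.conj (basePt p q).toSO

theorem sigma_apply (k : SO p q) :
    sigma p q k = (basePt p q).toSO * k * (basePt p q).toSO⁻¹ := rfl

theorem matSO_sigma (k : SO p q) :
    matSO (sigma p q k) = Jpq p q * matSO k * (Jpq p q)ᵀ := by
  rw [sigma_apply, matSO_mul, matSO_mul, Fpq.matSO_toSO, Fpq.matSO_toSO_inv, Jpq_transpose]
  rfl

theorem sigma_sigma (k : SO p q) : sigma p q (sigma p q k) = k := by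
  apply matSO_injective
  rw [matSO_sigma, matSO_sigma, Jpq_transpose]
  calc Jpq p q * (Jpq p q * matSO k * -Jpq p q) * -Jpq p q
      = (Jpq p q * Jpq p q) * matSO k * (Jpq p q * Jpq p q) := by
        simp only [Matrix.mul_assoc, Matrix.mul_neg, Matrix.neg_mul, neg_neg]
    _ = matSO k := by rw [Jpq_mul_self]; simp

theorem sigma_eq_self_iff (k : SO p q) : sigma p q k = k ↔ k ∈ Upq p q := by
  rw [sigma_apply, mul_inv_eq_iff_eq_mul, ← matSO_injective.eq_iff, eq_comm]
  rfl

/-! ### The Cayley transform -/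

/-- The Cayley transform of `-J_{p,q} X`. It maps a complex structure `X` near `J_{p,q}` to the
element `A` of `𝔪` with `X = (1 + A) J_{p,q} (1 + A)⁻¹`. -/
def cayley (X : Matrix (Idx p q) (Idx p q) ℝ) : Matrix (Idx p q) (Idx p q) ℝ :=
  (1 + Jpq p q * X) * (1 - Jpq p q * X)⁻¹

/-- The inverse of `cayley`. It equals `(1 + A) J_{p,q} (1 + A)⁻¹` when `A` anticommutes with
`J_{p,q}`. -/
def cayleyInv (A : Matrix (Idx p q) (Idx p q) ℝ) : Matrix (Idx p q) (Idx p q) ℝ :=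
  Jpq p q * (1 - A) * (1 + A)⁻¹

theorem Jpq_mul_Jpq_mul (X : Matrix (Idx p q) (Idx p q) ℝ) :
    Jpq p q * (Jpq p q * X) = -X := by
  rw [← Matrix.mul_assoc, Jpq_mul_self, Matrix.neg_mul, Matrix.one_mul]

theorem mul_right_cancel_of_det_ne_zero {ι : Type*} [Fintype ι] [DecidableEq ι]
    {P X Y : Matrix ι ι ℝ} (hP : P.det ≠ 0) (h : X * P = Y * P) : X = Y :=
  ((Matrix.isUnit_iff_isUnit_det P).2 (isUnit_iff_ne_zero.2 hP)).mul_right_cancel h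

theorem mul_left_cancel_of_det_ne_zero {ι : Type*} [Fintype ι] [DecidableEq ι]
    {P X Y : Matrix ι ι ℝ} (hP : P.det ≠ 0) (h : P * X = P * Y) : X = Y :=
  ((Matrix.isUnit_iff_isUnit_det P).2 (isUnit_iff_ne_zero.2 hP)).mul_left_cancel h

theorem cayley_mul {X : Matrix (Idx p q) (Idx p q) ℝ} (hX : (1 - Jpq p q * X).det ≠ 0) :
    cayley X * (1 - Jpq p q * X) = 1 + Jpq p q * X := by
  rw [cayley, Matrix.mul_assoc, Matrix.nonsing_inv_mul _ (isUnit_iff_ne_zero.2 hX), Matrix.mul_one]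

theorem cayleyInv_mul {A : Matrix (Idx p q) (Idx p q) ℝ} (hA : (1 + A).det ≠ 0) :
    cayleyInv A * (1 + A) = Jpq p q * (1 - A) := by
  rw [cayleyInv, Matrix.mul_assoc, Matrix.nonsing_inv_mul _ (isUnit_iff_ne_zero.2 hA),
    Matrix.mul_one]

theorem one_add_cayley_mul {X : Matrix (Idx p q) (Idx p q) ℝ} (hX : (1 - Jpq p q * X).det ≠ 0) :
    (1 + cayley X) * (1 - Jpq p q * X) = (2 : ℝ) • 1 := by
  rw [add_mul, cayley_mul hX, two_smul]
  noncomm_ring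

theorem one_sub_cayleyInv_mul {A : Matrix (Idx p q) (Idx p q) ℝ} (hA : (1 + A).det ≠ 0) :
    (1 - Jpq p q * cayleyInv A) * (1 + A) = (2 : ℝ) • 1 := by
  rw [sub_mul, Matrix.mul_assoc, cayleyInv_mul hA, Jpq_mul_Jpq_mul, two_smul]
  noncomm_ring

theorem det_pos_of_mul_eq_two {ι : Type*} [Fintype ι] [DecidableEq ι] {X Y : Matrix ι ι ℝ}
    (h : X * Y = (2 : ℝ) • 1) (hY : 0 < Y.det) : 0 < X.det := by
  have h1 := congrArg Matrix.det h
  rw [Matrix.det_mul, Matrix.det_smul, Matrix.det_one, mul_one] at h1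
  have h2 : 0 < X.det * Y.det := by rw [h1]; positivity
  exact pos_of_mul_pos_left h2 hY.le

theorem det_one_add_cayley_pos {X : Matrix (Idx p q) (Idx p q) ℝ}
    (hX : 0 < (1 - Jpq p q * X).det) : 0 < (1 + cayley X).det :=
  det_pos_of_mul_eq_two (one_add_cayley_mul hX.ne') hX

theorem det_one_sub_cayleyInv_pos {A : Matrix (Idx p q) (Idx p q) ℝ}
    (hA : 0 < (1 + A).det) : 0 < (1 - Jpq p q * cayleyInv A).det :=
  det_pos_of_mul_eq_two (one_sub_cayleyInv_mul hA.ne') hA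

theorem cayley_cayleyInv {A : Matrix (Idx p q) (Idx p q) ℝ} (hA : 0 < (1 + A).det) :
    cayley (cayleyInv A) = A := by
  have h1 := det_one_sub_cayleyInv_pos hA
  apply mul_right_cancel_of_det_ne_zero h1.ne'
  rw [cayley_mul h1.ne']
  apply mul_right_cancel_of_det_ne_zero hA.ne'
  rw [Matrix.mul_assoc A, one_sub_cayleyInv_mul hA.ne', add_mul, Matrix.mul_assoc,
    cayleyInv_mul hA.ne', Jpq_mul_Jpq_mul, Matrix.mul_smul, Matrix.mul_one, two_smul]
  noncomm_ring

theorem cayleyInv_cayley {X : Matrix (Idx p q) (Idx p q) ℝ} (hX : 0 < (1 - Jpq p q * X).det) :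
    cayleyInv (cayley X) = X := by
  have h1 := det_one_add_cayley_pos hX
  apply mul_right_cancel_of_det_ne_zero h1.ne'
  rw [cayleyInv_mul h1.ne']
  apply mul_right_cancel_of_det_ne_zero hX.ne'
  rw [Matrix.mul_assoc X, one_add_cayley_mul hX.ne', Matrix.mul_assoc, sub_mul,
    cayley_mul hX.ne', Matrix.mul_smul, Matrix.mul_one, Matrix.one_mul]
  have : 1 - Jpq p q * X - (1 + Jpq p q * X) = -((2 : ℝ) • (Jpq p q * X)) := by
    rw [two_smul]; abel
  rw [this, Matrix.mul_neg, Matrix.mul_smul, Jpq_mul_Jpq_mul, smul_neg, neg_neg]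

theorem mem_soLie_iff {A : Matrix (Idx p q) (Idx p q) ℝ} :
    A ∈ soLie p q ↔ Aᵀ * Ipq p q = -(Ipq p q * A) := by
  rw [soLie, LieAlgebra.Orthogonal.so', mem_skewAdjointMatricesLieSubalgebra,
    mem_skewAdjointMatricesSubmodule, Matrix.IsSkewAdjoint, Matrix.IsAdjointPair, Matrix.mul_neg]

theorem mem_mSpace_iff {A J : Matrix (Idx p q) (Idx p q) ℝ} :
    A ∈ mSpace J ↔ Aᵀ * Ipq p q = -(Ipq p q * A) ∧ A * J = -(J * A) := by
  rw [← mem_soLie_iff]; rfl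

theorem cayley_mem_mSpace (J : Fpq p q) (hJ : (1 - Jpq p q * J.1).det ≠ 0) :
    cayley J.1 ∈ mSpace (Jpq p q) := by
  revert hJ
  obtain ⟨X, hX, hXI, -⟩ := J
  intro hJ
  dsimp only at hJ ⊢
  set A := cayley X
  have hAP : A * (1 - Jpq p q * X) = 1 + Jpq p q * X := cayley_mul hJ
  rw [mem_mSpace_iff]
  constructor
  · have hS : (Jpq p q * X)ᵀ * Ipq p q * (Jpq p q * X) = Ipq p q := isometry_mul Jpq_isometry hXI
    set S := Jpq p q * X
    have hAP' : (1 - S)ᵀ * Aᵀ = (1 + S)ᵀ := by rw [← Matrix.transpose_mul, hAP]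
    apply mul_right_cancel_of_det_ne_zero hJ
    apply mul_left_cancel_of_det_ne_zero (P := (1 - S)ᵀ) (by rwa [Matrix.det_transpose])
    calc (1 - S)ᵀ * (Aᵀ * Ipq p q * (1 - S)) = (1 + S)ᵀ * Ipq p q * (1 - S) := by
          rw [← hAP']; simp only [Matrix.mul_assoc]
      _ = -((1 - S)ᵀ * Ipq p q * (1 + S)) := by
          simp only [Matrix.transpose_add, Matrix.transpose_sub, Matrix.transpose_one, add_mul,
            sub_mul, mul_add, mul_sub, Matrix.one_mul, Matrix.mul_one, hS]
          abel
      _ = (1 - S)ᵀ * (-(Ipq p q * A) * (1 - S)) := by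
          rw [← hAP]; simp only [Matrix.mul_assoc, Matrix.neg_mul, Matrix.mul_neg]
  · -- the factors of the Cayley transform intertwine `X` with `±J_{p,q}`
    have h1 : (1 - Jpq p q * X) * X = Jpq p q * (1 - Jpq p q * X) := by
      rw [sub_mul, mul_sub, Matrix.mul_assoc, hX, Jpq_mul_Jpq_mul]; noncomm_ring
    have h2 : (1 + Jpq p q * X) * X = -(Jpq p q * (1 + Jpq p q * X)) := by
      rw [add_mul, mul_add, Matrix.mul_assoc, hX, Jpq_mul_Jpq_mul]; noncomm_ring
    apply mul_right_cancel_of_det_ne_zero hJ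
    rw [Matrix.mul_assoc, ← h1, ← Matrix.mul_assoc, hAP, h2, Matrix.neg_mul, Matrix.mul_assoc, hAP]

theorem cayleyInv_mul_of_mem {A : Matrix (Idx p q) (Idx p q) ℝ} (hA : A ∈ mSpace (Jpq p q))
    (h : (1 + A).det ≠ 0) : cayleyInv A * (1 + A) = (1 + A) * Jpq p q := by
  rw [cayleyInv_mul h, add_mul, mul_sub, (mem_mSpace_iff.1 hA).2, Matrix.one_mul, Matrix.mul_one,
    sub_eq_add_neg]

/-- The complex structure with a given Cayley transform. -/
def ofCayley (A : Matrix (Idx p q) (Idx p q) ℝ) (hA : A ∈ mSpace (Jpq p q))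
    (h : 0 < (1 + A).det) : Fpq p q :=
  ⟨cayleyInv A, by
    have h1 := cayleyInv_mul_of_mem hA h.ne'
    obtain ⟨hA1, hA2⟩ := mem_mSpace_iff.1 hA
    refine ⟨?_, ?_, induceSameOrientation_Jpq.of_intertwine h h1⟩
    · apply mul_right_cancel_of_det_ne_zero h.ne'
      rw [Matrix.mul_assoc, h1, ← Matrix.mul_assoc, h1, Matrix.mul_assoc, Jpq_mul_self]
      noncomm_ring
    · have h1' : (1 + A)ᵀ * (cayleyInv A)ᵀ = (Jpq p q)ᵀ * (1 + A)ᵀ := by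
        rw [← Matrix.transpose_mul, h1, Matrix.transpose_mul]
      have hR : (1 + A)ᵀ * Ipq p q * (1 + A) = Ipq p q - Ipq p q * (A * A) := by
        rw [Matrix.transpose_add, Matrix.transpose_one, add_mul, hA1]; noncomm_ring
      have hAA : A * A * Jpq p q = Jpq p q * (A * A) := by
        rw [Matrix.mul_assoc, hA2, Matrix.mul_neg, ← Matrix.mul_assoc, hA2, Matrix.neg_mul, neg_neg,
          Matrix.mul_assoc]
      apply mul_right_cancel_of_det_ne_zero h.ne'
      apply mul_left_cancel_of_det_ne_zero (P := (1 + A)ᵀ)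
        (by rw [Matrix.det_transpose]; exact h.ne')
      calc (1 + A)ᵀ * ((cayleyInv A)ᵀ * Ipq p q * cayleyInv A * (1 + A))
          = ((1 + A)ᵀ * (cayleyInv A)ᵀ) * Ipq p q * (cayleyInv A * (1 + A)) := by
            simp only [Matrix.mul_assoc]
        _ = (Jpq p q)ᵀ * ((1 + A)ᵀ * Ipq p q * (1 + A)) * Jpq p q := by
            rw [h1, h1']; simp only [Matrix.mul_assoc]
        _ = (Jpq p q)ᵀ * Ipq p q * Jpq p q - (Jpq p q)ᵀ * Ipq p q * (A * A * Jpq p q) := by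
            rw [hR]; noncomm_ring
        _ = (1 + A)ᵀ * Ipq p q * (1 + A) := by
            rw [hAA, ← Matrix.mul_assoc _ (Jpq p q) (A * A), Jpq_isometry, hR]
        _ = (1 + A)ᵀ * (Ipq p q * (1 + A)) := Matrix.mul_assoc _ _ _⟩

/-! ### The complex model space -/

/-- The complexification of a real matrix. -/
abbrev cx (A : Matrix (Idx p q) (Idx p q) ℝ) : Matrix (Idx p q) (Idx p q) ℂ :=
  Complex.ofRealHom.mapMatrix A

theorem cx_mul (A B : Matrix (Idx p q) (Idx p q) ℝ) : cx (A * B) = cx A * cx B := map_mul _ A B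

theorem cx_add (A B : Matrix (Idx p q) (Idx p q) ℝ) : cx (A + B) = cx A + cx B := map_add _ A B

theorem cx_sub (A B : Matrix (Idx p q) (Idx p q) ℝ) : cx (A - B) = cx A - cx B := map_sub _ A B

theorem cx_one : cx (1 : Matrix (Idx p q) (Idx p q) ℝ) = 1 := map_one _

/-- The model space of `F_{p,q}`: the complex infinitesimal isometries that map the
`-i`-eigenspace of `J_{p,q}` to its `i`-eigenspace and vanish on the latter. -/
def modelSpace (p q : ℕ) : Submodule ℂ (Idx p q → Idx p q → ℂ) where
  carrier := {Z | cx (Jpq p q) * Matrix.of Z = Complex.I • Matrix.of Z ∧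
    Matrix.of Z * cx (Jpq p q) = -(Complex.I • Matrix.of Z) ∧
    (Matrix.of Z)ᵀ * cx (Ipq p q) = -(cx (Ipq p q) * Matrix.of Z)}
  zero_mem' := by
    have : Matrix.of (0 : Idx p q → Idx p q → ℂ) = 0 := rfl
    simp [this]
  add_mem' := by
    rintro a b ⟨ha1, ha2, ha3⟩ ⟨hb1, hb2, hb3⟩
    have : Matrix.of (a + b) = Matrix.of a + Matrix.of b := rfl
    refine ⟨?_, ?_, ?_⟩
    · rw [this, mul_add, ha1, hb1, smul_add]
    · rw [this, add_mul, ha2, hb2, smul_add, neg_add]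
    · rw [this, Matrix.transpose_add, add_mul, ha3, hb3, mul_add, neg_add]
  smul_mem' := by
    rintro c a ⟨ha1, ha2, ha3⟩
    have : Matrix.of (c • a) = c • Matrix.of a := rfl
    refine ⟨?_, ?_, ?_⟩
    · rw [this, Matrix.mul_smul, ha1, smul_comm]
    · rw [this, Matrix.smul_mul, ha2, smul_neg, smul_comm]
    · rw [this, Matrix.transpose_smul, Matrix.smul_mul, ha3, smul_neg, Matrix.mul_smul]

/-- A vector of the model space as a complex matrix. -/
abbrev modelMat (Z : modelSpace p q) : Matrix (Idx p q) (Idx p q) ℂ := Matrix.of Z.1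

/-- The real infinitesimal isometry `Z + Z̄`. This identifies the model space with the space `𝔪`
of the infinitesimal isometries that anticommute with `J_{p,q}`. -/
def twoRe : modelSpace p q →ₗ[ℝ] Matrix (Idx p q) (Idx p q) ℝ where
  toFun Z := Matrix.of fun i j => 2 * (Z.1 i j).re
  map_add' Z Z' := by ext i j; simp; ring
  map_smul' c Z := by ext i j; simp; ring

theorem re_cx_mul (A : Matrix (Idx p q) (Idx p q) ℝ) (Z : Matrix (Idx p q) (Idx p q) ℂ) :
    (cx A * Z).map Complex.re = A * Z.map Complex.re := by
  ext i j
  simp [Matrix.mul_apply]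

theorem re_mul_cx (A : Matrix (Idx p q) (Idx p q) ℝ) (Z : Matrix (Idx p q) (Idx p q) ℂ) :
    (Z * cx A).map Complex.re = Z.map Complex.re * A := by
  ext i j
  simp [Matrix.mul_apply]

theorem twoRe_eq (Z : modelSpace p q) :
    twoRe Z = (2 : ℝ) • (modelMat Z).map Complex.re := by
  ext i j; simp [twoRe]

/-- Multiplication by `i` on the model space is left multiplication by `J_{p,q}` on `𝔪`. -/
theorem twoRe_I_smul (Z : modelSpace p q) :
    twoRe (Complex.I • Z) = Jpq p q * twoRe Z := by
  rw [twoRe_eq, twoRe_eq, Matrix.mul_smul, ← re_cx_mul, Z.2.1]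
  rfl

theorem twoRe_mem (Z : modelSpace p q) : twoRe Z ∈ mSpace (Jpq p q) := by
  rw [mem_mSpace_iff]
  constructor
  · rw [twoRe_eq, Matrix.transpose_smul, Matrix.smul_mul, Matrix.mul_smul, ← smul_neg,
      ← re_cx_mul, ← Matrix.transpose_map, ← re_mul_cx, Z.2.2.2]
    congr 1
  · rw [← twoRe_I_smul, twoRe_eq, twoRe_eq, Matrix.smul_mul, ← re_mul_cx, Z.2.2.1]
    ext i j; simp

/-- The projection onto the `-i`-eigenspace of `J_{p,q}`. -/
def projNeg (p q : ℕ) : Matrix (Idx p q) (Idx p q) ℂ :=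
  (1 / 2 : ℂ) • (1 + Complex.I • cx (Jpq p q))

/-- The projection onto the `i`-eigenspace of `J_{p,q}`. -/
def projPos (p q : ℕ) : Matrix (Idx p q) (Idx p q) ℂ :=
  (1 / 2 : ℂ) • (1 - Complex.I • cx (Jpq p q))

theorem cx_Jpq_mul_self : cx (Jpq p q) * cx (Jpq p q) = -1 := by
  rw [← map_mul, Jpq_mul_self, map_neg, map_one]

theorem two_smul_projNeg_mul (X : Matrix (Idx p q) (Idx p q) ℂ) :
    (2 : ℂ) • (projNeg p q * X) = X + Complex.I • (cx (Jpq p q) * X) := by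
  rw [projNeg, Matrix.smul_mul, smul_smul, add_mul, Matrix.one_mul, Matrix.smul_mul,
    show (2 : ℂ) * (1 / 2) = 1 by norm_num, one_smul]

theorem two_smul_projPos_mul (X : Matrix (Idx p q) (Idx p q) ℂ) :
    (2 : ℂ) • (projPos p q * X) = X - Complex.I • (cx (Jpq p q) * X) := by
  rw [projPos, Matrix.smul_mul, smul_smul, sub_mul, Matrix.one_mul, Matrix.smul_mul,
    show (2 : ℂ) * (1 / 2) = 1 by norm_num, one_smul]

theorem projNeg_add_projPos : projNeg p q + projPos p q = 1 := by
  rw [projNeg, projPos, ← smul_add, add_add_sub_cancel, ← two_smul ℂ, smul_smul]; norm_num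

theorem cx_Jpq_mul_projNeg : cx (Jpq p q) * projNeg p q = -(Complex.I • projNeg p q) := by
  rw [projNeg, Matrix.mul_smul, mul_add, Matrix.mul_smul, cx_Jpq_mul_self, smul_comm, ← smul_neg,
    smul_add Complex.I, smul_smul Complex.I, Complex.I_mul_I]
  congr 1
  rw [Matrix.mul_one, smul_neg, neg_smul, one_smul]
  abel

theorem projNeg_mul_of_commute {N : Matrix (Idx p q) (Idx p q) ℝ}
    (h : N * Jpq p q = Jpq p q * N) : cx N * projNeg p q = projNeg p q * cx N := by
  rw [projNeg, Matrix.mul_smul, Matrix.smul_mul, mul_add, add_mul, Matrix.mul_smul, Matrix.smul_mul,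
    ← map_mul, ← map_mul, h, Matrix.mul_one, Matrix.one_mul]

theorem projPos_eq : projPos p q = 1 - projNeg p q := by
  rw [← projNeg_add_projPos (p := p) (q := q), add_sub_cancel_left]

theorem projNeg_mul_self : projNeg p q * projNeg p q = projNeg p q := by
  nth_rewrite 1 [projNeg]
  rw [Matrix.smul_mul, add_mul, Matrix.smul_mul, cx_Jpq_mul_projNeg, smul_neg, smul_smul,
    Complex.I_mul_I, neg_smul, one_smul, neg_neg, Matrix.one_mul, ← two_smul ℂ, smul_smul]
  norm_num

theorem projNeg_mul_projPos : projNeg p q * projPos p q = 0 := by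
  rw [projPos_eq, mul_sub, projNeg_mul_self, Matrix.mul_one, sub_self]

theorem projPos_mul_projNeg : projPos p q * projNeg p q = 0 := by
  rw [projPos_eq, sub_mul, projNeg_mul_self, Matrix.one_mul, sub_self]

theorem projPos_mul_self : projPos p q * projPos p q = projPos p q := by
  nth_rewrite 1 [projPos_eq]
  rw [sub_mul, projNeg_mul_projPos, Matrix.one_mul, sub_zero]

theorem modelMat_mul_projNeg (Z : modelSpace p q) : modelMat Z * projNeg p q = modelMat Z := by
  rw [projNeg, Matrix.mul_smul, mul_add, Matrix.mul_smul, Z.2.2.1, smul_neg, smul_smul,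
    Complex.I_mul_I, neg_smul, one_smul, neg_neg, Matrix.mul_one, ← two_smul ℂ, smul_smul]
  norm_num

theorem re_projNeg : (projNeg p q).map Complex.re = (1 / 2 : ℝ) • 1 := by
  ext i j
  simp [projNeg, Matrix.one_apply]
  split_ifs <;> simp

/-- The restriction of `A ∈ 𝔪` to the `-i`-eigenspace of `J_{p,q}`, as a vector of the model
space. The junk value, when this restriction is not in the model space, is `0`. -/
def toModel (A : Matrix (Idx p q) (Idx p q) ℝ) : modelSpace p q :=
  open Classical in
  if h : cx A * projNeg p q ∈ modelSpace p q then ⟨cx A * projNeg p q, h⟩ else 0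

theorem cx_mul_projNeg_mem {A : Matrix (Idx p q) (Idx p q) ℝ} (hA : A ∈ mSpace (Jpq p q)) :
    cx A * projNeg p q ∈ modelSpace p q := by
  obtain ⟨h1, h2⟩ := mem_mSpace_iff.1 hA
  have h1' : (cx A)ᵀ * cx (Ipq p q) = -(cx (Ipq p q) * cx A) := by
    have : (cx A)ᵀ = cx Aᵀ := by ext i j; simp
    rw [this, ← map_mul, h1, map_neg, map_mul]
  have h2' : cx A * cx (Jpq p q) = -(cx (Jpq p q) * cx A) := by
    rw [← map_mul, h2, map_neg, map_mul]
  have hJ3 : projNeg p q * cx (Jpq p q) = -(Complex.I • projNeg p q) := by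
    rw [← projNeg_mul_of_commute rfl, cx_Jpq_mul_projNeg]
  have hIJ : (projNeg p q)ᵀ * cx (Ipq p q) = cx (Ipq p q) * projPos p q := by
    have h3 : (Jpq p q)ᵀ * Ipq p q = -(Ipq p q * Jpq p q) := by
      have := congrArg (· * Jpq p q) (Jpq_isometry (p := p) (q := q))
      simp only [Matrix.mul_assoc, Jpq_mul_self] at this
      rw [← this]; simp
    have h4 : (cx (Jpq p q))ᵀ * cx (Ipq p q) = -(cx (Ipq p q) * cx (Jpq p q)) := by
      have : (cx (Jpq p q))ᵀ = cx (Jpq p q)ᵀ := by ext i j; simp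
      rw [this, ← map_mul, h3, map_neg, map_mul]
    rw [projNeg, projPos, Matrix.transpose_smul, Matrix.transpose_add, Matrix.transpose_smul,
      Matrix.transpose_one, Matrix.smul_mul, Matrix.mul_smul, add_mul, mul_sub, Matrix.smul_mul, h4,
      Matrix.mul_smul, smul_neg, Matrix.one_mul, Matrix.mul_one, sub_eq_add_neg]
  have hAP : projPos p q * cx A = cx A * projNeg p q := by
    rw [projNeg, projPos, Matrix.smul_mul, Matrix.mul_smul, sub_mul, mul_add, Matrix.smul_mul,
      Matrix.mul_smul, h2', smul_neg, Matrix.one_mul, Matrix.mul_one, sub_eq_add_neg]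
  refine ⟨?_, ?_, ?_⟩
  · change cx (Jpq p q) * (cx A * projNeg p q) = Complex.I • (cx A * projNeg p q)
    have : cx (Jpq p q) * cx A = -(cx A * cx (Jpq p q)) := by rw [h2', neg_neg]
    rw [← Matrix.mul_assoc, this, Matrix.neg_mul, Matrix.mul_assoc, cx_Jpq_mul_projNeg,
      Matrix.mul_neg, Matrix.mul_smul, neg_neg]
  · change cx A * projNeg p q * cx (Jpq p q) = -(Complex.I • (cx A * projNeg p q))
    rw [Matrix.mul_assoc, hJ3, Matrix.mul_neg, Matrix.mul_smul]
  · change (cx A * projNeg p q)ᵀ * cx (Ipq p q) = -(cx (Ipq p q) * (cx A * projNeg p q))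
    rw [Matrix.transpose_mul, Matrix.mul_assoc, h1', Matrix.mul_neg, ← Matrix.mul_assoc, hIJ,
      Matrix.mul_assoc, hAP]

theorem modelMat_toModel {A : Matrix (Idx p q) (Idx p q) ℝ} (hA : A ∈ mSpace (Jpq p q)) :
    modelMat (toModel A) = cx A * projNeg p q := by
  rw [toModel, dif_pos (cx_mul_projNeg_mem hA)]
  rfl

theorem twoRe_toModel {A : Matrix (Idx p q) (Idx p q) ℝ} (hA : A ∈ mSpace (Jpq p q)) :
    twoRe (toModel A) = A := by
  rw [twoRe_eq, modelMat_toModel hA, re_cx_mul, re_projNeg, Matrix.mul_smul, smul_smul,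
    Matrix.mul_one]
  norm_num

theorem twoRe_injective : Function.Injective (twoRe : modelSpace p q → _) := by
  rw [injective_iff_map_eq_zero]
  intro Z hZ
  have h1 : ∀ Z : modelSpace p q, twoRe Z = 0 → ∀ i j, (Z.1 i j).re = 0 := by
    intro Z h i j
    have := congrFun (congrFun h i) j
    simpa [twoRe] using this
  have h2 : twoRe (Complex.I • Z) = 0 := by rw [twoRe_I_smul, hZ, Matrix.mul_zero]
  ext i j
  refine Complex.ext (h1 Z hZ i j) ?_
  have := h1 _ h2 i j
  simpa using this

theorem toModel_twoRe (Z : modelSpace p q) : toModel (twoRe Z) = Z :=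
  twoRe_injective (twoRe_toModel (twoRe_mem Z))

/-- `Z` is the restriction of `Z + Z̄` to the `-i`-eigenspace. -/
theorem modelMat_eq (Z : modelSpace p q) : modelMat Z = cx (twoRe Z) * projNeg p q := by
  rw [← modelMat_toModel (twoRe_mem Z), toModel_twoRe]

/-! ### Smoothness of matrix-valued functions -/

section Entrywise

variable {𝕜 : Type*} [NontriviallyNormedField 𝕜] {E : Type*} [NormedAddCommGroup E]
  [NormedSpace 𝕜 E] {ι : Type*} {n : ℕ∞ω} {s : Set E}
  {M N : E → Matrix ι ι 𝕜}

/-- A matrix-valued function whose entries are `C^n`. This avoids the choice of a norm on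
matrices. -/
def EntrywiseContDiffOn (𝕜 : Type*) [NontriviallyNormedField 𝕜] {E : Type*}
    [NormedAddCommGroup E] [NormedSpace 𝕜 E] {ι : Type*} (n : ℕ∞ω) (M : E → Matrix ι ι 𝕜)
    (s : Set E) : Prop :=
  ∀ i j, ContDiffOn 𝕜 n (fun z => M z i j) s

theorem EntrywiseContDiffOn.const (A : Matrix ι ι 𝕜) : EntrywiseContDiffOn 𝕜 n (fun _ : E => A) s :=
  fun _ _ => contDiffOn_const

theorem EntrywiseContDiffOn.add (hM : EntrywiseContDiffOn 𝕜 n M s)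
    (hN : EntrywiseContDiffOn 𝕜 n N s) : EntrywiseContDiffOn 𝕜 n (fun z => M z + N z) s :=
  fun i j => (hM i j).add (hN i j)

theorem EntrywiseContDiffOn.sub (hM : EntrywiseContDiffOn 𝕜 n M s)
    (hN : EntrywiseContDiffOn 𝕜 n N s) : EntrywiseContDiffOn 𝕜 n (fun z => M z - N z) s :=
  fun i j => (hM i j).sub (hN i j)

theorem EntrywiseContDiffOn.mul [Fintype ι] (hM : EntrywiseContDiffOn 𝕜 n M s)
    (hN : EntrywiseContDiffOn 𝕜 n N s) : EntrywiseContDiffOn 𝕜 n (fun z => M z * N z) s := by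
  intro i j
  simp only [Matrix.mul_apply]
  exact ContDiffOn.sum fun k _ => (hM i k).mul (hN k j)

theorem EntrywiseContDiffOn.det [Fintype ι] [DecidableEq ι] (hM : EntrywiseContDiffOn 𝕜 n M s) :
    ContDiffOn 𝕜 n (fun z => (M z).det) s := by
  simp only [Matrix.det_apply']
  exact ContDiffOn.sum fun σ _ => contDiffOn_const.mul (contDiffOn_prod fun i _ => hM _ _)

theorem EntrywiseContDiffOn.inv [Fintype ι] [DecidableEq ι] (hM : EntrywiseContDiffOn 𝕜 n M s)
    (h : ∀ z ∈ s, (M z).det ≠ 0) : EntrywiseContDiffOn 𝕜 n (fun z => (M z)⁻¹) s := by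
  intro i j
  simp only [Matrix.inv_def, Ring.inverse_eq_inv', Matrix.smul_apply, smul_eq_mul]
  refine (hM.det.inv h).mul ?_
  simp only [Matrix.adjugate_apply]
  refine EntrywiseContDiffOn.det fun k l => ?_
  by_cases hk : k = j
  · subst hk
    simpa using contDiffOn_const
  · simpa [Matrix.updateRow_apply, hk] using hM k l

theorem EntrywiseContDiffOn.contDiffOn [Fintype ι] {f : E → ι → ι → 𝕜}
    (h : EntrywiseContDiffOn 𝕜 n (fun z => Matrix.of (f z)) s) : ContDiffOn 𝕜 n f s :=
  contDiffOn_pi.2 fun i => contDiffOn_pi.2 fun j => h i j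

theorem EntrywiseContDiffOn.continuousOn (h : EntrywiseContDiffOn 𝕜 n M s) :
    ContinuousOn M s :=
  continuousOn_pi.2 fun i => continuousOn_pi.2 fun j => (h i j).continuousOn

theorem EntrywiseContDiffOn.congr (hM : EntrywiseContDiffOn 𝕜 n M s)
    (h : ∀ z ∈ s, N z = M z) : EntrywiseContDiffOn 𝕜 n N s :=
  fun i j => (hM i j).congr fun z hz => by rw [h z hz]

/-- A map into a subspace of a finite-dimensional space is `C^n` if it is so as a map into the
ambient space. -/
theorem contDiffOn_of_coe {𝕜 : Type*} [NontriviallyNormedField 𝕜] [CompleteSpace 𝕜] {E F : Type*}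
    [NormedAddCommGroup E] [NormedSpace 𝕜 E] [NormedAddCommGroup F] [NormedSpace 𝕜 F]
    [FiniteDimensional 𝕜 F] {n : ℕ∞ω} {W : Submodule 𝕜 F} {f : E → W} {s : Set E}
    (h : ContDiffOn 𝕜 n (fun z => (f z : F)) s) : ContDiffOn 𝕜 n f s := by
  obtain ⟨r, hr⟩ := W.subtype.exists_leftInverse_of_injective (by simp)
  have h1 : f = fun z => LinearMap.toContinuousLinearMap r (f z : F) :=
    funext fun z => (LinearMap.congr_fun hr (f z)).symm
  rw [h1]
  exact (LinearMap.toContinuousLinearMap r).contDiff.comp_contDiffOn h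

end Entrywise

theorem entrywiseContDiffOn_of {ι 𝕜 : Type*} [Fintype ι] [NontriviallyNormedField 𝕜] {n : ℕ∞ω}
    {s : Set (ι → ι → 𝕜)} : EntrywiseContDiffOn 𝕜 n (fun X : ι → ι → 𝕜 => Matrix.of X) s :=
  fun i j => (contDiff_apply_apply 𝕜 𝕜 i j).contDiffOn

theorem entrywiseContDiffOn_cayley :
    EntrywiseContDiffOn ℝ ω (fun X : Idx p q → Idx p q → ℝ => cayley (Matrix.of X))
      {X | 0 < (1 - Jpq p q * Matrix.of X).det} := by
  have h : EntrywiseContDiffOn ℝ ω (fun X : Idx p q → Idx p q → ℝ => Jpq p q * Matrix.of X)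
      {X | 0 < (1 - Jpq p q * Matrix.of X).det} :=
    (EntrywiseContDiffOn.const _).mul entrywiseContDiffOn_of
  exact ((EntrywiseContDiffOn.const 1).add h).mul
    (((EntrywiseContDiffOn.const 1).sub h).inv fun X hX => (show (0 : ℝ) < _ from hX).ne')

theorem entrywiseContDiffOn_cayleyInv :
    EntrywiseContDiffOn ℝ ω (fun A : Idx p q → Idx p q → ℝ => cayleyInv (Matrix.of A))
      {A | 0 < (1 + Matrix.of A).det} :=
  ((EntrywiseContDiffOn.const _).mul ((EntrywiseContDiffOn.const 1).sub entrywiseContDiffOn_of)).mul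
    (((EntrywiseContDiffOn.const 1).add entrywiseContDiffOn_of).inv
      fun _ hX => (show (0 : ℝ) < _ from hX).ne')

theorem continuousOn_cayley :
    ContinuousOn (cayley : Matrix (Idx p q) (Idx p q) ℝ → _) {X | 0 < (1 - Jpq p q * X).det} :=
  entrywiseContDiffOn_cayley.continuousOn

theorem continuousOn_cayleyInv :
    ContinuousOn (cayleyInv : Matrix (Idx p q) (Idx p q) ℝ → _) {A | 0 < (1 + A).det} :=
  entrywiseContDiffOn_cayleyInv.continuousOn

theorem isOpen_det_one_sub :
    IsOpen {X : Matrix (Idx p q) (Idx p q) ℝ | 0 < (1 - Jpq p q * X).det} :=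
  isOpen_lt continuous_const
    (continuous_const.sub (continuous_const.matrix_mul continuous_id)).matrix_det

theorem isOpen_det_one_add :
    IsOpen {A : Matrix (Idx p q) (Idx p q) ℝ | 0 < (1 + A).det} :=
  isOpen_lt continuous_const (continuous_const.add continuous_id).matrix_det

/-! ### The charts -/

theorem continuous_twoRe : Continuous (twoRe : modelSpace p q → Matrix (Idx p q) (Idx p q) ℝ) :=
  continuous_pi fun i => continuous_pi fun j => continuous_const.mul
    (Complex.continuous_re.comp
      ((continuous_apply j).comp ((continuous_apply i).comp continuous_subtype_val)))

/-- The chart of `F_{p,q}` centred at `J_{p,q}`: the Cayley transform, with values in the model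
space. Complex structures and Cayley transforms are taken in the open sets where the determinant
of the denominator is positive, so that orientations are preserved. -/
def baseChart (p q : ℕ) : OpenPartialHomeomorph (Fpq p q) (modelSpace p q) where
  toFun J := toModel (cayley J.1)
  invFun Z := if h : 0 < (1 + twoRe Z).det then ofCayley (twoRe Z) (twoRe_mem Z) h else basePt p q
  source := {J | 0 < (1 - Jpq p q * J.1).det}
  target := {Z | 0 < (1 + twoRe Z).det}
  map_source' J hJ := by
    change 0 < (1 + twoRe (toModel (cayley J.1))).det
    rw [twoRe_toModel (cayley_mem_mSpace J (ne_of_gt hJ))]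
    exact det_one_add_cayley_pos hJ
  map_target' Z hZ := by
    have hZ' : 0 < (1 + twoRe Z).det := hZ
    rw [dif_pos hZ']
    exact det_one_sub_cayleyInv_pos hZ'
  left_inv' J hJ := by
    have h1 : twoRe (toModel (cayley J.1)) = cayley J.1 :=
      twoRe_toModel (cayley_mem_mSpace J (ne_of_gt hJ))
    have h2 : 0 < (1 + twoRe (toModel (cayley J.1))).det := by
      rw [h1]; exact det_one_add_cayley_pos hJ
    rw [dif_pos h2]
    apply Subtype.ext
    change cayleyInv (twoRe (toModel (cayley J.1))) = J.1
    rw [h1, cayleyInv_cayley hJ]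
  right_inv' Z hZ := by
    have hZ' : 0 < (1 + twoRe Z).det := hZ
    rw [dif_pos hZ']
    change toModel (cayley (cayleyInv (twoRe Z))) = Z
    rw [cayley_cayleyInv hZ', toModel_twoRe]
  open_source := isOpen_det_one_sub.preimage continuous_subtype_val
  open_target := isOpen_det_one_add.preimage continuous_twoRe
  continuousOn_toFun := by
    refine Topology.IsInducing.subtypeVal.continuousOn_iff.2 ?_
    have h1 : ContinuousOn (fun J : Fpq p q => cx (cayley J.1) * projNeg p q)
        {J | 0 < (1 - Jpq p q * J.1).det} := by
      have h2 : Continuous fun A : Matrix (Idx p q) (Idx p q) ℝ => cx A * projNeg p q :=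
        (continuous_id.matrix_map Complex.continuous_ofReal).matrix_mul continuous_const
      exact h2.comp_continuousOn
        (continuousOn_cayley.comp continuous_subtype_val.continuousOn fun J hJ => hJ)
    exact h1.congr fun J hJ => modelMat_toModel (cayley_mem_mSpace J (ne_of_gt hJ))
  continuousOn_invFun := by
    refine Topology.IsInducing.subtypeVal.continuousOn_iff.2 ?_
    have h1 : ContinuousOn (fun Z : modelSpace p q => cayleyInv (twoRe Z))
        {Z | 0 < (1 + twoRe Z).det} :=
      continuousOn_cayleyInv.comp continuous_twoRe.continuousOn fun Z hZ => hZ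
    refine h1.congr fun Z hZ => ?_
    have hZ' : 0 < (1 + twoRe Z).det := hZ
    simp only [Function.comp_apply]
    rw [dif_pos hZ']
    rfl

theorem baseChart_apply (J : Fpq p q) : baseChart p q J = toModel (cayley J.1) := rfl

theorem mem_baseChart_source {J : Fpq p q} :
    J ∈ (baseChart p q).source ↔ 0 < (1 - Jpq p q * J.1).det := Iff.rfl

theorem mem_baseChart_target {Z : modelSpace p q} :
    Z ∈ (baseChart p q).target ↔ 0 < (1 + twoRe Z).det := Iff.rfl

theorem coe_baseChart_symm {Z : modelSpace p q} (hZ : Z ∈ (baseChart p q).target) :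
    ((baseChart p q).symm Z).1 = cayleyInv (twoRe Z) := by
  have hZ' : 0 < (1 + twoRe Z).det := hZ
  change (if h : 0 < (1 + twoRe Z).det then ofCayley (twoRe Z) (twoRe_mem Z) h
    else basePt p q).1 = _
  rw [dif_pos hZ']
  rfl

theorem twoRe_baseChart {J : Fpq p q} (hJ : J ∈ (baseChart p q).source) :
    twoRe (baseChart p q J) = cayley J.1 :=
  twoRe_toModel (cayley_mem_mSpace J (ne_of_gt (mem_baseChart_source.1 hJ)))

theorem basePt_mem_baseChart_source : basePt p q ∈ (baseChart p q).source := by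
  rw [mem_baseChart_source]
  change 0 < (1 - Jpq p q * Jpq p q).det
  have h : (1 - Jpq p q * Jpq p q) = (2 : ℝ) • (1 : Matrix (Idx p q) (Idx p q) ℝ) := by
    rw [Jpq_mul_self, sub_neg_eq_add, two_smul]
  rw [h, Matrix.det_smul, Matrix.det_one]
  positivity

theorem baseChart_basePt : baseChart p q (basePt p q) = 0 := by
  apply twoRe_injective
  rw [twoRe_baseChart basePt_mem_baseChart_source, map_zero]
  change cayley (Jpq p q) = 0
  rw [cayley, Jpq_mul_self, add_neg_cancel, Matrix.zero_mul]

instance instContinuousSMulSOFpq : ContinuousSMul (SO p q) (Fpq p q) where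
  continuous_smul := by
    have hval : Continuous (matSO : SO p q → _) :=
      continuous_subtype_val.comp continuous_subtype_val
    apply Continuous.subtype_mk
    exact ((hval.comp continuous_fst).matrix_mul
      (continuous_subtype_val.comp continuous_snd)).matrix_mul
        (hval.comp (continuous_fst.inv))

/-- The action of an element of `SO_{2p,2q}` as a homeomorphism of `F_{p,q}`. -/
def smulHomeo (k : SO p q) : Fpq p q ≃ₜ Fpq p q := Homeomorph.smul k

theorem smulHomeo_apply (k : SO p q) (J : Fpq p q) : smulHomeo k J = k • J := rfl

theorem smulHomeo_symm_apply (k : SO p q) (J : Fpq p q) : (smulHomeo k).symm J = k⁻¹ • J := rfl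

/-- The chart of `F_{p,q}` centred at `k J_{p,q} k⁻¹`. -/
def chartSO (k : SO p q) : OpenPartialHomeomorph (Fpq p q) (modelSpace p q) :=
  (smulHomeo k⁻¹).transOpenPartialHomeomorph (baseChart p q)

theorem chartSO_apply (k : SO p q) (J : Fpq p q) :
    chartSO k J = baseChart p q (k⁻¹ • J) := by
  rw [chartSO, Homeomorph.transOpenPartialHomeomorph_apply, Function.comp_apply, smulHomeo_apply]

theorem chartSO_symm_apply (k : SO p q) (Z : modelSpace p q) :
    (chartSO k).symm Z = k • (baseChart p q).symm Z := by
  rw [chartSO, Homeomorph.transOpenPartialHomeomorph_symm_apply, Function.comp_apply,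
    smulHomeo_symm_apply, inv_inv]

theorem mem_chartSO_source {k : SO p q} {J : Fpq p q} :
    J ∈ (chartSO k).source ↔ k⁻¹ • J ∈ (baseChart p q).source := by
  rw [chartSO, Homeomorph.transOpenPartialHomeomorph_source, Set.mem_preimage, smulHomeo_apply]

theorem chartSO_target (k : SO p q) : (chartSO k).target = (baseChart p q).target := by
  rw [chartSO, Homeomorph.transOpenPartialHomeomorph_target]

/-- An element of `SO_{2p,2q}` that maps the base point to `J`. -/
def transporter (J : Fpq p q) : SO p q := (exists_smul_basePt J).choose

theorem transporter_smul (J : Fpq p q) : transporter J • basePt p q = J :=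
  (exists_smul_basePt J).choose_spec

theorem inv_transporter_smul (J : Fpq p q) : (transporter J)⁻¹ • J = basePt p q := by
  rw [inv_smul_eq_iff, transporter_smul]

/-- The complex manifold `F_{p,q}`: its atlas consists of the translates of the Cayley chart, and
the preferred chart at a point is centred there. -/
instance instChartedSpaceFpq : ChartedSpace (modelSpace p q) (Fpq p q) where
  atlas := Set.range chartSO
  chartAt J := chartSO (transporter J)
  mem_chart_source J := by
    rw [mem_chartSO_source, inv_transporter_smul]
    exact basePt_mem_baseChart_source
  chart_mem_atlas J := Set.mem_range_self _

theorem chartAt_eq (J : Fpq p q) : chartAt (modelSpace p q) J = chartSO (transporter J) := rfl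

theorem chartAt_self (J : Fpq p q) : chartAt (modelSpace p q) J J = 0 := by
  rw [chartAt_eq, chartSO_apply, inv_transporter_smul, baseChart_basePt]

theorem entrywiseContDiffOn_modelMat {s : Set (modelSpace p q)} :
    EntrywiseContDiffOn ℂ ω (fun Z : modelSpace p q => modelMat Z) s := fun i j =>
  ((contDiff_apply_apply ℂ ℂ i j).comp (modelSpace p q).subtypeL.contDiff).contDiffOn

/-- In the charts, elements of `SO_{2p,2q}` act by fractional linear transformations. -/
theorem modelMat_baseChart_smul (h : SO p q) {Z : modelSpace p q}
    (hZ : Z ∈ (baseChart p q).target)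
    (hs : h • (baseChart p q).symm Z ∈ (baseChart p q).source) :
    let Y := projNeg p q * cx (matSO h) * (1 + modelMat Z) * projNeg p q + projPos p q
    Y.det ≠ 0 ∧ modelMat (baseChart p q (h • (baseChart p q).symm Z))
      = projPos p q * cx (matSO h) * (1 + modelMat Z) * projNeg p q * Y⁻¹ := by
  intro Y
  rw [mem_baseChart_target] at hZ
  set A := twoRe Z with hA
  set J' := h • (baseChart p q).symm Z with hJ'
  rw [mem_baseChart_source] at hs
  set A' := cayley J'.1 with hA'
  -- `J' = M J_{p,q} M⁻¹`; `N` and `L` are the complex linear and antilinear parts of `M`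
  set M := matSO h * (1 + A) with hM
  have hMdet : M.det ≠ 0 := by
    rw [hM, Matrix.det_mul, det_matSO, one_mul]; exact hZ.ne'
  have hJM : J'.1 * M = M * Jpq p q := by
    rw [hJ', coe_smul_Fpq, coe_baseChart_symm hZ, hM, Matrix.mul_assoc, matSO_inv_mul_assoc,
      Matrix.mul_assoc, cayleyInv_mul_of_mem (twoRe_mem Z) hZ.ne', Matrix.mul_assoc]
  set N := M - Jpq p q * M * Jpq p q with hN
  set L := M + Jpq p q * M * Jpq p q with hL
  have hNM : (1 - Jpq p q * J'.1) * M = N := by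
    rw [sub_mul, Matrix.mul_assoc, hJM, Matrix.one_mul, ← Matrix.mul_assoc]
  have hNdet : N.det ≠ 0 := by
    rw [← hNM, Matrix.det_mul]; exact mul_ne_zero hs.ne' hMdet
  have hAN : A' * N = L := by
    rw [← hNM, ← Matrix.mul_assoc, cayley_mul hs.ne', add_mul, Matrix.mul_assoc, hJM,
      Matrix.one_mul, ← Matrix.mul_assoc]
  have hNJ : N * Jpq p q = Jpq p q * N := by
    have e1 : Jpq p q * M * Jpq p q * Jpq p q = -(Jpq p q * M) := by
      rw [Matrix.mul_assoc (Jpq p q * M), Jpq_mul_self, Matrix.mul_neg, Matrix.mul_one]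
    have e2 : Jpq p q * (Jpq p q * M * Jpq p q) = -(M * Jpq p q) := by
      rw [Matrix.mul_assoc (Jpq p q) M, Jpq_mul_Jpq_mul]
    rw [hN, sub_mul, mul_sub, e1, e2]
    abel
  have hJP := cx_Jpq_mul_projNeg (p := p) (q := q)
  have hZP : cx (1 + A) * projNeg p q = (1 + modelMat Z) * projNeg p q := by
    rw [cx_add, cx_one, add_mul, add_mul, modelMat_mul_projNeg, modelMat_eq Z]
  have hMP : cx M * projNeg p q = cx (matSO h) * (1 + modelMat Z) * projNeg p q := by
    rw [hM, cx_mul, Matrix.mul_assoc, hZP, Matrix.mul_assoc]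
  have hJMJ : cx (Jpq p q * M * Jpq p q) * projNeg p q
      = -(Complex.I • (cx (Jpq p q) * (cx M * projNeg p q))) := by
    rw [cx_mul, Matrix.mul_assoc, hJP, Matrix.mul_neg, Matrix.mul_smul, cx_mul, Matrix.mul_assoc]
  have hNP : cx N * projNeg p q = (2 : ℂ) • (projNeg p q * (cx M * projNeg p q)) := by
    rw [hN, cx_sub, sub_mul, hJMJ, two_smul_projNeg_mul, sub_neg_eq_add]
  have hLP : cx L * projNeg p q = (2 : ℂ) • (projPos p q * (cx M * projNeg p q)) := by
    rw [hL, cx_add, add_mul, hJMJ, two_smul_projPos_mul, sub_eq_add_neg]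
  have hY : Y = (1 / 2 : ℂ) • (cx N * projNeg p q) + projPos p q := by
    rw [hNP, hMP, smul_smul, show (1 / 2 : ℂ) * 2 = 1 by norm_num, one_smul]
    simp only [Y, Matrix.mul_assoc]
  have hNinv : N * N⁻¹ = 1 := Matrix.mul_nonsing_inv _ (isUnit_iff_ne_zero.2 hNdet)
  have hNinv' : N⁻¹ * N = 1 := Matrix.nonsing_inv_mul _ (isUnit_iff_ne_zero.2 hNdet)
  have hNiJ : N⁻¹ * Jpq p q = Jpq p q * N⁻¹ := by
    calc N⁻¹ * Jpq p q = N⁻¹ * (Jpq p q * N) * N⁻¹ := by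
          rw [Matrix.mul_assoc, Matrix.mul_assoc, hNinv, Matrix.mul_one]
      _ = Jpq p q * N⁻¹ := by rw [← hNJ, ← Matrix.mul_assoc, hNinv', Matrix.one_mul]
  have hYinv : Y * ((2 : ℂ) • (cx N⁻¹ * projNeg p q) + projPos p q) = 1 := by
    have e1 : cx N * projNeg p q * (cx N⁻¹ * projNeg p q) = projNeg p q := by
      rw [Matrix.mul_assoc, ← Matrix.mul_assoc (projNeg p q), ← projNeg_mul_of_commute hNiJ,
        Matrix.mul_assoc, projNeg_mul_self, ← Matrix.mul_assoc, ← cx_mul, hNinv, cx_one,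
        Matrix.one_mul]
    have e2 : cx N * projNeg p q * projPos p q = 0 := by
      rw [Matrix.mul_assoc, projNeg_mul_projPos, Matrix.mul_zero]
    have e3 : projPos p q * (cx N⁻¹ * projNeg p q) = 0 := by
      rw [projNeg_mul_of_commute hNiJ, ← Matrix.mul_assoc, projPos_mul_projNeg, Matrix.zero_mul]
    rw [hY, add_mul, mul_add, mul_add, Matrix.smul_mul, Matrix.mul_smul, e1, Matrix.smul_mul, e2,
      Matrix.mul_smul, e3, projPos_mul_self, smul_smul, smul_zero, smul_zero, add_zero, zero_add,
      show (1 / 2 : ℂ) * 2 = 1 by norm_num, one_smul, projNeg_add_projPos]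
  have hYdet : Y.det ≠ 0 := by
    intro h0
    have := congrArg Matrix.det hYinv
    rw [Matrix.det_mul, h0, zero_mul, Matrix.det_one] at this
    exact zero_ne_one this
  refine ⟨hYdet, ?_⟩
  have hmem : A' ∈ mSpace (Jpq p q) := cayley_mem_mSpace J' hs.ne'
  have hkey : cx A' * projNeg p q * Y
      = projPos p q * cx (matSO h) * (1 + modelMat Z) * projNeg p q := by
    have e1 : projNeg p q * (cx N * projNeg p q) = cx N * projNeg p q := by
      rw [projNeg_mul_of_commute hNJ, ← Matrix.mul_assoc, projNeg_mul_self]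
    rw [hY, mul_add, Matrix.mul_assoc _ (projNeg p q) (projPos p q), projNeg_mul_projPos,
      Matrix.mul_zero, add_zero, Matrix.mul_smul, Matrix.mul_assoc, e1, ← Matrix.mul_assoc,
      ← cx_mul, hAN, hLP, hMP, smul_smul, show (1 / 2 : ℂ) * 2 = 1 by norm_num, one_smul]
    simp only [Matrix.mul_assoc]
  rw [baseChart_apply, modelMat_toModel hmem, ← hkey, Matrix.mul_assoc _ Y,
    Matrix.mul_nonsing_inv _ (isUnit_iff_ne_zero.2 hYdet), Matrix.mul_one]

theorem contDiffOn_baseChart_smul (h : SO p q) :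
    ContDiffOn ℂ ω (fun Z => baseChart p q (h • (baseChart p q).symm Z))
      {Z | Z ∈ (baseChart p q).target ∧
        h • (baseChart p q).symm Z ∈ (baseChart p q).source} := by
  apply contDiffOn_of_coe
  apply EntrywiseContDiffOn.contDiffOn
  set s := {Z | Z ∈ (baseChart p q).target ∧
        h • (baseChart p q).symm Z ∈ (baseChart p q).source}
  have hc : ∀ P : Matrix (Idx p q) (Idx p q) ℂ, EntrywiseContDiffOn ℂ ω
      (fun Z : modelSpace p q => P * cx (matSO h) * (1 + modelMat Z) * projNeg p q) s := fun P =>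
    ((EntrywiseContDiffOn.const _).mul
      ((EntrywiseContDiffOn.const _).add entrywiseContDiffOn_modelMat)).mul
        (EntrywiseContDiffOn.const _)
  exact ((hc _).mul (((hc _).add (EntrywiseContDiffOn.const _)).inv
    fun Z hZ => (modelMat_baseChart_smul h hZ.1 hZ.2).1)).congr
      fun Z hZ => (modelMat_baseChart_smul h hZ.1 hZ.2).2

theorem contDiffOn_chartSO_trans (k l : SO p q) :
    ContDiffOn ℂ ω (chartSO l ∘ (chartSO k).symm)
      ((chartSO k).symm.trans (chartSO l)).source := by
  refine (contDiffOn_baseChart_smul (l⁻¹ * k)).congr_mono (fun Z hZ => ?_) (fun Z hZ => ?_)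
  · simp only [Function.comp_apply, chartSO_apply, chartSO_symm_apply, mul_smul]
  · rw [OpenPartialHomeomorph.trans_source] at hZ
    refine ⟨hZ.1, ?_⟩
    have := hZ.2
    rw [Set.mem_preimage, chartSO_symm_apply, mem_chartSO_source] at this
    rwa [mul_smul]

instance instIsManifoldComplexFpq : IsManifold 𝓘(ℂ, modelSpace p q) ω (Fpq p q) := by
  apply isManifold_of_contDiffOn
  rintro _ _ ⟨k, rfl⟩ ⟨l, rfl⟩
  simpa using contDiffOn_chartSO_trans k l

instance instIsManifoldRealFpq : IsManifold 𝓘(ℝ, modelSpace p q) ∞ (Fpq p q) := by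
  apply isManifold_of_contDiffOn
  rintro _ _ ⟨k, rfl⟩ ⟨l, rfl⟩
  simpa using ((contDiffOn_chartSO_trans k l).restrict_scalars ℝ).of_le le_top

/-! ### The embedding into the space of matrices -/

/-- Matrix multiplication as a continuous bilinear map. -/
def mulL (p q : ℕ) : (Idx p q → Idx p q → ℝ) →L[ℝ] (Idx p q → Idx p q → ℝ) →L[ℝ] (Idx p q → Idx p q → ℝ) :=
  LinearMap.toContinuousBilinearMap
    (LinearMap.mul ℝ (Matrix (Idx p q) (Idx p q) ℝ) :)

/-- The real infinitesimal isometry `Z + Z̄`, as a continuous linear map. -/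
def twoReL (p q : ℕ) : modelSpace p q →L[ℝ] (Idx p q → Idx p q → ℝ) :=
  LinearMap.toContinuousLinearMap (twoRe :)

theorem twoReL_apply (Z : modelSpace p q) : twoReL p q Z = twoRe Z := rfl

/-- The Cayley transform as a chart of the space of matrices. -/
def ambientBaseChart (p q : ℕ) : OpenPartialHomeomorph (Idx p q → Idx p q → ℝ) (Idx p q → Idx p q → ℝ) where
  toFun X := cayley (Matrix.of X)
  invFun A := cayleyInv (Matrix.of A)
  source := {X | 0 < (1 - Jpq p q * Matrix.of X).det}
  target := {A | 0 < (1 + Matrix.of A).det}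
  map_source' _ hX := det_one_add_cayley_pos hX
  map_target' _ hA := det_one_sub_cayleyInv_pos hA
  left_inv' _ hX := cayleyInv_cayley hX
  right_inv' _ hA := cayley_cayleyInv hA
  open_source := isOpen_det_one_sub
  open_target := isOpen_det_one_add
  continuousOn_toFun := continuousOn_cayley
  continuousOn_invFun := continuousOn_cayleyInv

theorem ambientBaseChart_apply (X : (Idx p q → Idx p q → ℝ)) :
    ambientBaseChart p q X = cayley (Matrix.of X) := rfl

theorem mem_ambientBaseChart_source {X : (Idx p q → Idx p q → ℝ)} :
    X ∈ (ambientBaseChart p q).source ↔ 0 < (1 - Jpq p q * Matrix.of X).det := Iff.rfl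

/-- Conjugation by an element of `SO_{2p,2q}` on the space of matrices. -/
def conjL (k : SO p q) : (Idx p q → Idx p q → ℝ) ≃L[ℝ] (Idx p q → Idx p q → ℝ) :=
  LinearEquiv.toContinuousLinearEquiv
    { toFun := fun X => matSO k * Matrix.of X * matSO k⁻¹
      invFun := fun X => matSO k⁻¹ * Matrix.of X * matSO k
      map_add' := fun X Y => by
        change matSO k * (Matrix.of X + Matrix.of Y) * matSO k⁻¹ = _
        rw [mul_add, add_mul]
        rfl
      map_smul' := fun c X => by
        change matSO k * (c • Matrix.of X) * matSO k⁻¹ = _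
        rw [Matrix.mul_smul, Matrix.smul_mul]
        rfl
      left_inv := fun X => by
        change matSO k⁻¹ * (matSO k * Matrix.of X * matSO k⁻¹) * matSO k = X
        simp only [Matrix.mul_assoc, matSO_inv_mul_assoc, matSO_inv_mul, Matrix.mul_one]
        rfl
      right_inv := fun X => by
        change matSO k * (matSO k⁻¹ * Matrix.of X * matSO k) * matSO k⁻¹ = X
        simp only [Matrix.mul_assoc, matSO_mul_inv_assoc, matSO_mul_inv, Matrix.mul_one]
        rfl }

theorem conjL_incl (k : SO p q) (J : Fpq p q) : conjL k (incl J) = incl (k • J) := rfl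

/-- The chart of the space of matrices that restricts to `chartSO k` on `F_{p,q}`. -/
def ambientChart (k : SO p q) : OpenPartialHomeomorph (Idx p q → Idx p q → ℝ) (Idx p q → Idx p q → ℝ) :=
  (conjL k⁻¹).toHomeomorph.transOpenPartialHomeomorph (ambientBaseChart p q)

theorem ambientChart_apply (k : SO p q) (X : (Idx p q → Idx p q → ℝ)) :
    ambientChart k X = ambientBaseChart p q (conjL k⁻¹ X) := by
  rw [ambientChart, Homeomorph.transOpenPartialHomeomorph_apply, Function.comp_apply,
    ContinuousLinearEquiv.coe_toHomeomorph]

theorem of_incl (J : Fpq p q) : Matrix.of (incl J) = J.1 := rfl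

theorem ambientChart_incl {k : SO p q} {J : Fpq p q} (hJ : J ∈ (chartSO k).source) :
    ambientChart k (incl J) = twoReL p q (chartSO k J) := by
  rw [ambientChart_apply, conjL_incl, ambientBaseChart_apply, twoReL_apply, chartSO_apply,
    twoRe_baseChart (mem_chartSO_source.1 hJ), of_incl]

theorem incl_mem_ambientChart_source {k : SO p q} {J : Fpq p q} (hJ : J ∈ (chartSO k).source) :
    incl J ∈ (ambientChart k).source := by
  rw [ambientChart, Homeomorph.transOpenPartialHomeomorph_source, Set.mem_preimage,
    ContinuousLinearEquiv.coe_toHomeomorph, conjL_incl, mem_ambientBaseChart_source, of_incl]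
  exact mem_baseChart_source.1 (mem_chartSO_source.1 hJ)

theorem ambientChart_mem_maximalAtlas (k : SO p q) :
    ambientChart k ∈ IsManifold.maximalAtlas 𝓘(ℝ, Idx p q → Idx p q → ℝ) ∞ (Idx p q → Idx p q → ℝ) := by
  apply StructureGroupoid.mem_maximalAtlas_of_mem_groupoid
  rw [contDiffGroupoid, mem_groupoid_of_pregroupoid]
  have h1 : ContDiffOn ℝ ∞ (ambientBaseChart p q) (ambientBaseChart p q).source :=
    (EntrywiseContDiffOn.contDiffOn entrywiseContDiffOn_cayley).of_le le_top
  have h2 : ContDiffOn ℝ ∞ (ambientBaseChart p q).symm (ambientBaseChart p q).target :=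
    (EntrywiseContDiffOn.contDiffOn entrywiseContDiffOn_cayleyInv).of_le le_top
  have h3 : ContDiffOn ℝ ∞ (ambientChart k) (ambientChart k).source :=
    h1.comp (conjL k⁻¹).contDiff.contDiffOn fun X hX => hX
  have h4 : ContDiffOn ℝ ∞ (ambientChart k).symm (ambientChart k).target :=
    (conjL k⁻¹).symm.contDiff.comp_contDiffOn h2
  simpa [contDiffPregroupoid] using And.intro h3 h4

/-- In suitable charts, the inclusion is the injective linear map `Z ↦ Z + Z̄`. -/
theorem ambientChart_incl_symm (k : SO p q) :
    Set.EqOn ((ambientChart k).extend 𝓘(ℝ, Idx p q → Idx p q → ℝ) ∘ incl ∘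
        ((chartSO k).extend 𝓘(ℝ, modelSpace p q)).symm)
      (twoReL p q) ((chartSO k).extend 𝓘(ℝ, modelSpace p q)).target := by
  intro Z hZ
  have hZ' : Z ∈ (chartSO k).target := by
    simpa only [OpenPartialHomeomorph.extend_target, modelWithCornersSelf_coe_symm,
      Set.preimage_id, modelWithCornersSelf_coe, Set.range_id, Set.inter_univ] using hZ
  have h1 := ambientChart_incl ((chartSO k).map_target hZ')
  rw [(chartSO k).right_inv hZ'] at h1
  simp only [OpenPartialHomeomorph.extend_coe, OpenPartialHomeomorph.extend_coe_symm,
    modelWithCornersSelf_coe, modelWithCornersSelf_coe_symm, Function.comp_apply, id_eq]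
  exact h1

/-- The model space of `F_{p,q}` as a direct summand of the space of matrices. -/
theorem exists_complement_twoReL (p q : ℕ) :
    ∃ (C : Submodule ℝ (Idx p q → Idx p q → ℝ))
      (e : (modelSpace p q × C) ≃L[ℝ] (Idx p q → Idx p q → ℝ)), ∀ Z, e (Z, 0) = twoReL p q Z := by
  have hinj : Function.Injective (twoReL p q : modelSpace p q →ₗ[ℝ] (Idx p q → Idx p q → ℝ)) :=
    twoRe_injective
  obtain ⟨C, hC⟩ := Submodule.exists_isCompl
    (LinearMap.range (twoReL p q : modelSpace p q →ₗ[ℝ] (Idx p q → Idx p q → ℝ)))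
  exact ⟨C, (((LinearEquiv.ofInjective _ hinj).prodCongr (LinearEquiv.refl ℝ C)).trans
      (Submodule.prodEquivOfIsCompl _ _ hC)).toContinuousLinearEquiv, fun Z => by simp⟩

theorem isSmoothEmbedding_incl :
    Manifold.IsSmoothEmbedding 𝓘(ℝ, modelSpace p q) 𝓘(ℝ, Idx p q → Idx p q → ℝ) ∞
      (incl : Fpq p q → Idx p q → Idx p q → ℝ) := by
  obtain ⟨C, e, he⟩ := exists_complement_twoReL p q
  have himm (J : Fpq p q) : Manifold.IsImmersionAtOfComplement C 𝓘(ℝ, modelSpace p q)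
      𝓘(ℝ, Idx p q → Idx p q → ℝ) ∞ (incl : Fpq p q → Idx p q → Idx p q → ℝ) J := by
    have h1 : J ∈ (chartSO (transporter J)).source := mem_chart_source (modelSpace p q) J
    have h2 : chartSO (transporter J) ∈ IsManifold.maximalAtlas 𝓘(ℝ, modelSpace p q) ∞ (Fpq p q) :=
      IsManifold.chart_mem_maximalAtlas J
    have h3 : (e ∘ fun Z : modelSpace p q => (Z, (0 : C))) = twoReL p q := funext he
    refine Manifold.IsImmersionAtOfComplement.mk_of_charts e _ _ h1
      (incl_mem_ambientChart_source h1) h2 (ambientChart_mem_maximalAtlas _)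
      (fun J' hJ' => incl_mem_ambientChart_source hJ') ?_
    rw [h3]
    exact ambientChart_incl_symm _
  exact ⟨⟨C, inferInstance, inferInstance, himm⟩, Topology.IsEmbedding.subtypeVal⟩

theorem contMDiff_incl :
    ContMDiff 𝓘(ℝ, modelSpace p q) 𝓘(ℝ, Idx p q → Idx p q → ℝ) ∞ (incl : Fpq p q → Idx p q → Idx p q → ℝ) :=
  isSmoothEmbedding_incl.contMDiff

/-! ### The tangent spaces -/

/-- The differential of the inclusion in the preferred chart at `J`. -/
theorem hasFDerivAt_incl_chart (J : Fpq p q) :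
    HasFDerivAt (fun Z => incl ((chartAt (modelSpace p q) J).symm Z))
      (mfderiv 𝓘(ℝ, modelSpace p q) 𝓘(ℝ, Idx p q → Idx p q → ℝ) (incl : Fpq p q → Idx p q → Idx p q → ℝ) J :
        modelSpace p q →L[ℝ] (Idx p q → Idx p q → ℝ)) 0 := by
  have h1 : MDifferentiableAt 𝓘(ℝ, modelSpace p q) 𝓘(ℝ, Idx p q → Idx p q → ℝ)
      (incl : Fpq p q → Idx p q → Idx p q → ℝ) J := contMDiff_incl.mdifferentiable (by simp) J
  have h2 := h1.hasMFDerivAt.2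
  rw [← chartAt_self J]
  rw [writtenInExtChartAt] at h2
  refine hasFDerivWithinAt_univ.1 ?_
  simpa [Function.comp_def, extChartAt_model_space_eq_id, chartAt_self_eq] using h2

/-- The differential of the inclusion, obtained by differentiating the equation that characterizes
the inclusion in the preferred chart at `J`. -/
theorem dincl_eq (J : Fpq p q) (v : modelSpace p q) :
    dincl (W := modelSpace p q) J v
      = (-2 : ℝ) • (J.1 * matSO (transporter J) * twoRe v * matSO (transporter J)⁻¹) := by
  set k := transporter J with hk
  have hJk : J.1 * matSO k = matSO k * Jpq p q := by
    have := congrArg Subtype.val (transporter_smul J)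
    rw [coe_smul_Fpq] at this
    rw [← this, Matrix.mul_assoc, matSO_inv_mul, Matrix.mul_one]
    rfl
  set G : modelSpace p q → (Idx p q → Idx p q → ℝ) := fun Z => incl ((chartAt (modelSpace p q) J).symm Z) with hG
  have hD := hasFDerivAt_incl_chart J
  set D : modelSpace p q →L[ℝ] (Idx p q → Idx p q → ℝ) :=
    mfderiv 𝓘(ℝ, modelSpace p q) 𝓘(ℝ, Idx p q → Idx p q → ℝ) (incl : Fpq p q → Idx p q → Idx p q → ℝ) J
  -- in the chart, the inclusion satisfies `G(Z) k (1 + A) = k (1 + A) J_{p,q}` with `A = Z + Z̄`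
  have hev : ∀ᶠ Z in 𝓝 (0 : modelSpace p q),
      mulL p q (G Z) (mulL p q (matSO k) (Matrix.of.symm 1 + twoReL p q Z))
        = mulL p q (mulL p q (matSO k) (Matrix.of.symm 1 + twoReL p q Z)) (Jpq p q) := by
    have h0 : (0 : modelSpace p q) ∈ (chartAt (modelSpace p q) J).target := by
      rw [← chartAt_self J]; exact mem_chart_target _ J
    filter_upwards [(chartAt (modelSpace p q) J).open_target.mem_nhds h0] with Z hZ
    rw [chartAt_eq, chartSO_target] at hZ
    have hG' : G Z = matSO k * cayleyInv (twoRe Z) * matSO k⁻¹ := by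
      rw [hG, ← coe_baseChart_symm hZ, ← coe_smul_Fpq, ← chartSO_symm_apply]
      rfl
    have h1 := cayleyInv_mul_of_mem (twoRe_mem Z) (ne_of_gt (mem_baseChart_target.1 hZ))
    change Matrix.of (G Z) * (matSO k * (1 + twoRe Z)) = matSO k * (1 + twoRe Z) * Jpq p q
    rw [hG']
    change matSO k * cayleyInv (twoRe Z) * matSO k⁻¹ * (matSO k * (1 + twoRe Z)) = _
    rw [Matrix.mul_assoc, matSO_inv_mul_assoc, Matrix.mul_assoc, h1, Matrix.mul_assoc]
  have hT : HasFDerivAt (fun Z => mulL p q (matSO k) (Matrix.of.symm 1 + twoReL p q Z))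
      ((mulL p q (matSO k)).comp (twoReL p q)) (0 : modelSpace p q) :=
    (mulL p q (matSO k)).hasFDerivAt.comp _ ((twoReL p q).hasFDerivAt.const_add _)
  have hL := (mulL p q).hasFDerivAt_of_bilinear hD hT
  have hR := ((mulL p q).flip (Jpq p q)).hasFDerivAt.comp _ hT
  have huniq := (hL.congr_of_eventuallyEq
    (Filter.EventuallyEq.symm hev)).unique hR
  have hv := congrArg (fun f : modelSpace p q →L[ℝ] (Idx p q → Idx p q → ℝ) => f v) huniq
  have hG0 : G 0 = J.1 := by
    rw [hG]
    change incl ((chartAt (modelSpace p q) J).symm 0) = _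
    rw [← chartAt_self J, OpenPartialHomeomorph.left_inv _ (mem_chart_source _ J)]
    rfl
  have hv' : J.1 * (matSO k * twoRe v) + Matrix.of (D v) * matSO k
      = matSO k * twoRe v * Jpq p q := by
    have e : J.1 * (matSO k * twoRe v) + Matrix.of (D v) * (matSO k * (1 + twoRe 0))
        = matSO k * twoRe v * Jpq p q := by
      rw [← hG0]
      exact hv
    rwa [map_zero, add_zero, Matrix.mul_one] at e
  have hmem := (mem_mSpace_iff.1 (twoRe_mem v)).2
  have hD' : Matrix.of (D v) * matSO k = (-2 : ℝ) • (J.1 * matSO k * twoRe v) := by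
    rw [eq_sub_of_add_eq' hv', Matrix.mul_assoc, hmem, Matrix.mul_neg, ← Matrix.mul_assoc, ← hJk,
      Matrix.mul_assoc, neg_smul, two_smul]
    abel
  change Matrix.of (D v) = _
  calc Matrix.of (D v) = Matrix.of (D v) * matSO k * matSO k⁻¹ := by
        rw [Matrix.mul_assoc, matSO_mul_inv, Matrix.mul_one]
    _ = _ := by rw [hD', Matrix.smul_mul]

theorem conj_mem_mSpace (k : SO p q) {A J : Matrix (Idx p q) (Idx p q) ℝ} (hA : A ∈ mSpace J) :
    matSO k * A * matSO k⁻¹ ∈ mSpace (matSO k * J * matSO k⁻¹) := by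
  obtain ⟨h1, h2⟩ := mem_mSpace_iff.1 hA
  rw [mem_mSpace_iff]
  constructor
  · have hT : (matSO k)ᵀ * Ipq p q = Ipq p q * matSO k⁻¹ := by
      calc (matSO k)ᵀ * Ipq p q = (matSO k)ᵀ * Ipq p q * matSO k * matSO k⁻¹ := by
            rw [Matrix.mul_assoc, matSO_mul_inv, Matrix.mul_one]
        _ = _ := by rw [matSO_isometry]
    have hT' : (matSO k⁻¹)ᵀ * Ipq p q = Ipq p q * matSO k := by
      calc (matSO k⁻¹)ᵀ * Ipq p q = (matSO k⁻¹)ᵀ * Ipq p q * matSO k⁻¹ * matSO k := by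
            rw [Matrix.mul_assoc, matSO_inv_mul, Matrix.mul_one]
        _ = _ := by rw [matSO_isometry]
    calc (matSO k * A * matSO k⁻¹)ᵀ * Ipq p q
        = (matSO k⁻¹)ᵀ * (Aᵀ * ((matSO k)ᵀ * Ipq p q)) := by
          simp only [Matrix.transpose_mul, Matrix.mul_assoc]
      _ = -((matSO k⁻¹)ᵀ * Ipq p q * A * matSO k⁻¹) := by
          rw [hT, ← Matrix.mul_assoc Aᵀ, h1]
          simp only [Matrix.neg_mul, Matrix.mul_neg, Matrix.mul_assoc]
      _ = -(Ipq p q * (matSO k * A * matSO k⁻¹)) := by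
          rw [hT']; simp only [Matrix.mul_assoc]
  · rw [conj_mul_conj, conj_mul_conj, h2, Matrix.mul_neg, Matrix.neg_mul]

theorem mul_mem_mSpace {J : Fpq p q} {A : Matrix (Idx p q) (Idx p q) ℝ} (hA : A ∈ mSpace J.1) :
    J.1 * A ∈ mSpace J.1 := by
  obtain ⟨h1, h2⟩ := mem_mSpace_iff.1 hA
  rw [mem_mSpace_iff]
  constructor
  · have h3 : (J.1)ᵀ * Ipq p q = -(Ipq p q * J.1) := by
      have := congrArg (· * J.1) (Fpq_isometry J)
      simp only [Matrix.mul_assoc, Fpq_mul_self] at this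
      rw [← this]; simp
    rw [Matrix.transpose_mul, Matrix.mul_assoc, h3, Matrix.mul_neg, ← Matrix.mul_assoc, h1,
      Matrix.neg_mul, neg_neg, Matrix.mul_assoc, h2, Matrix.mul_neg]
  · rw [Matrix.mul_assoc, h2, Matrix.mul_neg]

theorem smul_mem_mSpace {J A : Matrix (Idx p q) (Idx p q) ℝ} (c : ℝ) (hA : A ∈ mSpace J) :
    c • A ∈ mSpace J := by
  refine ⟨(soLie p q).smul_mem c hA.1, ?_⟩
  rw [Matrix.smul_mul, hA.2, Matrix.mul_smul, smul_neg]

theorem coe_eq_conj (J : Fpq p q) :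
    J.1 = matSO (transporter J) * Jpq p q * matSO (transporter J)⁻¹ :=
  (congrArg Subtype.val (transporter_smul J)).symm

theorem coe_basePt_eq_conj (J : Fpq p q) :
    Jpq p q = matSO (transporter J)⁻¹ * J.1 * matSO (transporter J)⁻¹⁻¹ :=
  (congrArg Subtype.val (inv_transporter_smul J)).symm

theorem range_dincl (J : Fpq p q) :
    Set.range (dincl (W := modelSpace p q) J) = mSpace J.1 := by
  ext B
  constructor
  · rintro ⟨v, rfl⟩
    rw [dincl_eq J v]
    have h1 := conj_mem_mSpace (transporter J) (twoRe_mem v)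
    rw [← coe_eq_conj] at h1
    have h2 := smul_mem_mSpace (-2) (mul_mem_mSpace h1)
    simpa only [Matrix.mul_assoc] using h2
  · intro hB
    have h1 := conj_mem_mSpace (transporter J)⁻¹ (smul_mem_mSpace (1 / 2) (mul_mem_mSpace hB))
    rw [← coe_basePt_eq_conj, inv_inv] at h1
    refine ⟨(toModel (matSO (transporter J)⁻¹ * ((1 / 2 : ℝ) • (J.1 * B)) *
      matSO (transporter J)) : modelSpace p q), (dincl_eq J _).trans ?_⟩
    rw [twoRe_toModel h1]
    simp only [Matrix.mul_assoc, matSO_mul_inv_assoc, matSO_mul_inv, Matrix.mul_one,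
      Matrix.smul_mul, Matrix.mul_smul, smul_smul]
    rw [← Matrix.mul_assoc, Fpq_mul_self]
    norm_num

theorem dincl_complexStructure (J : Fpq p q) (v : modelSpace p q) :
    dincl (W := modelSpace p q) J (complexStructure (W := modelSpace p q) J v)
      = J.1 * dincl (W := modelSpace p q) J v := by
  change dincl (W := modelSpace p q) J (Complex.I • v : modelSpace p q) = _
  rw [dincl_eq, dincl_eq, twoRe_I_smul, Matrix.mul_smul]
  congr 1
  have hJk : J.1 * matSO (transporter J) = matSO (transporter J) * Jpq p q := by
    conv_lhs => rw [coe_eq_conj J]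
    rw [Matrix.mul_assoc, matSO_inv_mul, Matrix.mul_one]
  rw [← Matrix.mul_assoc _ (Jpq p q), Matrix.mul_assoc J.1 _ (Jpq p q), ← hJk]
  simp only [Matrix.mul_assoc]

theorem dincl_injective (J : Fpq p q) {v w : modelSpace p q}
    (h : dincl (W := modelSpace p q) J v = dincl (W := modelSpace p q) J w) : v = w := by
  rw [dincl_eq, dincl_eq] at h
  have h1 := congrArg (fun X => (1 / 2 : ℝ) •
    (matSO (transporter J)⁻¹ * (J.1 * X) * matSO (transporter J))) h
  apply twoRe_injective
  have h2 : ∀ u : modelSpace p q, (1 / 2 : ℝ) • (matSO (transporter J)⁻¹ * (J.1 * ((-2 : ℝ) •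
      (J.1 * matSO (transporter J) * twoRe u * matSO (transporter J)⁻¹)))
        * matSO (transporter J)) = twoRe u := fun u => by
    simp only [Matrix.smul_mul, Matrix.mul_smul, smul_smul, ← Matrix.mul_assoc]
    rw [Matrix.mul_assoc _ J.1 J.1, Fpq_mul_self]
    simp only [Matrix.mul_neg, Matrix.neg_mul, Matrix.mul_one, matSO_inv_mul, Matrix.one_mul]
    rw [Matrix.mul_assoc (twoRe u), matSO_inv_mul, Matrix.mul_one]
    norm_num
  simpa only [h2] using h1

/-! ### Bilinear forms and vector fields on manifolds mapped to a vector space -/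

section Pullback

variable {W : Type*} [NormedAddCommGroup W] [NormedSpace ℝ W]
  {M : Type*} [TopologicalSpace M] [ChartedSpace W M]
  {E : Type*} [NormedAddCommGroup E] [NormedSpace ℝ E]

/-- The pullback of a bilinear form under a linear map, as a function of the linear map. -/
def pullbackBilin (β : E →L[ℝ] E →L[ℝ] ℝ) (D : W →L[ℝ] E) : W →L[ℝ] W →L[ℝ] ℝ :=
  ((ContinuousLinearMap.compL ℝ W E ℝ).flip D).comp (β.comp D)

theorem pullbackBilin_apply (β : E →L[ℝ] E →L[ℝ] ℝ) (D : W →L[ℝ] E) (v w : W) :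
    pullbackBilin β D v w = β (D v) (D w) := rfl

theorem contDiff_pullbackBilin [FiniteDimensional ℝ W] {n : ℕ∞ω} (β : E →L[ℝ] E →L[ℝ] ℝ) :
    ContDiff ℝ n (pullbackBilin β : (W →L[ℝ] E) → _) := by
  refine contDiff_clm_apply_iff.2 fun v => contDiff_clm_apply_iff.2 fun w => ?_
  simp only [pullbackBilin_apply]
  exact (β.contDiff.comp (contDiff_id.clm_apply contDiff_const)).clm_apply
    (contDiff_id.clm_apply contDiff_const)

theorem two_le_infty : (2 : ℕ∞ω) ≤ ∞ :=
  show ((2 : ℕ∞) : ℕ∞ω) ≤ ((⊤ : ℕ∞) : ℕ∞ω) from WithTop.coe_le_coe.2 le_top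

/-- The expression of a vector field in the preferred chart at `x`. -/
def chartField (x : M) (X : ∀ y : M, TangentSpace 𝓘(ℝ, W) y) (z : W) : W :=
  VectorField.mpullbackWithin 𝓘(ℝ, W) 𝓘(ℝ, W) (extChartAt 𝓘(ℝ, W) x).symm X
    (Set.range 𝓘(ℝ, W)) z

theorem chartField_eq (x : M) (X : ∀ y : M, TangentSpace 𝓘(ℝ, W) y) :
    chartField x X = VectorField.mpullbackWithin 𝓘(ℝ, W) 𝓘(ℝ, W) (extChartAt 𝓘(ℝ, W) x).symm X
      Set.univ := by
  funext z
  rw [chartField, modelWithCornersSelf_coe, Set.range_id]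

/-- The product rule for a bilinear map. -/
theorem mvfderiv_bilinear {F G : Type*} [NormedAddCommGroup F] [NormedSpace ℝ F]
    [NormedAddCommGroup G] [NormedSpace ℝ G] (B : E →L[ℝ] F →L[ℝ] G) {a : M → E} {b : M → F}
    {x : M} (ha : MDifferentiableAt 𝓘(ℝ, W) 𝓘(ℝ, E) a x)
    (hb : MDifferentiableAt 𝓘(ℝ, W) 𝓘(ℝ, F) b x) :
    MDifferentiableAt 𝓘(ℝ, W) 𝓘(ℝ, G) (fun y => B (a y) (b y)) x ∧
      ∀ v, mvfderiv 𝓘(ℝ, W) (fun y => B (a y) (b y)) x v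
        = B (mvfderiv 𝓘(ℝ, W) a x v) (b x) + B (a x) (mvfderiv 𝓘(ℝ, W) b x v) := by
  have h1 : HasMFDerivAt 𝓘(ℝ, W) 𝓘(ℝ, E × F) (fun y => (a y, b y)) x
      ((mfderiv 𝓘(ℝ, W) 𝓘(ℝ, E) a x : W →L[ℝ] E).prod (mfderiv 𝓘(ℝ, W) 𝓘(ℝ, F) b x)) :=
    ⟨ha.continuousAt.prodMk hb.continuousAt, ha.hasMFDerivAt.2.prodMk hb.hasMFDerivAt.2⟩
  have h2 := (B.hasFDerivAt_of_bilinear (hasFDerivAt_fst (p := (a x, b x)))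
    (hasFDerivAt_snd (p := (a x, b x)))).hasMFDerivAt
  have h3 := HasMFDerivAt.comp x h2 h1
  refine ⟨h3.mdifferentiableAt, fun v => ?_⟩
  have h4 := congrArg (fun L => (L v : G)) h3.mfderiv
  refine Eq.trans ?_ (h4.trans (add_comm _ _))
  rfl

variable [IsManifold 𝓘(ℝ, W) ∞ M]

/-- A constant bilinear form on a vector space pulls back under a smooth map to a smooth field of
bilinear forms. -/
theorem contMDiff_pullbackBilin [FiniteDimensional ℝ W] {f : M → E} (hf : ContMDiff 𝓘(ℝ, W) 𝓘(ℝ, E) ∞ f)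
    (β : E →L[ℝ] E →L[ℝ] ℝ) :
    ContMDiff 𝓘(ℝ, W) (𝓘(ℝ, W).prod 𝓘(ℝ, W →L[ℝ] W →L[ℝ] ℝ)) ∞
      (fun x : M => Bundle.TotalSpace.mk' (W →L[ℝ] W →L[ℝ] ℝ)
        (E := fun x : M => TangentSpace 𝓘(ℝ, W) x →L[ℝ] TangentSpace 𝓘(ℝ, W) x →L[ℝ] ℝ) x
        (pullbackBilin (W := W) (E := E) β (mfderiv 𝓘(ℝ, W) 𝓘(ℝ, E) f x))) := by
  intro x₀
  refine Bundle.contMDiffAt_totalSpace.2 ⟨contMDiffAt_id, ?_⟩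
  have h1 : ContMDiffAt 𝓘(ℝ, W) 𝓘(ℝ, W →L[ℝ] E) ∞
      (inTangentCoordinates 𝓘(ℝ, W) 𝓘(ℝ, E) id f (mfderiv 𝓘(ℝ, W) 𝓘(ℝ, E) f) x₀) x₀ :=
    (hf x₀).mfderiv_const (by simp)
  have h2 := (contDiff_pullbackBilin (n := ∞) β).contMDiff.contMDiffAt.comp x₀ h1
  refine h2.congr_of_eventuallyEq ?_
  filter_upwards [(trivializationAt W (TangentSpace 𝓘(ℝ, W)) x₀).open_baseSet.mem_nhds
    (FiberBundle.mem_baseSet_trivializationAt' x₀)] with x hx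
  ext v w
  refine (inCoordinates_apply_eq₂ (E₃ := Bundle.Trivial M ℝ) hx hx (Set.mem_univ _)).trans ?_
  have h3 (u : W) : inTangentCoordinates 𝓘(ℝ, W) 𝓘(ℝ, E) id f (mfderiv 𝓘(ℝ, W) 𝓘(ℝ, E) f) x₀ x u
      = mfderiv 𝓘(ℝ, W) 𝓘(ℝ, E) f x
        ((trivializationAt W (TangentSpace 𝓘(ℝ, W)) x₀).symm x u) := by
    simp [inTangentCoordinates, ContinuousLinearMap.inCoordinates]
    change (mfderiv 𝓘(ℝ, W) 𝓘(ℝ, E) f x)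
      ((trivializationAt W (TangentSpace 𝓘(ℝ, W)) x₀).symmL ℝ x u) = _
    rw [Bundle.Trivialization.symmL_apply _ hx]
  rw [Function.comp_apply, pullbackBilin_apply, h3, h3]
  simp
  rfl

theorem differentiableAt_chartField [CompleteSpace W] {x : M}
    {X : ∀ y : M, TangentSpace 𝓘(ℝ, W) y}
    (hX : MDifferentiableAt 𝓘(ℝ, W) 𝓘(ℝ, W).tangent
      (fun y => (⟨y, X y⟩ : TangentBundle 𝓘(ℝ, W) M)) x) :
    DifferentiableAt ℝ (chartField x X) (extChartAt 𝓘(ℝ, W) x x) := by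
  have : IsManifold 𝓘(ℝ, W) 2 M := IsManifold.of_le (n := ∞) two_le_infty
  have h := (mdifferentiableWithinAt_univ.2 hX).differentiableWithinAt_mpullbackWithin_vectorField
  simp only [Set.preimage_univ, Set.univ_inter, modelWithCornersSelf_coe, Set.range_id] at h
  rw [chartField_eq]
  exact differentiableWithinAt_univ.1 h

/-- The derivative of a function along a vector field, computed in a chart. -/
theorem mvfderiv_eq_fderiv_chartField {x : M} {F : M → E} {X : ∀ y : M, TangentSpace 𝓘(ℝ, W) y}
    {z : W} (hz : z ∈ (extChartAt 𝓘(ℝ, W) x).target)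
    (hF : MDifferentiableAt 𝓘(ℝ, W) 𝓘(ℝ, E) F ((extChartAt 𝓘(ℝ, W) x).symm z)) :
    mvfderiv 𝓘(ℝ, W) F ((extChartAt 𝓘(ℝ, W) x).symm z) (X ((extChartAt 𝓘(ℝ, W) x).symm z))
      = fderiv ℝ (F ∘ (extChartAt 𝓘(ℝ, W) x).symm) z (chartField x X z) := by
  have : IsManifold 𝓘(ℝ, W) 1 M := IsManifold.of_le (n := ∞) (by exact_mod_cast le_top)
  have hinv := isInvertible_mfderivWithin_extChartAt_symm (I := 𝓘(ℝ, W)) hz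
  have hs : MDifferentiableAt 𝓘(ℝ, W) 𝓘(ℝ, W) (extChartAt 𝓘(ℝ, W) x).symm z := by
    have := mdifferentiableWithinAt_extChartAt_symm (I := 𝓘(ℝ, W)) hz
    rwa [modelWithCornersSelf_coe, Set.range_id, mdifferentiableWithinAt_univ] at this
  have hc := mfderiv_comp z hF hs
  rw [mfderiv_eq_fderiv] at hc
  rw [hc]
  rw [modelWithCornersSelf_coe, Set.range_id, mfderivWithin_univ] at hinv
  have h1 : chartField x X z
      = (mfderiv 𝓘(ℝ, W) 𝓘(ℝ, W) (extChartAt 𝓘(ℝ, W) x).symm z).inverse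
        (X ((extChartAt 𝓘(ℝ, W) x).symm z)) := by
    rw [chartField_eq, VectorField.mpullbackWithin_apply, mfderivWithin_univ]
  rw [h1]
  obtain ⟨e, he⟩ := hinv
  change mfderiv 𝓘(ℝ, W) 𝓘(ℝ, E) F _ _ = (mfderiv 𝓘(ℝ, W) 𝓘(ℝ, E) F _) (_)
  congr 1
  rw [← he, ContinuousLinearMap.inverse_equiv]
  exact (e.apply_symm_apply _).symm

theorem mvfderiv_eq_fderiv_chartField_self {x : M} {F : M → E}
    {X : ∀ y : M, TangentSpace 𝓘(ℝ, W) y} (hF : MDifferentiableAt 𝓘(ℝ, W) 𝓘(ℝ, E) F x) :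
    mvfderiv 𝓘(ℝ, W) F x (X x) = fderiv ℝ (F ∘ (extChartAt 𝓘(ℝ, W) x).symm)
      (extChartAt 𝓘(ℝ, W) x x) (chartField x X (extChartAt 𝓘(ℝ, W) x x)) := by
  have h0 : (extChartAt 𝓘(ℝ, W) x).symm (extChartAt 𝓘(ℝ, W) x x) = x := extChartAt_to_inv x
  rw [← mvfderiv_eq_fderiv_chartField (mem_extChartAt_target x) (h0.symm ▸ hF)]
  exact congrArg (fun y => (mvfderiv 𝓘(ℝ, W) F y (X y) : E)) h0.symm

theorem contDiffOn_comp_extChartAt_symm {f : M → E} (hf : ContMDiff 𝓘(ℝ, W) 𝓘(ℝ, E) ∞ f) (x : M) :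
    ContDiffOn ℝ ∞ (f ∘ (extChartAt 𝓘(ℝ, W) x).symm) (extChartAt 𝓘(ℝ, W) x).target :=
  contMDiffOn_iff_contDiffOn.1 (hf.comp_contMDiffOn (contMDiffOn_extChartAt_symm x))

variable {f : M → E} {x : M} {X Y : ∀ y : M, TangentSpace 𝓘(ℝ, W) y}

theorem eventuallyEq_fderiv_chartField (hf : ContMDiff 𝓘(ℝ, W) 𝓘(ℝ, E) ∞ f) :
    (fun y => mvfderiv 𝓘(ℝ, W) f y (X y)) ∘ (extChartAt 𝓘(ℝ, W) x).symm
      =ᶠ[𝓝 (extChartAt 𝓘(ℝ, W) x x)]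
      fun z => fderiv ℝ (f ∘ (extChartAt 𝓘(ℝ, W) x).symm) z (chartField x X z) := by
  filter_upwards [extChartAt_target_mem_nhds (I := 𝓘(ℝ, W)) x] with z hz
  exact mvfderiv_eq_fderiv_chartField hz (hf.mdifferentiable (by simp) _)

theorem contDiffAt_comp_extChartAt_symm (hf : ContMDiff 𝓘(ℝ, W) 𝓘(ℝ, E) ∞ f) :
    ContDiffAt ℝ ∞ (f ∘ (extChartAt 𝓘(ℝ, W) x).symm) (extChartAt 𝓘(ℝ, W) x x) :=
  (contDiffOn_comp_extChartAt_symm hf x).contDiffAt (extChartAt_target_mem_nhds x)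

theorem hasFDerivAt_fderiv_chartField [CompleteSpace W]
    (hf : ContMDiff 𝓘(ℝ, W) 𝓘(ℝ, E) ∞ f)
    (hX : MDifferentiableAt 𝓘(ℝ, W) 𝓘(ℝ, W).tangent
      (fun y => (⟨y, X y⟩ : TangentBundle 𝓘(ℝ, W) M)) x) :
    HasFDerivAt (fun z => fderiv ℝ (f ∘ (extChartAt 𝓘(ℝ, W) x).symm) z (chartField x X z))
      ((fderiv ℝ (f ∘ (extChartAt 𝓘(ℝ, W) x).symm) (extChartAt 𝓘(ℝ, W) x x)).comp
        (fderiv ℝ (chartField x X) (extChartAt 𝓘(ℝ, W) x x))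
        + (fderiv ℝ (fderiv ℝ (f ∘ (extChartAt 𝓘(ℝ, W) x).symm))
          (extChartAt 𝓘(ℝ, W) x x)).flip (chartField x X (extChartAt 𝓘(ℝ, W) x x)))
      (extChartAt 𝓘(ℝ, W) x x) :=
  ((((contDiffAt_comp_extChartAt_symm hf).fderiv_right (m := 1)
    (by exact two_le_infty)).differentiableAt (by simp)).hasFDerivAt).clm_apply
      (differentiableAt_chartField hX).hasFDerivAt

/-- The derivative of a smooth map to a vector space along a differentiable vector field is
differentiable. -/
theorem mdifferentiableAt_mvfderiv_apply [CompleteSpace W]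
    (hf : ContMDiff 𝓘(ℝ, W) 𝓘(ℝ, E) ∞ f)
    (hX : MDifferentiableAt 𝓘(ℝ, W) 𝓘(ℝ, W).tangent
      (fun y => (⟨y, X y⟩ : TangentBundle 𝓘(ℝ, W) M)) x) :
    MDifferentiableAt 𝓘(ℝ, W) 𝓘(ℝ, E) (fun y => mvfderiv 𝓘(ℝ, W) f y (X y)) x := by
  have : IsManifold 𝓘(ℝ, W) 1 M := IsManifold.of_le (n := ∞) (by exact_mod_cast le_top)
  have h1 := (hasFDerivAt_fderiv_chartField hf hX).differentiableAt.mdifferentiableAt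
  have h2 := h1.comp x (mdifferentiableAt_extChartAt (I := 𝓘(ℝ, W)) (mem_chart_source W x))
  refine h2.congr_of_eventuallyEq ?_
  filter_upwards [extChartAt_source_mem_nhds (I := 𝓘(ℝ, W)) x] with y hy
  have h3 := mvfderiv_eq_fderiv_chartField (X := X) ((extChartAt 𝓘(ℝ, W) x).map_source hy)
    (hf.mdifferentiable (by simp) _)
  rw [Function.comp_apply, ← h3]
  exact congrArg (fun y => (mvfderiv 𝓘(ℝ, W) f y (X y) : E))
    ((extChartAt 𝓘(ℝ, W) x).left_inv hy).symm

/-- A smooth map `f` to a vector space maps the bracket of two vector fields to the commutator of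
the derivatives of `df(X)` and `df(Y)`. -/
theorem mvfderiv_mlieBracket [CompleteSpace W]
    (hf : ContMDiff 𝓘(ℝ, W) 𝓘(ℝ, E) ∞ f)
    (hX : MDifferentiableAt 𝓘(ℝ, W) 𝓘(ℝ, W).tangent
      (fun y => (⟨y, X y⟩ : TangentBundle 𝓘(ℝ, W) M)) x)
    (hY : MDifferentiableAt 𝓘(ℝ, W) 𝓘(ℝ, W).tangent
      (fun y => (⟨y, Y y⟩ : TangentBundle 𝓘(ℝ, W) M)) x) :
    mvfderiv 𝓘(ℝ, W) f x (VectorField.mlieBracket 𝓘(ℝ, W) X Y x)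
      = mvfderiv 𝓘(ℝ, W) (fun y => mvfderiv 𝓘(ℝ, W) f y (Y y)) x (X x)
        - mvfderiv 𝓘(ℝ, W) (fun y => mvfderiv 𝓘(ℝ, W) f y (X y)) x (Y x) := by
  have : IsManifold 𝓘(ℝ, W) 1 M := IsManifold.of_le (n := ∞) (by exact_mod_cast le_top)
  rw [mvfderiv_eq_fderiv_chartField_self (mdifferentiableAt_mvfderiv_apply hf hX),
    mvfderiv_eq_fderiv_chartField_self (mdifferentiableAt_mvfderiv_apply hf hY),
    (eventuallyEq_fderiv_chartField hf).fderiv_eq, (eventuallyEq_fderiv_chartField hf).fderiv_eq,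
    (hasFDerivAt_fderiv_chartField hf hX).fderiv, (hasFDerivAt_fderiv_chartField hf hY).fderiv]
  have hsymm := (contDiffAt_comp_extChartAt_symm hf (x := x)).isSymmSndFDerivAt
    (by simpa using two_le_infty)
  -- the differential of the chart identifies the brackets
  have hb : mvfderiv 𝓘(ℝ, W) f x (VectorField.mlieBracket 𝓘(ℝ, W) X Y x)
      = fderiv ℝ (f ∘ (extChartAt 𝓘(ℝ, W) x).symm) (extChartAt 𝓘(ℝ, W) x x)
        (VectorField.lieBracket ℝ (chartField x X) (chartField x Y)
          (extChartAt 𝓘(ℝ, W) x x)) := by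
    have h1 : f =ᶠ[𝓝 x] (f ∘ (extChartAt 𝓘(ℝ, W) x).symm) ∘ extChartAt 𝓘(ℝ, W) x := by
      filter_upwards [extChartAt_source_mem_nhds (I := 𝓘(ℝ, W)) x] with y hy
      simp only [Function.comp_apply, (extChartAt 𝓘(ℝ, W) x).left_inv hy]
    have h2 := h1.mfderiv_eq (I := 𝓘(ℝ, W)) (I' := 𝓘(ℝ, E))
    rw [mfderiv_comp x (I' := 𝓘(ℝ, W))
      ((contDiffAt_comp_extChartAt_symm hf).differentiableAt (by simp)).mdifferentiableAt
      (mdifferentiableAt_extChartAt (mem_chart_source W x)), mfderiv_eq_fderiv] at h2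
    obtain ⟨e, he⟩ := isInvertible_mfderiv_extChartAt (I := 𝓘(ℝ, W)) (mem_extChartAt_source x)
    have h3 : VectorField.mlieBracket 𝓘(ℝ, W) X Y x
        = (mfderiv 𝓘(ℝ, W) 𝓘(ℝ, W) (extChartAt 𝓘(ℝ, W) x) x).inverse
          (VectorField.lieBracket ℝ (chartField x X) (chartField x Y)
            (extChartAt 𝓘(ℝ, W) x x) : W) := by
      rw [VectorField.mlieBracket, VectorField.mlieBracketWithin_apply]
      simp only [Set.preimage_univ, Set.univ_inter, modelWithCornersSelf_coe, Set.range_id,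
        chartField_eq]
      exact congrArg _ (congrFun VectorField.lieBracketWithin_univ _)
    rw [h3]
    change mfderiv 𝓘(ℝ, W) 𝓘(ℝ, E) f x _ = _
    rw [h2, ← he, ContinuousLinearMap.inverse_equiv]
    exact congrArg _ (e.apply_symm_apply _)
  rw [hb, VectorField.lieBracket]
  have hs := hsymm (chartField x X (extChartAt 𝓘(ℝ, W) x x))
    (chartField x Y (extChartAt 𝓘(ℝ, W) x x))
  simp only [add_apply, ContinuousLinearMap.comp_apply,
    ContinuousLinearMap.flip_apply, map_sub, hs]
  abel

end Pullback

/-! ### The Killing form -/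

section Trace

variable {ι : Type*} [Fintype ι] [DecidableEq ι]

theorem trace_eq_sum_single (f : Matrix ι ι ℝ →ₗ[ℝ] Matrix ι ι ℝ) :
    LinearMap.trace ℝ _ f = ∑ i, ∑ j, f (Matrix.single i j 1) i j := by
  rw [LinearMap.trace_eq_matrix_trace ℝ (Matrix.stdBasis ℝ ι ι), Matrix.trace,
    Fintype.sum_prod_type]
  refine Finset.sum_congr rfl fun i _ => Finset.sum_congr rfl fun j _ => ?_
  rw [Matrix.diag_apply, LinearMap.toMatrix_apply, Matrix.stdBasis_eq_single]
  rfl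

/-- The trace of `Z ↦ P Z Q`. -/
theorem trace_mulLeft_mulRight (P Q : Matrix ι ι ℝ) (f : Matrix ι ι ℝ →ₗ[ℝ] Matrix ι ι ℝ)
    (hf : ∀ Z, f Z = P * Z * Q) : LinearMap.trace ℝ _ f = P.trace * Q.trace := by
  rw [trace_eq_sum_single, Matrix.trace, Matrix.trace, Finset.sum_mul_sum]
  refine Finset.sum_congr rfl fun i _ => Finset.sum_congr rfl fun j _ => ?_
  rw [hf, Matrix.mul_apply, Finset.sum_eq_single j]
  · simp
  · intro b _ hb
    rw [Matrix.mul_single_apply_of_ne (hbj := hb), zero_mul]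
  · simp

/-- The trace of `Z ↦ P Zᵀ Q`. -/
theorem trace_mul_transpose_mul (P Q : Matrix ι ι ℝ) (f : Matrix ι ι ℝ →ₗ[ℝ] Matrix ι ι ℝ)
    (hf : ∀ Z, f Z = P * Zᵀ * Q) : LinearMap.trace ℝ _ f = (P * Qᵀ).trace := by
  rw [trace_eq_sum_single, Matrix.trace]
  refine Finset.sum_congr rfl fun i _ => ?_
  rw [Matrix.diag_apply, Matrix.mul_apply]
  refine Finset.sum_congr rfl fun j _ => ?_
  rw [hf, Matrix.transpose_single, Matrix.mul_apply, Finset.sum_eq_single i]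
  · simp
  · intro b _ hb
    rw [Matrix.mul_single_apply_of_ne (hbj := hb), zero_mul]
  · simp

end Trace

theorem conj_transpose_of_mem_soLie {A : Matrix (Idx p q) (Idx p q) ℝ} (hA : A ∈ soLie p q) :
    Ipq p q * Aᵀ * Ipq p q = -A := by
  rw [Matrix.mul_assoc, mem_soLie_iff.1 hA, Matrix.mul_neg, ← Matrix.mul_assoc, Ipq_mul_self,
    Matrix.one_mul]

theorem trace_of_mem_soLie {A : Matrix (Idx p q) (Idx p q) ℝ} (hA : A ∈ soLie p q) :
    A.trace = 0 := by
  have h := congrArg Matrix.trace (conj_transpose_of_mem_soLie hA)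
  rw [Matrix.mul_assoc, Matrix.trace_mul_comm, Matrix.mul_assoc, Ipq_mul_self, Matrix.mul_one,
    Matrix.trace_transpose, Matrix.trace_neg] at h
  linarith

/-- The projection of the space of matrices onto `so_{2p,2q}`. -/
def soProj (p q : ℕ) : Matrix (Idx p q) (Idx p q) ℝ →ₗ[ℝ] Matrix (Idx p q) (Idx p q) ℝ where
  toFun Z := (1 / 2 : ℝ) • (Z - Ipq p q * Zᵀ * Ipq p q)
  map_add' X Y := by
    rw [Matrix.transpose_add, mul_add, add_mul]; module
  map_smul' c X := by
    rw [Matrix.transpose_smul, Matrix.mul_smul, Matrix.smul_mul, RingHom.id_apply]; module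

theorem soProj_apply (Z : Matrix (Idx p q) (Idx p q) ℝ) :
    soProj p q Z = (1 / 2 : ℝ) • (Z - Ipq p q * Zᵀ * Ipq p q) := rfl

theorem soProj_mem (Z : Matrix (Idx p q) (Idx p q) ℝ) : soProj p q Z ∈ soLie p q := by
  rw [mem_soLie_iff, soProj_apply]
  simp only [Matrix.transpose_smul, Matrix.transpose_sub, Matrix.transpose_mul, Ipq_transpose,
    Matrix.transpose_transpose, Matrix.smul_mul, Matrix.mul_smul, sub_mul, mul_sub]
  simp only [← Matrix.mul_assoc, Ipq_mul_self, Matrix.one_mul]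
  simp only [Matrix.mul_assoc, Ipq_mul_self, Matrix.mul_one]
  module

theorem soProj_eq_self {Z : Matrix (Idx p q) (Idx p q) ℝ} (hZ : Z ∈ soLie p q) :
    soProj p q Z = Z := by
  rw [soProj_apply, conj_transpose_of_mem_soLie hZ]; module

/-- The Killing form of `so_N` is `(N - 2) tr(AB)`: its value is the trace of `ad A ∘ ad B`,
composed with the projection onto `so_N`, on the space of all matrices. -/
theorem killingForm_soLie (A B : soLie p q) :
    killingForm ℝ (soLie p q) A B = (2 * (p + q) - 2 : ℝ) * (A.1 * B.1).trace := by
  obtain ⟨A, hA⟩ := A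
  obtain ⟨B, hB⟩ := B
  set T : Matrix (Idx p q) (Idx p q) ℝ →ₗ[ℝ] Matrix (Idx p q) (Idx p q) ℝ :=
    (LieAlgebra.ad ℝ _ A : Module.End ℝ _) ∘ₗ (LieAlgebra.ad ℝ _ B : Module.End ℝ _) ∘ₗ soProj p q
    with hT
  have hmem (Z) : T Z ∈ (soLie p q).toSubmodule :=
    (soLie p q).lie_mem hA ((soLie p q).lie_mem hB (soProj_mem Z))
  have h1 : killingForm ℝ (soLie p q) ⟨A, hA⟩ ⟨B, hB⟩ = LinearMap.trace ℝ _ T := by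
    rw [← LinearMap.trace_restrict_eq_of_forall_mem _ T hmem, LieModule.traceForm_apply_apply]
    congr 1
    ext Z : 1
    apply Subtype.ext
    change ⁅A, ⁅B, Z.1⁆⁆ = ⁅A, ⁅B, soProj p q Z.1⁆⁆
    rw [soProj_eq_self Z.2]
  let L (P Q : Matrix (Idx p q) (Idx p q) ℝ) :
      Matrix (Idx p q) (Idx p q) ℝ →ₗ[ℝ] Matrix (Idx p q) (Idx p q) ℝ :=
    LinearMap.mulLeft ℝ P ∘ₗ LinearMap.mulRight ℝ Q
  have hL (P Q) : LinearMap.trace ℝ _ (L P Q) = P.trace * Q.trace :=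
    trace_mulLeft_mulRight P Q _ fun Z =>
      (Matrix.mul_assoc P _ Q).symm
  let R (P Q : Matrix (Idx p q) (Idx p q) ℝ) :
      Matrix (Idx p q) (Idx p q) ℝ →ₗ[ℝ] Matrix (Idx p q) (Idx p q) ℝ :=
    L P Q ∘ₗ (Matrix.transposeLinearEquiv (Idx p q) (Idx p q) ℝ ℝ).toLinearMap
  have hR (P Q) : LinearMap.trace ℝ _ (R P Q) = (P * Qᵀ).trace :=
    trace_mul_transpose_mul P Q _ fun Z =>
      (Matrix.mul_assoc P _ Q).symm
  have hdec : T = (1 / 2 : ℝ) • ((L (A * B) 1 - L A B - L B A + L 1 (B * A))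
      - (R (A * B * Ipq p q) (Ipq p q) - R (A * Ipq p q) (Ipq p q * B)
        - R (B * Ipq p q) (Ipq p q * A) + R (Ipq p q) (Ipq p q * B * A))) := by
    apply LinearMap.ext
    intro Z
    change ⁅A, ⁅B, soProj p q Z⁆⁆ = (1 / 2 : ℝ) • ((A * B * (Z * 1) - A * (Z * B) - B * (Z * A)
      + 1 * (Z * (B * A))) - (A * B * Ipq p q * (Zᵀ * Ipq p q) - A * Ipq p q * (Zᵀ * (Ipq p q * B))
        - B * Ipq p q * (Zᵀ * (Ipq p q * A)) + Ipq p q * (Zᵀ * (Ipq p q * B * A))))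
    rw [soProj_apply, Ring.lie_def, Ring.lie_def]
    simp only [Matrix.smul_mul, Matrix.mul_smul, sub_mul, mul_sub, Matrix.one_mul, Matrix.mul_one,
      Matrix.mul_assoc]
    module
  have e1 : (A * Ipq p q * (Ipq p q * B)ᵀ).trace = -(A * B).trace := by
    rw [Matrix.transpose_mul, Ipq_transpose, Matrix.mul_assoc, ← Matrix.mul_assoc (Ipq p q),
      conj_transpose_of_mem_soLie hB, Matrix.mul_neg, Matrix.trace_neg]
  have e2 : (B * Ipq p q * (Ipq p q * A)ᵀ).trace = -(A * B).trace := by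
    rw [Matrix.transpose_mul, Ipq_transpose, Matrix.mul_assoc, ← Matrix.mul_assoc (Ipq p q),
      conj_transpose_of_mem_soLie hA, Matrix.mul_neg, Matrix.trace_neg, Matrix.trace_mul_comm]
  have e3 : (A * B * Ipq p q * (Ipq p q)ᵀ).trace = (A * B).trace := by
    rw [Ipq_transpose, Matrix.mul_assoc, Ipq_mul_self, Matrix.mul_one]
  have e4 : (Ipq p q * (Ipq p q * B * A)ᵀ).trace = (A * B).trace := by
    rw [Matrix.trace_mul_comm, ← Matrix.trace_transpose, Matrix.transpose_mul,
      Matrix.transpose_transpose, Ipq_transpose, Matrix.mul_assoc, ← Matrix.mul_assoc,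
      Ipq_mul_self, Matrix.one_mul, Matrix.trace_mul_comm]
  have hN : (1 : Matrix (Idx p q) (Idx p q) ℝ).trace = 2 * (p + q) := by
    rw [Matrix.trace_one]
    simp only [Fintype.card_sum, Fintype.card_fin]
    push_cast
    ring
  rw [h1, hdec]
  simp only [map_smul, map_sub, map_add, hL, hR, e1, e2, e3, e4, hN, trace_of_mem_soLie hA,
    trace_of_mem_soLie hB, smul_eq_mul, Matrix.trace_mul_comm B A]
  ring

/-- A product of three matrices that anticommute with a complex structure `J` anticommutes with
`J`, hence has trace zero. -/
theorem trace_mul_mul_eq_zero {J A B C : Matrix (Idx p q) (Idx p q) ℝ} (hJ : J * J = -1)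
    (hA : A * J = -(J * A)) (hB : B * J = -(J * B)) (hC : C * J = -(J * C)) :
    (A * B * C).trace = 0 := by
  have h1 : A * B * C * J = -(J * (A * B * C)) := by
    rw [Matrix.mul_assoc _ C, hC, Matrix.mul_neg, ← Matrix.mul_assoc (A * B), Matrix.mul_assoc A,
      hB, Matrix.mul_neg, ← Matrix.mul_assoc A, hA]
    simp only [Matrix.neg_mul, Matrix.mul_assoc, neg_neg]
  have h2 : (A * B * C * J * J).trace = (A * B * C).trace := by
    rw [h1, Matrix.neg_mul, Matrix.trace_neg, Matrix.trace_mul_comm, ← Matrix.mul_assoc, hJ]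
    simp
  rw [Matrix.mul_assoc, hJ] at h2
  simp only [Matrix.mul_neg, Matrix.mul_one, Matrix.trace_neg] at h2
  linarith

theorem trace_complex_mul_complex {J A B : Matrix (Idx p q) (Idx p q) ℝ} (hJ : J * J = -1)
    (hA : A * J = -(J * A)) : (J * A * (J * B)).trace = (A * B).trace := by
  rw [Matrix.mul_assoc, ← Matrix.mul_assoc A, hA, Matrix.neg_mul, Matrix.mul_neg,
    Matrix.mul_assoc, ← Matrix.mul_assoc J J, hJ]
  simp

theorem Fpq_transpose_mul (J : Fpq p q) : (J.1)ᵀ * Ipq p q = -(Ipq p q * J.1) := by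
  calc (J.1)ᵀ * Ipq p q = -((J.1)ᵀ * Ipq p q * J.1 * J.1) := by
        rw [Matrix.mul_assoc _ J.1, Fpq_mul_self, Matrix.mul_neg, Matrix.mul_one, neg_neg]
    _ = _ := by rw [Fpq_isometry]

theorem trace_mul_soProj {A : Matrix (Idx p q) (Idx p q) ℝ} (hA : A ∈ soLie p q)
    (Z : Matrix (Idx p q) (Idx p q) ℝ) : (A * soProj p q Z).trace = (A * Z).trace := by
  have h : (A * (Ipq p q * Zᵀ * Ipq p q)).trace = -(A * Z).trace := by
    rw [← Matrix.trace_transpose]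
    simp only [Matrix.transpose_mul, Matrix.transpose_transpose, Ipq_transpose]
    rw [Matrix.trace_mul_comm, ← Matrix.mul_assoc Aᵀ, mem_soLie_iff.1 hA, Matrix.neg_mul,
      Matrix.trace_neg, Matrix.mul_assoc, Matrix.trace_mul_comm, Matrix.mul_assoc,
      Matrix.mul_assoc Z, Ipq_mul_self, Matrix.mul_one]
  rw [soProj_apply, Matrix.mul_smul, mul_sub, Matrix.trace_smul, Matrix.trace_sub, h, smul_eq_mul]
  ring

/-- The trace form is nondegenerate on `𝔪_J`: the trace of `A ∈ 𝔪_J` against any matrix `Z` is its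
trace against the projection of `Z` onto `𝔪_J`. -/
theorem eq_zero_of_trace_mul_eq_zero (J : Fpq p q) {A : Matrix (Idx p q) (Idx p q) ℝ}
    (hA : A ∈ mSpace J.1) (h : ∀ B ∈ mSpace J.1, (A * B).trace = 0) : A = 0 := by
  obtain ⟨hA1, hA2⟩ := hA
  refine Matrix.ext_iff_trace_mul_right.2 fun Z => ?_
  have hY := mem_soLie_iff.1 (soProj_mem Z)
  set Y := soProj p q Z with hYdef
  have hB : (1 / 2 : ℝ) • (Y + J.1 * Y * J.1) ∈ mSpace J.1 := by
    rw [mem_mSpace_iff]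
    constructor
    · have h1 : (J.1 * Y * J.1)ᵀ * Ipq p q = -(Ipq p q * (J.1 * Y * J.1)) := by
        rw [Matrix.transpose_mul, Matrix.transpose_mul, Matrix.mul_assoc, Matrix.mul_assoc,
          Fpq_transpose_mul, Matrix.mul_neg, ← Matrix.mul_assoc Yᵀ, hY, Matrix.neg_mul, neg_neg,
          ← Matrix.mul_assoc, ← Matrix.mul_assoc, Fpq_transpose_mul]
        simp only [Matrix.neg_mul, Matrix.mul_assoc]
      rw [Matrix.transpose_smul, Matrix.transpose_add, Matrix.smul_mul, add_mul, h1, hY,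
        Matrix.mul_smul, mul_add]
      module
    · have h1 : J.1 * Y * J.1 * J.1 = -(J.1 * Y) := by
        rw [Matrix.mul_assoc _ J.1, Fpq_mul_self, Matrix.mul_neg, Matrix.mul_one]
      have h2 : J.1 * (J.1 * Y * J.1) = -(Y * J.1) := by
        rw [← Matrix.mul_assoc, ← Matrix.mul_assoc, Fpq_mul_self, Matrix.neg_mul, Matrix.one_mul,
          Matrix.neg_mul]
      rw [Matrix.smul_mul, add_mul, h1, Matrix.mul_smul, mul_add, h2]
      module
  have h3 : (A * (J.1 * Y * J.1)).trace = (A * Y).trace := by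
    rw [← Matrix.mul_assoc, ← Matrix.mul_assoc, hA2, Matrix.trace_mul_comm, Matrix.neg_mul,
      Matrix.mul_neg, Matrix.mul_assoc, ← Matrix.mul_assoc J.1, Fpq_mul_self]
    simp
  have h4 := h _ hB
  rw [Matrix.mul_smul, mul_add, Matrix.trace_smul, Matrix.trace_add, h3, hYdef,
    trace_mul_soProj hA1, smul_eq_mul] at h4
  rw [Matrix.zero_mul, Matrix.trace_zero]
  linarith

/-- Skew-symmetric `2 × 2` matrices commute. -/
theorem commute_of_transpose_eq_neg {ι : Type*} [Fintype ι] (hι : Fintype.card ι = 2)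
    {S T : Matrix ι ι ℝ} (hS : Sᵀ = -S) (hT : Tᵀ = -T) : S * T = T * S := by
  classical
  obtain ⟨a, b, hab, huniv⟩ := Finset.card_eq_two.1 (Finset.card_univ.trans hι)
  have hS' (i j) : S j i = -S i j := congrFun (congrFun hS i) j
  have hT' (i j) : T j i = -T i j := congrFun (congrFun hT i) j
  have ha := hS' a a
  have hb := hS' b b
  have ha' := hT' a a
  have hb' := hT' b b
  have hmem (i : ι) : i = a ∨ i = b := by
    have := Finset.mem_univ i
    rw [huniv] at this
    simpa using this
  have e1 : S a a = 0 := by linarith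
  have e2 : S b b = 0 := by linarith
  have e3 : T a a = 0 := by linarith
  have e4 : T b b = 0 := by linarith
  ext i j
  rw [Matrix.mul_apply, Matrix.mul_apply, huniv, Finset.sum_pair hab, Finset.sum_pair hab]
  rcases hmem i with h | h <;> rcases hmem j with h' | h' <;>
    simp only [h, h', e1, e2, e3, e4, hS' a b, hT' a b] <;> ring

theorem transpose_eq_neg_of_mul_Ipq (hpq : p + q = 1) {S : Matrix (Idx p q) (Idx p q) ℝ}
    (hS : Sᵀ * Ipq p q = -(Ipq p q * S)) : Sᵀ = -S := by
  have hI : Ipq p q = 1 ∨ Ipq p q = -1 := by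
    obtain ⟨rfl, rfl⟩ | ⟨rfl, rfl⟩ : (p = 1 ∧ q = 0) ∨ (p = 0 ∧ q = 1) := by omega
    · left
      rw [← Matrix.diagonal_one]
      refine congrArg Matrix.diagonal (funext fun i => ?_)
      rcases i with i | i
      · rfl
      · exact isEmptyElim i
    · right
      rw [← Matrix.diagonal_one, Matrix.diagonal_neg]
      refine congrArg Matrix.diagonal (funext fun i => ?_)
      rcases i with i | i
      · exact isEmptyElim i
      · rfl
  rcases hI with hI | hI
  · simpa [hI] using hS
  · rw [hI] at hS
    simpa using congrArg Neg.neg hS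

/-- If `p + q = 1`, then `𝔪_J = 0`. This is the only case in which the Killing form of
`so_{2p,2q}` vanishes. -/
theorem eq_zero_of_mem_mSpace (hpq : p + q = 1) (J : Fpq p q)
    {A : Matrix (Idx p q) (Idx p q) ℝ} (hA : A ∈ mSpace J.1) : A = 0 := by
  obtain ⟨hA1, hA2⟩ := hA
  have hcard : Fintype.card (Idx p q) = 2 := by
    simp only [Fintype.card_sum, Fintype.card_fin]; omega
  have hcomm : A * J.1 = J.1 * A := commute_of_transpose_eq_neg hcard
    (transpose_eq_neg_of_mul_Ipq hpq (mem_soLie_iff.1 hA1))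
    (transpose_eq_neg_of_mul_Ipq hpq (Fpq_transpose_mul J))
  have h1 : J.1 * A = 0 := by
    ext i j
    have := congrFun (congrFun (hcomm.symm.trans hA2) i) j
    rw [Matrix.neg_apply] at this
    rw [Matrix.zero_apply]
    linarith
  have h2 : J.1 * (J.1 * A) = -A := by
    rw [← Matrix.mul_assoc, Fpq_mul_self, Matrix.neg_mul, Matrix.one_mul]
  rw [h1, Matrix.mul_zero] at h2
  exact neg_eq_zero.1 h2.symm

/-! ### The action by holomorphic maps -/

/-- Between the charts centred at `J` and at `k • J`, the action of `k` is the identity. -/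
theorem contMDiff_smul {𝕜 : Type*} [NontriviallyNormedField 𝕜] [NormedSpace 𝕜 (modelSpace p q)]
    {n : ℕ∞ω} [IsManifold 𝓘(𝕜, modelSpace p q) n (Fpq p q)] (k : SO p q) :
    ContMDiff 𝓘(𝕜, modelSpace p q) 𝓘(𝕜, modelSpace p q) n (fun J : Fpq p q => k • J) := by
  intro J
  set l := transporter J
  have hmem (m : SO p q) :
      chartSO m ∈ IsManifold.maximalAtlas 𝓘(𝕜, modelSpace p q) n (Fpq p q) :=
    IsManifold.subset_maximalAtlas (Set.mem_range_self m)
  have hJ : J ∈ (chartSO l).source := mem_chart_source (modelSpace p q) J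
  have h1 := (contMDiffOn_of_mem_maximalAtlas (hmem l)).contMDiffAt
    ((chartSO l).open_source.mem_nhds hJ)
  have hZ : chartSO l J ∈ (chartSO (k * l)).target := by
    rw [chartSO_target, ← chartSO_target l]
    exact (chartSO l).map_source hJ
  have h2 := (contMDiffOn_symm_of_mem_maximalAtlas (hmem (k * l))).contMDiffAt
    ((chartSO (k * l)).open_target.mem_nhds hZ)
  refine (h2.comp J h1).congr_of_eventuallyEq ?_
  filter_upwards [(chartSO l).open_source.mem_nhds hJ] with J' hJ'
  rw [Function.comp_apply, chartSO_symm_apply, mul_smul, ← chartSO_symm_apply,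
    (chartSO l).left_inv hJ']

theorem mdifferentiableAt_smul (k : SO p q) (J : Fpq p q) :
    MDifferentiableAt 𝓘(ℝ, modelSpace p q) 𝓘(ℝ, modelSpace p q)
      (fun J : Fpq p q => k • J) J :=
  (contMDiff_smul (𝕜 := ℝ) (n := ∞) k).mdifferentiable (by simp) J

/-- Elements of `SO_{2p,2q}` act on tangent vectors by conjugation. -/
theorem dincl_smul (k : SO p q) (J : Fpq p q) (v : modelSpace p q) :
    dincl (W := modelSpace p q) (k • J)
        (mfderiv 𝓘(ℝ, modelSpace p q) 𝓘(ℝ, modelSpace p q) (fun J : Fpq p q => k • J) J v)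
      = matSO k * dincl (W := modelSpace p q) J v * matSO k⁻¹ := by
  have hi (J : Fpq p q) : MDifferentiableAt 𝓘(ℝ, modelSpace p q) 𝓘(ℝ, Idx p q → Idx p q → ℝ)
      (incl : Fpq p q → _) J := contMDiff_incl.mdifferentiable (by simp) J
  have h1 := mfderiv_comp J (hi (k • J)) (mdifferentiableAt_smul k J)
  have h2 := mfderiv_comp J
    ((conjL k).differentiableAt.mdifferentiableAt : MDifferentiableAt 𝓘(ℝ, Idx p q → Idx p q → ℝ)
      𝓘(ℝ, Idx p q → Idx p q → ℝ) (conjL k) (incl J)) (hi J)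
  have h3 : incl ∘ (fun J : Fpq p q => k • J) = conjL k ∘ incl := funext fun J => conjL_incl k J
  rw [← h3, h1, mfderiv_eq_fderiv, (conjL k).fderiv] at h2
  exact congrArg (fun L : modelSpace p q →L[ℝ] (Idx p q → Idx p q → ℝ) => Matrix.of (L v)) h2

/-! ### The pseudo-Kähler metric -/

/-- The trace form `(X, Y) ↦ tr(XY)` on the space of matrices. -/
def traceForm (p q : ℕ) :
    (Idx p q → Idx p q → ℝ) →L[ℝ] (Idx p q → Idx p q → ℝ) →L[ℝ] ℝ :=
  (ContinuousLinearMap.compL ℝ (Idx p q → Idx p q → ℝ) (Idx p q → Idx p q → ℝ) ℝ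
    (LinearMap.toContinuousLinearMap
      (Matrix.traceLinearMap (Idx p q) ℝ ℝ :))).comp (mulL p q)

/-- The multiple by `c` of the metric defined by the Killing form of `so_{2p,2q}`, which is
`2(p + q) - 2` times the trace form. -/
def kahlerMetric (p q : ℕ) (c : ℝ) : BilinField (modelSpace p q) (Fpq p q) := fun J =>
  pullbackBilin (W := modelSpace p q) (E := Idx p q → Idx p q → ℝ)
    ((c * (2 * (p + q) - 2)) • traceForm p q)
    (mfderiv 𝓘(ℝ, modelSpace p q) 𝓘(ℝ, Idx p q → Idx p q → ℝ) (incl : Fpq p q → _) J)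

theorem kahlerMetric_apply (c : ℝ) (J : Fpq p q) (v w : modelSpace p q) :
    kahlerMetric p q c J v w = c * (2 * (p + q) - 2)
      * (dincl (W := modelSpace p q) J v * dincl (W := modelSpace p q) J w).trace := rfl

theorem kahlerMetric_eq_killingForm (c : ℝ) (J : Fpq p q) (v w : modelSpace p q)
    (A B : soLie p q) (hA : A.1 = dincl (W := modelSpace p q) J v)
    (hB : B.1 = dincl (W := modelSpace p q) J w) :
    kahlerMetric p q c J v w = c * killingForm ℝ (soLie p q) A B := by
  rw [killingForm_soLie, hA, hB, kahlerMetric_apply, mul_assoc]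

theorem dincl_mem (J : Fpq p q) (v : modelSpace p q) :
    dincl (W := modelSpace p q) J v ∈ mSpace J.1 :=
  range_dincl J ▸ Set.mem_range_self v

/-- When `p + q = 1` the Killing form vanishes, but so do the tangent spaces. -/
theorem kahlerMetric_nondegenerate {c : ℝ} (hc : c ≠ 0) (J : Fpq p q) (v : modelSpace p q)
    (h : ∀ w : modelSpace p q, kahlerMetric p q c J v w = 0) : v = 0 := by
  have h0 : dincl (W := modelSpace p q) J v = 0 := by
    by_cases hpq : p + q = 1
    · exact eq_zero_of_mem_mSpace hpq J (dincl_mem J v)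
    · refine eq_zero_of_trace_mul_eq_zero J (dincl_mem J v) fun B hB => ?_
      rw [← range_dincl] at hB
      obtain ⟨w, rfl⟩ := hB
      have hne : c * (2 * (p + q) - 2 : ℝ) ≠ 0 := by
        refine mul_ne_zero hc fun h => hpq ?_
        have : ((p + q : ℕ) : ℝ) = 1 := by push_cast; linarith
        exact_mod_cast this
      exact (mul_eq_zero.1 (h w)).resolve_left hne
  refine dincl_injective J (h0.trans ?_)
  rw [dincl_eq, map_zero]
  simp

theorem kahlerMetric_smul (c : ℝ) (k : SO p q) (J : Fpq p q) (v w : modelSpace p q) :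
    kahlerMetric p q c (k • J)
      (mfderiv 𝓘(ℝ, modelSpace p q) 𝓘(ℝ, modelSpace p q) (fun J : Fpq p q => k • J) J v)
      (mfderiv 𝓘(ℝ, modelSpace p q) 𝓘(ℝ, modelSpace p q) (fun J : Fpq p q => k • J) J w)
      = kahlerMetric p q c J v w := by
  refine (kahlerMetric_apply c _ _ _).trans ?_
  rw [dincl_smul, dincl_smul, conj_mul_conj, Matrix.trace_mul_comm, ← Matrix.mul_assoc,
    matSO_inv_mul, Matrix.one_mul, kahlerMetric_apply]

theorem isHolomorphicIsometry_smul (c : ℝ) (k : SO p q) :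
    IsHolomorphicIsometry (kahlerMetric p q c) (fun J : Fpq p q => k • J) :=
  ⟨contMDiff_smul k, kahlerMetric_smul c k⟩

theorem kahlerMetric_hermitian (c : ℝ) (J : Fpq p q) (v w : modelSpace p q) :
    kahlerMetric p q c J (complexStructure (W := modelSpace p q) J v)
      (complexStructure (W := modelSpace p q) J w) = kahlerMetric p q c J v w := by
  refine (kahlerMetric_apply c J _ _).trans ?_
  rw [dincl_complexStructure, dincl_complexStructure,
    trace_complex_mul_complex (Fpq_mul_self J) (dincl_mem J v).2, kahlerMetric_apply]

/-! ### The fundamental form is closed -/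

theorem fundamentalForm_apply (c : ℝ) (J : Fpq p q) (v w : modelSpace p q) :
    fundamentalForm (kahlerMetric p q c) J v w = c * (2 * (p + q) - 2) *
      (J.1 * dincl (W := modelSpace p q) J v * dincl (W := modelSpace p q) J w).trace :=
  congrArg (fun A => c * (2 * (p + q) - 2) * (A * dincl (W := modelSpace p q) J w).trace)
    (dincl_complexStructure J v)

/-- A vector field on `F_{p,q}`, as a matrix-valued function. -/
def fieldMat (X : ∀ J : Fpq p q, TangentSpace 𝓘(ℝ, modelSpace p q) J) (J : Fpq p q) :
    Idx p q → Idx p q → ℝ :=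
  mvfderiv 𝓘(ℝ, modelSpace p q) (incl : Fpq p q → Idx p q → Idx p q → ℝ) J (X J)

/-- The derivative of a matrix-valued function on `F_{p,q}`. -/
def matDeriv (F : Fpq p q → Idx p q → Idx p q → ℝ) (J : Fpq p q) (v : modelSpace p q) :
    Matrix (Idx p q) (Idx p q) ℝ :=
  Matrix.of (mvfderiv 𝓘(ℝ, modelSpace p q) F J v)

variable {J : Fpq p q} {X Y : ∀ J : Fpq p q, TangentSpace 𝓘(ℝ, modelSpace p q) J}

theorem mdifferentiableAt_fieldMat
    (hX : ContMDiffAt 𝓘(ℝ, modelSpace p q) 𝓘(ℝ, modelSpace p q).tangent ∞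
      (fun y => (⟨y, X y⟩ : TangentBundle 𝓘(ℝ, modelSpace p q) (Fpq p q))) J) :
    MDifferentiableAt 𝓘(ℝ, modelSpace p q) 𝓘(ℝ, Idx p q → Idx p q → ℝ) (fieldMat X) J :=
  mdifferentiableAt_mvfderiv_apply contMDiff_incl (hX.mdifferentiableAt (by simp))

theorem mvfderiv_fundamentalForm (c : ℝ)
    (hX : ContMDiffAt 𝓘(ℝ, modelSpace p q) 𝓘(ℝ, modelSpace p q).tangent ∞
      (fun y => (⟨y, X y⟩ : TangentBundle 𝓘(ℝ, modelSpace p q) (Fpq p q))) J)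
    (hY : ContMDiffAt 𝓘(ℝ, modelSpace p q) 𝓘(ℝ, modelSpace p q).tangent ∞
      (fun y => (⟨y, Y y⟩ : TangentBundle 𝓘(ℝ, modelSpace p q) (Fpq p q))) J)
    (v : modelSpace p q) :
    mvfderiv 𝓘(ℝ, modelSpace p q) (fun y => fundamentalForm (kahlerMetric p q c) y (X y) (Y y)) J v
      = c * (2 * (p + q) - 2) *
        ((dincl (W := modelSpace p q) J v * dincl (W := modelSpace p q) J (X J)
            * dincl (W := modelSpace p q) J (Y J)).trace
          + (J.1 * matDeriv (fieldMat X) J v * dincl (W := modelSpace p q) J (Y J)).trace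
          + (J.1 * dincl (W := modelSpace p q) J (X J) * matDeriv (fieldMat Y) J v).trace) := by
  have h0 : (fun y => fundamentalForm (kahlerMetric p q c) y (X y) (Y y))
      = fun y => ((c * (2 * (p + q) - 2)) • traceForm p q) (mulL p q (incl y) (fieldMat X y))
        (fieldMat Y y) :=
    funext fun y => fundamentalForm_apply c y (X y) (Y y)
  have hi : MDifferentiableAt 𝓘(ℝ, modelSpace p q) 𝓘(ℝ, Idx p q → Idx p q → ℝ)
      (incl : Fpq p q → _) J := contMDiff_incl.mdifferentiable (by simp) J
  obtain ⟨h1, h1'⟩ := mvfderiv_bilinear (mulL p q) hi (mdifferentiableAt_fieldMat hX)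
  obtain ⟨-, h2⟩ := mvfderiv_bilinear ((c * (2 * (p + q) - 2)) • traceForm p q) h1
    (mdifferentiableAt_fieldMat hY)
  rw [h0]
  refine (h2 v).trans ?_
  rw [h1' v]
  change c * (2 * (p + q) - 2) * ((dincl (W := modelSpace p q) J v
      * dincl (W := modelSpace p q) J (X J) + J.1 * matDeriv (fieldMat X) J v)
        * dincl (W := modelSpace p q) J (Y J)).trace
    + c * (2 * (p + q) - 2) * (J.1 * dincl (W := modelSpace p q) J (X J)
        * matDeriv (fieldMat Y) J v).trace = _
  rw [add_mul, Matrix.trace_add]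
  ring

theorem dincl_mlieBracket
    (hX : ContMDiffAt 𝓘(ℝ, modelSpace p q) 𝓘(ℝ, modelSpace p q).tangent ∞
      (fun y => (⟨y, X y⟩ : TangentBundle 𝓘(ℝ, modelSpace p q) (Fpq p q))) J)
    (hY : ContMDiffAt 𝓘(ℝ, modelSpace p q) 𝓘(ℝ, modelSpace p q).tangent ∞
      (fun y => (⟨y, Y y⟩ : TangentBundle 𝓘(ℝ, modelSpace p q) (Fpq p q))) J) :
    dincl (W := modelSpace p q) J (VectorField.mlieBracket 𝓘(ℝ, modelSpace p q) X Y J)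
      = matDeriv (fieldMat Y) J (X J) - matDeriv (fieldMat X) J (Y J) :=
  congrArg Matrix.of (mvfderiv_mlieBracket contMDiff_incl (hX.mdifferentiableAt (by simp))
    (hY.mdifferentiableAt (by simp)))

theorem trace_mul_mul_of_anticommute {J A : Matrix (Idx p q) (Idx p q) ℝ} (h : A * J = -(J * A))
    (D : Matrix (Idx p q) (Idx p q) ℝ) : (J * A * D).trace = -(J * D * A).trace := by
  rw [Matrix.trace_mul_comm, ← neg_neg (J * A), ← h, Matrix.mul_neg, Matrix.trace_neg,
    ← Matrix.mul_assoc, Matrix.trace_mul_comm, Matrix.mul_assoc]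

/-- Since tangent vectors at `J` anticommute with `J`, the terms with derivatives of vector fields
cancel in pairs, and the three remaining traces of triple products vanish. -/
theorem extDerivTwoForm_fundamentalForm (c : ℝ)
    {Z : ∀ J : Fpq p q, TangentSpace 𝓘(ℝ, modelSpace p q) J}
    (hX : ContMDiffAt 𝓘(ℝ, modelSpace p q) 𝓘(ℝ, modelSpace p q).tangent ∞
      (fun y => (⟨y, X y⟩ : TangentBundle 𝓘(ℝ, modelSpace p q) (Fpq p q))) J)
    (hY : ContMDiffAt 𝓘(ℝ, modelSpace p q) 𝓘(ℝ, modelSpace p q).tangent ∞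
      (fun y => (⟨y, Y y⟩ : TangentBundle 𝓘(ℝ, modelSpace p q) (Fpq p q))) J)
    (hZ : ContMDiffAt 𝓘(ℝ, modelSpace p q) 𝓘(ℝ, modelSpace p q).tangent ∞
      (fun y => (⟨y, Z y⟩ : TangentBundle 𝓘(ℝ, modelSpace p q) (Fpq p q))) J) :
    extDerivTwoForm (fundamentalForm (kahlerMetric p q c)) X Y Z J = 0 := by
  have hzero (U V W : modelSpace p q) : (dincl (W := modelSpace p q) J U
      * dincl (W := modelSpace p q) J V * dincl (W := modelSpace p q) J W).trace = 0 :=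
    trace_mul_mul_eq_zero (Fpq_mul_self J) (dincl_mem J U).2 (dincl_mem J V).2 (dincl_mem J W).2
  have hbr {X Y : ∀ J : Fpq p q, TangentSpace 𝓘(ℝ, modelSpace p q) J}
      (hX : ContMDiffAt 𝓘(ℝ, modelSpace p q) 𝓘(ℝ, modelSpace p q).tangent ∞
        (fun y => (⟨y, X y⟩ : TangentBundle 𝓘(ℝ, modelSpace p q) (Fpq p q))) J)
      (hY : ContMDiffAt 𝓘(ℝ, modelSpace p q) 𝓘(ℝ, modelSpace p q).tangent ∞
        (fun y => (⟨y, Y y⟩ : TangentBundle 𝓘(ℝ, modelSpace p q) (Fpq p q))) J)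
      (V : modelSpace p q) :
      fundamentalForm (kahlerMetric p q c) J
          (VectorField.mlieBracket 𝓘(ℝ, modelSpace p q) X Y J) V
        = c * (2 * (p + q) - 2) *
          ((J.1 * matDeriv (fieldMat Y) J (X J) * dincl (W := modelSpace p q) J V).trace
            - (J.1 * matDeriv (fieldMat X) J (Y J) * dincl (W := modelSpace p q) J V).trace) := by
    refine (fundamentalForm_apply c J _ V).trans ?_
    rw [dincl_mlieBracket hX hY, Matrix.mul_sub, Matrix.sub_mul, Matrix.trace_sub]
  have e1 := mvfderiv_fundamentalForm c hY hZ (X J)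
  have e2 := mvfderiv_fundamentalForm c hZ hX (Y J)
  have e3 := mvfderiv_fundamentalForm c hX hY (Z J)
  have e4 := hbr hX hY (Z J)
  have e5 := hbr hY hZ (X J)
  have e6 := hbr hZ hX (Y J)
  rw [hzero (X J) (Y J) (Z J), trace_mul_mul_of_anticommute (dincl_mem J (Y J)).2] at e1
  rw [hzero (Y J) (Z J) (X J), trace_mul_mul_of_anticommute (dincl_mem J (Z J)).2] at e2
  rw [hzero (Z J) (X J) (Y J), trace_mul_mul_of_anticommute (dincl_mem J (X J)).2] at e3
  rw [extDerivTwoForm]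
  refine (congrArg₂ (· - ·) (congrArg₂ (· - ·) (congrArg₂ (· - ·) (congrArg₂ (· + ·)
    (congrArg₂ (· + ·) e1 e2) e3) e4) e5) e6).trans ?_
  ring

theorem isPseudoKahler_kahlerMetric {c : ℝ} (hc : c ≠ 0) :
    IsPseudoKahler (kahlerMetric p q c) where
  smooth := contMDiff_pullbackBilin contMDiff_incl _
  symm J v w := by
    refine (kahlerMetric_apply c J v w).trans ?_
    rw [Matrix.trace_mul_comm]
    rfl
  nondegenerate J v h := kahlerMetric_nondegenerate hc J v h
  hermitian J v w := kahlerMetric_hermitian c J v w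
  closed _ _ _ _ hX hY hZ := extDerivTwoForm_fundamentalForm c hX hY hZ

/-! ### The symmetries -/

theorem toSO_smul_toSO_smul (J J' : Fpq p q) : J.toSO • J.toSO • J' = J' := by
  apply Subtype.ext
  rw [coe_smul_Fpq, coe_smul_Fpq, Fpq.matSO_toSO, Fpq.matSO_toSO_inv]
  calc J.1 * (J.1 * J'.1 * -J.1) * -J.1 = (J.1 * J.1) * J'.1 * (J.1 * J.1) := by
        simp only [Matrix.mul_assoc, Matrix.mul_neg, Matrix.neg_mul, neg_neg]
    _ = J'.1 := by rw [Fpq_mul_self]; simp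

theorem toSO_smul_self (J : Fpq p q) : J.toSO • J = J :=
  (smul_eq_self_iff _ _).2 rfl

/-- A fixed point `J'` of the symmetry at `J` commutes with `J`, so that `(J - J')(J + J') = 0`,
where `J + J'` is invertible for `J'` close to `J`. -/
theorem eventually_toSO_smul_ne (J : Fpq p q) : ∀ᶠ J' in 𝓝[≠] J, J.toSO • J' ≠ J' := by
  have hopen : IsOpen {J' : Fpq p q | (J.1 + J'.1).det ≠ 0} :=
    isOpen_ne_fun (continuous_const.add continuous_subtype_val).matrix_det continuous_const
  have hJ : (J.1 + J.1).det ≠ 0 := by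
    rw [← two_smul ℝ, Matrix.det_smul]
    exact mul_ne_zero (by positivity) (det_ne_zero_of_isometry (Fpq_isometry J))
  filter_upwards [nhdsWithin_le_nhds (hopen.mem_nhds hJ), self_mem_nhdsWithin] with J' h1 h2 h3
  apply h2
  rw [smul_eq_self_iff, Fpq.matSO_toSO] at h3
  have h4 : (J'.1 - J.1) * (J.1 + J'.1) = 0 := by
    rw [sub_mul, mul_add, mul_add, Fpq_mul_self, Fpq_mul_self, h3]
    abel
  apply Subtype.ext
  rw [← sub_eq_zero]
  exact mul_right_cancel_of_det_ne_zero h1 (h4.trans (Matrix.zero_mul _).symm)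

theorem mfderiv_toSO_smul (J : Fpq p q) (v : modelSpace p q) :
    (mfderiv 𝓘(ℝ, modelSpace p q) 𝓘(ℝ, modelSpace p q) (fun J' : Fpq p q => J.toSO • J') J v :
      modelSpace p q) = -v := by
  have hcongr {J' : Fpq p q} (h : J' = J) (u : modelSpace p q) :
      dincl (W := modelSpace p q) J' u = dincl (W := modelSpace p q) J u := by subst h; rfl
  have h1 := dincl_smul J.toSO J v
  rw [Fpq.matSO_toSO, Fpq.matSO_toSO_inv] at h1
  apply dincl_injective J
  refine ((hcongr (toSO_smul_self J) _).symm.trans h1).trans ?_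
  rw [Matrix.mul_neg, Matrix.mul_assoc, (dincl_mem J v).2, Matrix.mul_neg, neg_neg,
    ← Matrix.mul_assoc, Fpq_mul_self, Matrix.neg_mul, Matrix.one_mul, dincl_eq, dincl_eq, map_neg]
  simp

/-- The symmetry at `J` is the action of `J` itself, as an element of `SO_{2p,2q}`. -/
theorem isSymmetryAt_toSO_smul (c : ℝ) (J : Fpq p q) :
    IsSymmetryAt (kahlerMetric p q c) J (fun J' => J.toSO • J') where
  holomorphicIsometry := isHolomorphicIsometry_smul c _
  involutive := toSO_smul_toSO_smul J
  fixed := toSO_smul_self J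
  isolated := eventually_toSO_smul_ne J
  mfderiv_eq := mfderiv_toSO_smul J

/-! ### The quotient `SO_{2p,2q} / U_{p,q}` -/

instance instSigmaCompactSpaceSO : SigmaCompactSpace (SO p q) := by
  have h0 : SigmaCompactSpace (Matrix (Idx p q) (Idx p q) ℝ) :=
    inferInstanceAs (SigmaCompactSpace (Idx p q → Idx p q → ℝ))
  have h1 : Topology.IsClosedEmbedding
      (Subtype.val : Matrix.SpecialLinearGroup (Idx p q) ℝ → Matrix (Idx p q) (Idx p q) ℝ) :=
    (isClosed_eq continuous_id.matrix_det continuous_const).isClosedEmbedding_subtypeVal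
  have h2 : IsClosed (SO p q : Set (Matrix.SpecialLinearGroup (Idx p q) ℝ)) :=
    isClosed_eq ((continuous_subtype_val.matrix_transpose.matrix_mul
      continuous_const).matrix_mul continuous_subtype_val) continuous_const
  exact (h1.comp h2.isClosedEmbedding_subtypeVal).sigmaCompactSpace

/-- The orbit map at the base point is open, because a σ-compact group acts transitively on a
locally compact space. -/
theorem isOpenMap_smul_basePt : IsOpenMap (fun k : SO p q => k • basePt p q) := by
  have : LocallyCompactSpace (Fpq p q) := ChartedSpace.locallyCompactSpace (modelSpace p q) _
  exact isOpenMap_smul_of_sigmaCompact _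

/-- The map `k U_{p,q} ↦ k J_{p,q} k⁻¹`. -/
def quotientEquiv (p q : ℕ) : SO p q ⧸ Upq p q ≃ Fpq p q :=
  Equiv.ofBijective
    (Quotient.lift (fun k : SO p q => k • basePt p q) fun k l h => by
      have h' : k⁻¹ * l ∈ Upq p q := QuotientGroup.leftRel_apply.1 h
      rw [← stabilizer_basePt, MulAction.mem_stabilizer_iff, mul_smul, inv_smul_eq_iff] at h'
      exact h'.symm)
    ⟨by
      rintro ⟨k⟩ ⟨l⟩ h
      refine QuotientGroup.eq.2 ?_
      rw [← stabilizer_basePt, MulAction.mem_stabilizer_iff, mul_smul, inv_smul_eq_iff]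
      exact h.symm,
    fun J => ⟨QuotientGroup.mk (transporter J), transporter_smul J⟩⟩

theorem continuous_quotientEquiv : Continuous (quotientEquiv p q) :=
  Continuous.quotient_lift (continuous_id.smul continuous_const) _

theorem isOpenMap_quotientEquiv : IsOpenMap (quotientEquiv p q) := by
  intro U hU
  rw [← Set.image_preimage_eq U QuotientGroup.mk_surjective, ← Set.image_comp]
  exact isOpenMap_smul_basePt _ (hU.preimage QuotientGroup.continuous_mk)

/-- The homeomorphism `SO_{2p,2q} / U_{p,q} ≃ F_{p,q}`. -/
def quotientHomeo (p q : ℕ) : SO p q ⧸ Upq p q ≃ₜ Fpq p q :=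
  (quotientEquiv p q).toHomeomorphOfContinuousOpen continuous_quotientEquiv
    isOpenMap_quotientEquiv

theorem quotientHomeo_mk (k : SO p q) :
    quotientHomeo p q (QuotientGroup.mk k) = k • basePt p q := rfl

end

theorem mainTheorem7 (p q : ℕ) :
    -- `k ↦ J_{p,q} k J_{p,q}ᵀ` is an involutive automorphism of `SO_{2p,2q}`, with fixed
    -- subgroup `U_{p,q}`, and `F_{p,q}` is the quotient `SO_{2p,2q} / U_{p,q}`
    ∃ (σ : SO p q ≃* SO p q) (Φ : SO p q ⧸ Upq p q ≃ₜ Fpq p q),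
      (∀ k : SO p q, matSO (σ k) = Jpq p q * matSO k * (Jpq p q)ᵀ) ∧
      (∀ k : SO p q, σ (σ k) = k) ∧
      (∀ k : SO p q, σ k = k ↔ k ∈ Upq p q) ∧
      (∀ k : SO p q, (Φ (QuotientGroup.mk k)).1 = matSO k * Jpq p q * matSO k⁻¹) ∧
    -- `F_{p,q}` is a complex manifold, modelled on some `W` and embedded in the space of matrices
    ∃ (W : Type) (_ : NormedAddCommGroup W) (_ : NormedSpace ℂ W) (_ : FiniteDimensional ℂ W)
      (_ : ChartedSpace W (Fpq p q))
      (_ : IsManifold 𝓘(ℝ, W) ∞ (Fpq p q))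
      (_ : IsManifold 𝓘(ℂ, W) ω (Fpq p q)),
      Manifold.IsSmoothEmbedding 𝓘(ℝ, W) 𝓘(ℝ, Idx p q → Idx p q → ℝ) ∞
        (incl : Fpq p q → Idx p q → Idx p q → ℝ) ∧
      -- `T_J F_{p,q} = 𝔪_J`, and the complex structure is left multiplication by `J`
      (∀ J : Fpq p q, Set.range (dincl (W := W) J) = mSpace J.1) ∧
      (∀ (J : Fpq p q) (v : TangentSpace 𝓘(ℝ, W) J),
        dincl J (complexStructure J v) = J.1 * dincl J v) ∧
      -- every nonzero multiple of the Killing form induces an invariant metric on `F_{p,q}`,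
      -- and makes it a pseudo-Kähler symmetric space
      ∀ c : ℝ, c ≠ 0 → ∃ g : BilinField W (Fpq p q),
        (∀ (J : Fpq p q) (v w : TangentSpace 𝓘(ℝ, W) J)
          (A B : soLie p q), A.1 = dincl J v → B.1 = dincl J w →
          g J v w = c * killingForm ℝ (soLie p q) A B) ∧
        IsPseudoKahlerSymmetricSpace g ∧
        -- `SO_{2p,2q}` acts by holomorphic isometries
        (∀ k : SO p q, ∃ a : Fpq p q ≃ Fpq p q,
          (∀ J, (a J).1 = matSO k * J.1 * matSO k⁻¹) ∧ IsHolomorphicIsometry g a) ∧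
        -- the symmetry at the base point is induced by `σ`
        (∃ s : Fpq p q → Fpq p q, IsSymmetryAt g (Φ (QuotientGroup.mk 1)) s ∧
          ∀ k : SO p q, s (Φ (QuotientGroup.mk k)) = Φ (QuotientGroup.mk (σ k))) := by
  refine ⟨sigma p q, quotientHomeo p q, matSO_sigma, sigma_sigma, sigma_eq_self_iff,
    fun k => rfl, modelSpace p q, inferInstance, inferInstance, inferInstance, inferInstance,
    inferInstance, inferInstance, isSmoothEmbedding_incl, range_dincl, dincl_complexStructure,
    fun c hc => ⟨kahlerMetric p q c, kahlerMetric_eq_killingForm c,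
      ⟨isPseudoKahler_kahlerMetric hc, fun J => ⟨_, isSymmetryAt_toSO_smul c J⟩⟩,
      fun k => ⟨MulAction.toPerm k, fun J => rfl, isHolomorphicIsometry_smul c k⟩,
      fun J => (basePt p q).toSO • J, ?_, fun k => ?_⟩⟩
  · rw [quotientHomeo_mk, one_smul]
    exact isSymmetryAt_toSO_smul c (basePt p q)
  · rw [quotientHomeo_mk, quotientHomeo_mk, sigma_apply, mul_smul, mul_smul]
    congr 2
    rw [eq_inv_smul_iff, toSO_smul_self]
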